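/- For a finite-dimensional real vector space $E$ let $\mathbb{PE}(E)$ be the space of positive definite quadratic forms on $E$ up to positive factors, and $\mathbb{PE}_n=\mathbb{PE}(\mathbb R^n)=\mathrm{PGL}(n,\mathbb R)/\mathrm{PO}(n)$, with the Riemannian structure induced by $ds^2=\operatorname{tr}(dX\,X^{-1}dX\,X^{-1})$. For $m\ge 2$ let $\Delta_\circ^m$ be the set of sequences $\psi_1>\dots>\psi_m$ of reals modulo $\psi\mapsto a\psi+b$, $a>0$. *The set.* The set $\mathrm{Ass}(\mathbb{PE}(E))$ is defined by induction on $\dim E$: it is the disjoint union of $\mathbb{PE}(E)$ and, over all flags $E=W_0\supsetneq W_1\supsetneq\dots\supsetneq W_m=0$ with $m\ge2$, of the sets $\Delta_\circ^m\times\prod_{k=1}^m \mathrm{Ass}(\mathbb{PE}(W_{k-1}/W_k))$. The boundary points with all components in $\mathbb{PE}(W_{k-1}/W_k)$ and with $\{\operatorname{codim}W_k\}=I$ form the stratum $\mathfrak K(I)=\Delta_\circ(I)\times\mathbb S_n(I)$, where $\mathbb S_n(I)$ is the set of flags of type $I$ with a form, up to a positive factor, on each subquotient. For a fixed flag and $\psi\in\Delta^m_\circ$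 the product $\prod_k\mathbb{PE}(W_{k-1}/W_k)$ is called a boundary symmetric space; so are the analogous products of symmetric spaces (including unchanged factors) which arise at further steps of the induction. *Limits of geodesics.* A geodesic in $\mathbb{PE}(E)$ has in a suitable basis the form $\gamma(t)=\sum_i e^{\varphi_i t}x_i^2$. Let $\psi_1>\dots>\psi_m$ ($m\geq 2$) be the distinct values of the $\varphi_i$. The combinatorial limit of $\gamma$ is the boundary point given by the class of $\psi$ in $\Delta_\circ^m$, the flag $W_k=\{x_i=0 \text{ whenever } \varphi_i\ge\psi_k\}$ and the forms $\sum_{\varphi_i=\psi_k}x_i^2$ on $W_{k-1}/W_k$. The limit of a constant curve is its value; the combinatorial limit of a geodesic in a boundary symmetric space, i.e. in a product, is taken in each factor. **Theorem 5.1.** For each $n$ there exists a topology on $\mathrm{Ass}(\mathbb{PE}_n)$ such that: 1. $\mathrm{Ass}(\mathbb{PE}_n)$ is compact and metrizable, and $\mathbb{PE}_n$ with its usual topology is an open dense subspace. 2. For any geodesic $\gamma$ in $\mathbb{PE}_n$ or in any boundary symmetric space, the combinatorial limit of $\gamma$ exists, and $\lim_{t\to+\infty}\gamma(t)$ in this topology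 is the combinatorial limit. 3. The topology is that of the hybrid of the velocity compactification of $\mathbb{PE}_n$ associated with the permutoassociahedral completion of the Weyl chamber and of the Satake–Furstenberg compactification. That is, a sequence $X_j\in\mathbb{PE}_n$ with eigenvalues $e^{\varphi^{(j)}_1}\ge\dots\ge e^{\varphi^{(j)}_n}$ and corresponding orthonormal eigenvectors converges to $x\in\mathrm{Ass}(\mathbb{PE}_n)$ if and only if the following two conditions hold. (In the inductive description of $x$, each subquotient $A/B$ of $\mathbb R^n$ that occurs corresponds to the segment $\operatorname{codim}A<i\le\operatorname{codim}B$ of indices; it is called terminal if the component of $x$ there is a form, up to a factor, and not a boundary point.) (a) On the segment of each nonterminal subquotient, the vectors $(\varphi_i^{(j)})_i$, modulo constants, tend to infinity in the direction of the ray of the vector which equals $\psi_k$ on the segment of $W_{k-1}/W_k$, where $\psi$ and $W$ are the velocity and the flag of $x$ there; on the segment of each terminal subquotient $A/B$ they converge, modulo constants, to the logarithms of the eigenvalues, in decreasing order, of the form of $x$ on $A/B\cong A\cap B^\perp$. (b) For each terminal subquotient $A/B$, with form $Q$, the spans $W^{(j)}$ of the eigenvectors with the last $\dim A$ numbers converge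 to $A$, and the restrictions of $X_j$ to $W^{(j)}$, transferred to $A$ by the orthogonal projection $A\to W^{(j)}$ and multiplied by suitable positive factors, converge to the form $Q$ on $A$. -/

import Mathlib

open Filter Topology Module

noncomputable section

universe u

namespace Neretin

/-! ### The symmetric spaces `PE` -/

section Forms

variable (E : Type u) [AddCommGroup E] [Module ℝ E]

/-- Positive definite quadratic forms on a real vector space `E` (for `E = ℝⁿ` this is the space
of positive definite symmetric matrices `X`, read as the forms `vᵀ X v`). -/
def PosDefForm : Type u := {Q : QuadraticForm ℝ E // Q.PosDef}

/-- The usual topology of the space of positive definite forms on a finite-dimensional space: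
convergence of all values, equivalently of all matrix elements. -/
instance : TopologicalSpace (PosDefForm E) :=
  TopologicalSpace.induced (fun Q v => Q.1 v) (Pi.topologicalSpace : TopologicalSpace (E → ℝ))

/-- Proportionality of positive definite forms, with a positive factor. -/
instance posDefSetoid : Setoid (PosDefForm E) where
  r Q R := ∃ a : ℝ, 0 < a ∧ ∀ v, R.1 v = a * Q.1 v
  iseqv :=
    { refl := fun _ => ⟨1, one_pos, fun _ => (one_mul _).symm⟩
      symm := by
        rintro Q R ⟨a, ha, h⟩
        exact ⟨a⁻¹, inv_pos.2 ha, fun v => by rw [h v, inv_mul_cancel_left₀ ha.ne']⟩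
      trans := by
        rintro Q R S ⟨a, ha, h⟩ ⟨b, hb, h'⟩
        exact ⟨b * a, mul_pos hb ha, fun v => by rw [h' v, h v, mul_assoc]⟩ }

/-- `PE(E)`: positive definite quadratic forms on `E`, up to a positive factor, with the quotient
topology. `PE(ℝⁿ) = PGL(n, ℝ) / PO(n)`. -/
def PE : Type u := Quotient (posDefSetoid E)

instance : TopologicalSpace (PE E) :=
  inferInstanceAs (TopologicalSpace (Quotient (posDefSetoid E)))

variable {E}

/-- The point of `PE(E)` represented by a form. -/
def PE.mk (Q : PosDefForm E) : PE E := Quotient.mk (posDefSetoid E) Q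

/-- Geodesics `X(t)`, `t ∈ ℝ`, in an affine parameter, of the space of positive definite matrices
with the Riemannian metric `ds² = tr (dX X⁻¹ dX X⁻¹)`: the geodesic equation of this metric is
`X'' = X' X⁻¹ X'`. Constant curves are allowed. -/
def IsMatrixGeodesic {d : ℕ} (X : ℝ → Matrix (Fin d) (Fin d) ℝ) : Prop :=
  (∀ t, (X t).PosDef) ∧
    ∃ X' : ℝ → Matrix (Fin d) (Fin d) ℝ,
      (∀ t i j, HasDerivAt (fun s => X s i j) (X' t i j) t) ∧
        ∀ t i j, HasDerivAt (fun s => X' s i j) ((X' t * (X t)⁻¹ * X' t) i j) t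

/-- Geodesics in `PE(E)`, in an affine parameter: images of geodesics in the space of positive
definite matrices, with respect to some (equivalently, any) basis of `E`. Constant curves are
allowed, since they occur as components of geodesics in products. -/
def IsGeodesic (c : ℝ → PE E) : Prop :=
  ∃ (d : ℕ) (b : Basis (Fin d) ℝ E) (X : ℝ → Matrix (Fin d) (Fin d) ℝ) (Q : ℝ → PosDefForm E),
    IsMatrixGeodesic X ∧
      (∀ t v, (Q t).1 v = ∑ i, ∑ j, X t i j * b.repr v i * b.repr v j) ∧
        ∀ t, c t = PE.mk (Q t)

end Forms

/-! ### Velocities -/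

/-- Two strictly decreasing sequences of length `m` represent the same velocity if they differ by
`ψ ↦ a ψ + b` with `a > 0`. -/
instance velocitySetoid (m : ℕ) : Setoid {ψ : Fin m → ℝ // StrictAnti ψ} where
  r ψ χ := ∃ a b : ℝ, 0 < a ∧ ∀ k, χ.1 k = a * ψ.1 k + b
  iseqv :=
    { refl := fun _ => ⟨1, 0, one_pos, fun _ => by ring⟩
      symm := by
        rintro ψ χ ⟨a, b, ha, h⟩
        refine ⟨a⁻¹, -(a⁻¹ * b), inv_pos.2 ha, fun k => ?_⟩
        rw [h k]
        field_simp
        ring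
      trans := by
        rintro ψ χ ω ⟨a, b, ha, h⟩ ⟨a', b', ha', h'⟩
        exact ⟨a' * a, a' * b + b', mul_pos ha' ha, fun k => by rw [h' k, h k]; ring⟩ }

/-- The open simplex `Δ∘` of collections `ψ₁ > ψ₂ > … > ψ_m` modulo `ψ ↦ a ψ + b`, `a > 0`. -/
def Simplex (m : ℕ) : Type := Quotient (velocitySetoid m)

/-- The point of the simplex represented by a decreasing sequence. -/
def Simplex.mk {m : ℕ} (ψ : Fin m → ℝ) (hψ : StrictAnti ψ) : Simplex m :=
  Quotient.mk (velocitySetoid m) ⟨ψ, hψ⟩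

/-! ### Flags and the associahedral compactification as a set -/

section Compactification

variable {V : Type u} [AddCommGroup V] [Module ℝ V]

/-- The subquotient `A / B` of `V`, for subspaces `B ⊆ A ⊆ V`. -/
abbrev SubQ (A B : Submodule ℝ V) : Type u := A ⧸ B.submoduleOf A

/-- The class in `A / B` of a vector of `A`. -/
abbrev cls {A : Submodule ℝ V} (B : Submodule ℝ V) (v : A) : SubQ A B :=
  Submodule.Quotient.mk v

/-- Flags `A = W₀ ⊃ W₁ ⊃ … ⊃ W_m = B` with `m` nonzero subquotients; equivalently, flags in the
space `A / B`. The set `I` of the dimensions `dim A / W_k` is determined by the flag. -/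
structure Flag (A B : Submodule ℝ V) (m : ℕ) where
  W : Fin (m + 1) → Submodule ℝ V
  strictAnti : StrictAnti W
  first : W 0 = A
  last : W (Fin.last m) = B

/-- The associahedral compactification of `PE(A / B)`, as a set. Its points are
* the points of `PE(A / B)`;
* for each flag `A = W₀ ⊃ … ⊃ W_m = B` with `m ≥ 2` and each velocity `v ∈ Δ∘`, the points of the
  product of the compactifications of the `PE(W_k / W_{k+1})`.

Those boundary points all whose components lie in the `PE(W_k / W_{k+1})` themselves, with the
`dim A / W_k` prescribed by `I`, form the stratum `Δ∘(I) × S(I)`. A flag in a subquotient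
`W_k / W_{k+1}` is written as a flag of subspaces between `W_k` and `W_{k+1}`. -/
inductive Ass : Submodule ℝ V → Submodule ℝ V → Type u
  | interior {A B : Submodule ℝ V} (q : PE (SubQ A B)) : Ass A B
  | boundary {A B : Submodule ℝ V} (m : ℕ) (hm : 2 ≤ m) (F : Flag A B m) (v : Simplex m)
      (x : ∀ k : Fin m, Ass (F.W k.castSucc) (F.W k.succ)) : Ass A B

/-! ### Limits of geodesics, in terms of boundary data -/

/-- The limit of a geodesic `c` of `PE(A / B)`, as `t → +∞`, in terms of its boundary data. A
constant curve has its value as its limit. A nonconstant geodesic is, in a suitable basis of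
`A / B`, the diagonal one `Q(t) = ∑ i, e^{φ_i t} x_i²`; let `ψ₀ > … > ψ_{m-1}` be the distinct values
of the `φ_i`, so `φ_i = ψ_{κ(i)}`. Its velocity is the class of `ψ`; its limit in the Semple–Satake
space has the flag `W_k = {x_i = 0 if κ(i) < k}` and on `W_k / W_{k+1}` the form
`∑_{κ(i) = k} x_i²`. These data together are the point of the boundary. -/
def IsGeodesicLimit {A B : Submodule ℝ V} (c : ℝ → PE (SubQ A B)) (x : Ass A B) : Prop :=
  (∃ q, (∀ t, c t = q) ∧ x = Ass.interior q) ∨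
  ∃ (m : ℕ) (hm : 2 ≤ m) (ψ : Fin m → ℝ) (hψ : StrictAnti ψ)
    (d : ℕ) (b : Basis (Fin d) ℝ (SubQ A B)) (κ : Fin d → Fin m)
    (Q : ℝ → PosDefForm (SubQ A B)) (F : Flag A B m)
    (q : ∀ k : Fin m, PosDefForm (SubQ (F.W k.castSucc) (F.W k.succ))),
    (∀ t v, (Q t).1 v = ∑ i, Real.exp (ψ (κ i) * t) * b.repr v i ^ 2) ∧
    (∀ t, c t = PE.mk (Q t)) ∧
    (∀ (k : Fin (m + 1)) (v : A),
      (v : V) ∈ F.W k ↔ ∀ i, (κ i : ℕ) < k → b.repr (cls B v) i = 0) ∧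
    (∀ (k : Fin m) (v : V) (hA : v ∈ A) (hW : v ∈ F.W k.castSucc),
      (q k).1 (cls (F.W k.succ) ⟨v, hW⟩) =
        ∑ i with κ i = k, b.repr (cls B ⟨v, hA⟩) i ^ 2) ∧
    x = Ass.boundary m hm F (Simplex.mk ψ hψ) fun k => Ass.interior (PE.mk (q k))

/-- Curves in the compactification which are geodesics in `PE(A / B)` or in a boundary symmetric
space, that is, in a fibre `∏ PE(W_k / W_{k+1})` for a fixed flag and velocity, or in such a fibre
arising at any further step of the inductive construction. A curve in a product is a geodesic if
its components are geodesics in affine parameters; some of them may be constant. -/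
inductive IsAssGeodesic : ∀ {A B : Submodule ℝ V}, (ℝ → Ass A B) → Prop
  | interior {A B : Submodule ℝ V} (c : ℝ → PE (SubQ A B)) (hc : IsGeodesic c) :
      IsAssGeodesic (fun t => Ass.interior (c t))
  | boundary {A B : Submodule ℝ V} (m : ℕ) (hm : 2 ≤ m) (F : Flag A B m) (v : Simplex m)
      (γ : ∀ k : Fin m, ℝ → Ass (F.W k.castSucc) (F.W k.succ))
      (hγ : ∀ k, IsAssGeodesic (γ k)) :
      IsAssGeodesic (fun t => Ass.boundary m hm F v fun k => γ k t)

/-- The limit, in terms of boundary data, of a geodesic in `PE(A / B)` or in a boundary symmetric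
space: in a product it is taken in each factor separately. -/
inductive IsAssLimit : ∀ {A B : Submodule ℝ V}, (ℝ → Ass A B) → Ass A B → Prop
  | interior {A B : Submodule ℝ V} (c : ℝ → PE (SubQ A B)) (x : Ass A B)
      (h : IsGeodesicLimit c x) : IsAssLimit (fun t => Ass.interior (c t)) x
  | boundary {A B : Submodule ℝ V} (m : ℕ) (hm : 2 ≤ m) (F : Flag A B m) (v : Simplex m)
      (γ : ∀ k : Fin m, ℝ → Ass (F.W k.castSucc) (F.W k.succ))
      (x : ∀ k : Fin m, Ass (F.W k.castSucc) (F.W k.succ))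
      (h : ∀ k, IsAssLimit (γ k) (x k)) :
      IsAssLimit (fun t => Ass.boundary m hm F v fun k => γ k t) (Ass.boundary m hm F v x)

end Compactification

/-! ### Convergence of velocities and convergence in the Semple–Satake space -/

section Hybrid

variable {V : Type u} [NormedAddCommGroup V] [InnerProductSpace ℝ V]

/-- If the eigenvalues on `V` are numbered from `0` in decreasing order, the segment of numbers
that belongs to the subquotient `A / B`: `codim A ≤ i < codim B`. -/
def block (A B : Submodule ℝ V) : Finset (Fin (finrank ℝ V)) :=
  {i | finrank ℝ V ≤ i + finrank ℝ A ∧ i + finrank ℝ B < finrank ℝ V}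

/-- `e_i`, `i ∈ block A B`, is an orthonormal basis of `A ∩ Bᗮ ≅ A / B` that diagonalizes `Q`, and
the corresponding eigenvalues of `Q` are `exp (μ_i)`, in decreasing order. -/
structure IsEigenbasis {A B : Submodule ℝ V} (Q : PosDefForm (SubQ A B))
    (e : Fin (finrank ℝ V) → V) (μ : Fin (finrank ℝ V) → ℝ) : Prop where
  mem : ∀ i ∈ block A B, e i ∈ A ∧ e i ∈ Bᗮ
  orthonormal : ∀ i ∈ block A B, ∀ j ∈ block A B, inner ℝ (e i) (e j) = if i = j then (1 : ℝ) else 0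
  antitone : ∀ i ∈ block A B, ∀ j ∈ block A B, i ≤ j → μ j ≤ μ i
  diag : ∀ v : A, Q.1 (cls B v) = ∑ i ∈ block A B, Real.exp (μ i) * inner ℝ (e i) (v : V) ^ 2

/-- Convergence of a sequence of points `φ_j` of the Weyl chamber (decreasing vectors modulo
constants) in the permutoassociahedral compactification of the chamber, to the velocity point of
`x`. At each boundary step the coordinates of the current segment, modulo constants, tend to
infinity in the direction of the ray of `ψ`, and the process goes on with the segments on which
this ray is constant; in a terminal segment the coordinates, modulo constants, converge to the
logarithms of the eigenvalues of the form that `x` has there. -/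
def VelocityTendsto (φ : ℕ → Fin (finrank ℝ V) → ℝ) :
    ∀ {A B : Submodule ℝ V}, Ass A B → Prop
  | A, B, .interior q =>
      ∃ (Q : PosDefForm (SubQ A B)) (e : Fin (finrank ℝ V) → V) (μ : Fin (finrank ℝ V) → ℝ),
        q = PE.mk Q ∧ IsEigenbasis Q e μ ∧
          ∀ i ∈ block A B, ∀ i' ∈ block A B,
            Tendsto (fun j => φ j i - φ j i') atTop (𝓝 (μ i - μ i'))
  | _, _, .boundary m _ F v x =>
      (∃ (ψ : Fin m → ℝ) (hψ : StrictAnti ψ) (s : ℕ → ℝ),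
        v = Simplex.mk ψ hψ ∧ Tendsto s atTop atTop ∧
          ∀ (k k' : Fin m), ∀ i ∈ block (F.W k.castSucc) (F.W k.succ),
            ∀ i' ∈ block (F.W k'.castSucc) (F.W k'.succ),
              Tendsto (fun j => (φ j i - φ j i') / s j) atTop (𝓝 (ψ k - ψ k'))) ∧
      ∀ k, VelocityTendsto φ (x k)

/-- The span of the last `dim A` vectors of an eigenbasis. -/
def eigenTail (e : Fin (finrank ℝ V) → V) (A : Submodule ℝ V) : Submodule ℝ V :=
  Submodule.span ℝ (e '' {i | finrank ℝ V ≤ i + finrank ℝ A})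

variable [FiniteDimensional ℝ V]

/-- Convergence of a sequence of forms `X_j` on `V` with eigenbases `e_j`, in the Semple–Satake
space, to the point consisting of the flag of all the terminal subquotients `A / B` of `x` and of
the forms `Q` on them: the spans `W⁽ʲ⁾` of the eigenvectors of the `dim A` smallest eigenvalues
converge to `A`, and the restrictions of `X_j` to `W⁽ʲ⁾`, suitably normalized, converge to the
form `Q` (pulled back to `A`). Here `W⁽ʲ⁾` is compared with `A` by means of the orthogonal
projection. -/
def SatakeTendsto (X : ℕ → PosDefForm (SubQ (⊤ : Submodule ℝ V) ⊥))
    (e : ℕ → Fin (finrank ℝ V) → V) : ∀ {A B : Submodule ℝ V}, Ass A B → Prop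
  | A, B, .interior q =>
      ∃ (Q : PosDefForm (SubQ A B)) (a : ℕ → ℝ), q = PE.mk Q ∧ (∀ j, 0 < a j) ∧
        ∀ v : A,
          Tendsto (fun j => (eigenTail (e j) A).starProjection (v : V)) atTop (𝓝 (v : V)) ∧
          Tendsto
            (fun j => a j * (X j).1 (cls ⊥ ⟨(eigenTail (e j) A).starProjection (v : V), trivial⟩))
            atTop (𝓝 (Q.1 (cls B v)))
  | _, _, .boundary _ _ _ _ x => ∀ k, SatakeTendsto X e (x k)

end Hybrid

/-- `ℝⁿ` as a subquotient of itself. -/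
abbrev Full (n : ℕ) : Type :=
  SubQ (⊤ : Submodule ℝ (EuclideanSpace ℝ (Fin n))) ⊥

/-- The associahedral compactification `Ass(PE_n)`, as a set. -/
abbrev AssPE (n : ℕ) : Type :=
  Ass (⊤ : Submodule ℝ (EuclideanSpace ℝ (Fin n))) ⊥

end Neretin

end

noncomputable section

namespace Neretin

set_option linter.unusedSectionVars false

section Frames

variable {V : Type u} [NormedAddCommGroup V] [InnerProductSpace ℝ V]

/-- The number `i` precedes the segment of numbers that belong to the subspace `A`. -/
def Before (A : Submodule ℝ V) (i : Fin (finrank ℝ V)) : Prop :=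
  i + finrank ℝ A < finrank ℝ V

lemma mem_block {A B : Submodule ℝ V} {i : Fin (finrank ℝ V)} :
    i ∈ block A B ↔ ¬ Before A i ∧ Before B i := by
  simp [block, Before]

lemma Before.mono {A B : Submodule ℝ V} [FiniteDimensional ℝ V] (h : B ≤ A)
    {i : Fin (finrank ℝ V)} (hi : Before A i) : Before B i := by
  have := Submodule.finrank_mono h
  unfold Before at *
  omega

lemma Before.of_le {A : Submodule ℝ V} {i j : Fin (finrank ℝ V)} (hij : i ≤ j) (hj : Before A j) :
    Before A i := by
  unfold Before at *
  have : (i : ℕ) ≤ j := hij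
  omega

lemma before_bot (i : Fin (finrank ℝ V)) : Before (⊥ : Submodule ℝ V) i := by
  simp [Before]

lemma not_before_top (i : Fin (finrank ℝ V)) : ¬ Before (⊤ : Submodule ℝ V) i := by
  simp [Before]

lemma mem_block_top_bot (i : Fin (finrank ℝ V)) : i ∈ block (⊤ : Submodule ℝ V) ⊥ :=
  mem_block.2 ⟨not_before_top i, before_bot i⟩

variable [FiniteDimensional ℝ V]

lemma block_nonempty {A B : Submodule ℝ V} (h : B < A) : (block A B).Nonempty := by
  have h1 := Submodule.finrank_lt_finrank_of_lt h
  have h2 := Submodule.finrank_le A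
  refine ⟨⟨finrank ℝ V - finrank ℝ A, by omega⟩, mem_block.2 ⟨?_, ?_⟩⟩ <;> simp only [Before] <;> omega

variable {e f : Fin (finrank ℝ V) → V}

/-- The orthonormal basis given by a full orthonormal family. -/
def frameBasis (he : Orthonormal ℝ e) : OrthonormalBasis (Fin (finrank ℝ V)) ℝ V :=
  OrthonormalBasis.mk he
    (he.linearIndependent.span_eq_top_of_card_eq_finrank' (by simp)).ge

lemma frameBasis_apply (he : Orthonormal ℝ e) (i) : frameBasis he i = e i := by
  simp [frameBasis]

lemma frame_sum (he : Orthonormal ℝ e) (v : V) : ∑ i, inner ℝ (e i) v • e i = v := by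
  simpa [frameBasis_apply] using (frameBasis he).sum_repr' v

lemma frame_inner (he : Orthonormal ℝ e) (v w : V) :
    ∑ i, inner ℝ (e i) v * inner ℝ (e i) w = inner ℝ v w := by
  have := (frameBasis he).sum_inner_mul_inner v w
  simp only [frameBasis_apply] at this
  rw [← this]
  exact Finset.sum_congr rfl fun i _ => by rw [real_inner_comm v]

lemma frame_normSq (he : Orthonormal ℝ e) (v : V) :
    ∑ i, inner ℝ (e i) v ^ 2 = ‖v‖ ^ 2 := by
  rw [← real_inner_self_eq_norm_sq, ← frame_inner he]
  exact Finset.sum_congr rfl fun i _ => sq _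

lemma frame_ext (he : Orthonormal ℝ e) {v w : V} (h : ∀ i, inner ℝ (e i) v = inner ℝ (e i) w) :
    v = w := by
  rw [← frame_sum he v, ← frame_sum he w]
  simp [h]

lemma frame_inner_self (he : Orthonormal ℝ e) (i j) :
    inner ℝ (e i) (e j) = if i = j then (1 : ℝ) else 0 :=
  orthonormal_iff_ite.1 he i j

lemma inner_frame_sum (he : Orthonormal ℝ e) (c : Fin (finrank ℝ V) → ℝ) (i) :
    inner ℝ (e i) (∑ j, c j • e j) = c i := by
  simp [inner_sum, inner_smul_right, frame_inner_self he]

/-! ### Subspaces adapted to a frame -/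

/-- The subspace `A` is spanned by the last `dim A` vectors of the frame. -/
def Adp (e : Fin (finrank ℝ V) → V) (A : Submodule ℝ V) : Prop :=
  ∀ v, v ∈ A ↔ ∀ i, Before A i → inner ℝ (e i) v = 0

lemma mem_eigenTail (he : Orthonormal ℝ e) (A : Submodule ℝ V) (v : V) :
    v ∈ eigenTail e A ↔ ∀ i, Before A i → inner ℝ (e i) v = 0 := by
  constructor
  · intro hv i hi
    have : eigenTail e A ≤ LinearMap.ker (innerₛₗ ℝ (e i)) := by
      refine Submodule.span_le.2 ?_
      rintro _ ⟨j, hj, rfl⟩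
      have hij : i ≠ j := by
        rintro rfl
        exact absurd hi (by simpa [Before] using hj)
      simp [frame_inner_self he, hij]
    simpa using this hv
  · intro h
    rw [← frame_sum he v]
    refine Submodule.sum_mem _ fun i _ => ?_
    by_cases hi : Before A i
    · simp [h i hi]
    · exact Submodule.smul_mem _ _ (Submodule.subset_span ⟨i, by simpa [Before] using hi, rfl⟩)

/-- The span of the vectors of a frame with numbers at least `a`. -/
def tail (e : Fin (finrank ℝ V) → V) (a : ℕ) : Submodule ℝ V :=
  Submodule.span ℝ (e '' {i | a ≤ i})

lemma finrank_tail (he : Orthonormal ℝ e) (a : ℕ) :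
    finrank ℝ (tail e a) = finrank ℝ V - a := by
  classical
  let s : Finset (Fin (finrank ℝ V)) := {i | a ≤ i}
  have h1 : tail e a = Submodule.span ℝ (Set.range fun i : s => e i) := by
    unfold tail
    congr 1
    ext v
    simp [s]
  have h3 := finrank_span_eq_card (b := fun i : s => e i)
    (he.linearIndependent.comp _ Subtype.val_injective)
  rw [h1, h3]
  have : s.card = finrank ℝ V - a := by
    let T : Fin (finrank ℝ V - a) ↪ Fin (finrank ℝ V) :=
      ⟨fun i => ⟨i + a, by omega⟩, fun i j h => by
        simp only [Fin.mk.injEq] at h; ext; omega⟩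
    have hT : ∀ j, ((T j : Fin (finrank ℝ V)) : ℕ) = j + a := fun _ => rfl
    have hs : s = Finset.univ.map T := by
      ext i
      simp only [s, Finset.mem_filter, Finset.mem_univ, true_and, Finset.mem_map]
      constructor
      · intro h
        refine ⟨⟨i - a, by omega⟩, ?_⟩
        ext
        simp only [hT]
        omega
      · rintro ⟨j, rfl⟩
        simp only [hT]
        omega
    rw [hs]; simp
  simpa using this

lemma finrank_eigenTail (he : Orthonormal ℝ e) (A : Submodule ℝ V) :
    finrank ℝ (eigenTail e A) = finrank ℝ A := by
  have h2 := Submodule.finrank_le A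
  have h1 : eigenTail e A = tail e (finrank ℝ V - finrank ℝ A) := by
    unfold eigenTail tail
    congr 2
    ext i
    simp
  rw [h1, finrank_tail he]
  omega

lemma adp_iff (he : Orthonormal ℝ e) (A : Submodule ℝ V) : Adp e A ↔ eigenTail e A = A := by
  constructor
  · intro h
    ext v
    rw [mem_eigenTail he, h v]
  · intro h v
    rw [← mem_eigenTail he, h]

lemma adp_of_le (he : Orthonormal ℝ e) {A : Submodule ℝ V}
    (h : ∀ v ∈ A, ∀ i, Before A i → inner ℝ (e i) v = 0) : Adp e A := by
  rw [adp_iff he]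
  exact (Submodule.eq_of_le_of_finrank_eq (fun v hv => (mem_eigenTail he A v).2 (h v hv))
    (finrank_eigenTail he A).symm).symm

lemma adp_of_mem (he : Orthonormal ℝ e) {A : Submodule ℝ V}
    (h : ∀ i, ¬ Before A i → e i ∈ A) : Adp e A := by
  rw [adp_iff he]
  refine Submodule.eq_of_le_of_finrank_eq (Submodule.span_le.2 ?_) (finrank_eigenTail he A)
  rintro _ ⟨i, hi, rfl⟩
  exact h i (by simpa [Before] using hi)

lemma Adp.mem (he : Orthonormal ℝ e) {A : Submodule ℝ V} (h : Adp e A) {i}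
    (hi : ¬ Before A i) : e i ∈ A := by
  rw [h]
  intro j hj
  rw [frame_inner_self he, if_neg]
  rintro rfl
  exact hi hj

lemma Adp.mem_orthogonal {A : Submodule ℝ V} (h : Adp e A) {i}
    (hi : Before A i) : e i ∈ Aᗮ := by
  rw [Submodule.mem_orthogonal']
  exact fun v hv => (h v).1 hv i hi

lemma adp_top (e : Fin (finrank ℝ V) → V) : Adp e (⊤ : Submodule ℝ V) := fun v => by
  simp [not_before_top]

lemma adp_bot (he : Orthonormal ℝ e) : Adp e (⊥ : Submodule ℝ V) := fun v => by
  simp only [Submodule.mem_bot, before_bot, forall_true_left]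
  exact ⟨fun h => by simp [h], fun h => frame_ext he (by simpa using h)⟩

open Classical in
lemma starProjection_eigenTail (he : Orthonormal ℝ e) (A : Submodule ℝ V) (v : V) :
    (eigenTail e A).starProjection v =
      ∑ i, (if Before A i then 0 else inner ℝ (e i) v) • e i := by
  apply Submodule.eq_starProjection_of_mem_orthogonal
  · rw [mem_eigenTail he]
    intro i hi
    rw [inner_frame_sum he, if_pos hi]
  · rw [Submodule.mem_orthogonal']
    intro w hw
    rw [mem_eigenTail he] at hw
    rw [← frame_inner he]
    refine Finset.sum_eq_zero fun i _ => ?_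
    by_cases hi : Before A i
    · simp [hw i hi]
    · rw [inner_sub_right, inner_frame_sum he, if_neg hi]
      simp

/-! ### Operators diagonal in a frame -/

/-- The operator `∑ i, c_i ⟨e_i, ·⟩ e_i`. -/
def diagOp (e : Fin (finrank ℝ V) → V) (c : Fin (finrank ℝ V) → ℝ) : V →L[ℝ] V :=
  ∑ i, c i • (innerSL ℝ (e i)).smulRight (e i)

lemma diagOp_apply (c : Fin (finrank ℝ V) → ℝ) (v : V) :
    diagOp e c v = ∑ i, (c i * inner ℝ (e i) v) • e i := by
  simp [diagOp, smul_smul]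

lemma inner_diagOp (he : Orthonormal ℝ e) (c : Fin (finrank ℝ V) → ℝ) (v : V) (i) :
    inner ℝ (e i) (diagOp e c v) = c i * inner ℝ (e i) v := by
  rw [diagOp_apply, inner_frame_sum he]

lemma inner_diagOp_self (c : Fin (finrank ℝ V) → ℝ) (v : V) :
    inner ℝ (diagOp e c v) v = ∑ i, c i * inner ℝ (e i) v ^ 2 := by
  rw [diagOp_apply, sum_inner]
  refine Finset.sum_congr rfl fun i _ => ?_
  rw [real_inner_smul_left]; ring

lemma inner_diagOp_comm (c : Fin (finrank ℝ V) → ℝ) (v w : V) :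
    inner ℝ (diagOp e c v) w = inner ℝ v (diagOp e c w) := by
  rw [diagOp_apply, diagOp_apply, sum_inner, inner_sum]
  refine Finset.sum_congr rfl fun i _ => ?_
  rw [real_inner_smul_left, real_inner_smul_right, real_inner_comm v]; ring

lemma diagOp_eq_of_quadratic {c c' : Fin (finrank ℝ V) → ℝ}
    (h : ∀ v, inner ℝ (diagOp e c v) v = inner ℝ (diagOp f c' v) v) : diagOp e c = diagOp f c' := by
  have key : ∀ v w, inner ℝ (diagOp e c v) w = inner ℝ (diagOp f c' v) w := by
    intro v w
    have h1 := h (v + w)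
    simp only [map_add, inner_add_left, inner_add_right, h v, h w] at h1
    have h2 : inner ℝ (diagOp e c w) v = inner ℝ (diagOp e c v) w := by
      rw [inner_diagOp_comm, real_inner_comm]
    have h3 : inner ℝ (diagOp f c' w) v = inner ℝ (diagOp f c' v) w := by
      rw [inner_diagOp_comm, real_inner_comm]
    linarith
  ext v
  exact ext_inner_right ℝ (key v)

lemma weight_eq_of_diagOp_eq (he : Orthonormal ℝ e) (hf : Orthonormal ℝ f)
    {c c' : Fin (finrank ℝ V) → ℝ} (h : diagOp e c = diagOp f c') {l i}
    (hli : inner ℝ (e l) (f i) ≠ (0 : ℝ)) : c l = c' i := by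
  have h1 := inner_diagOp he c (f i) l
  have h2 : diagOp f c' (f i) = c' i • f i := by
    refine frame_ext hf fun j => ?_
    rw [inner_diagOp hf, real_inner_smul_right, frame_inner_self hf]
    by_cases hj : j = i <;> simp [hj]
  rw [h, h2, real_inner_smul_right] at h1
  exact mul_right_cancel₀ hli h1.symm

/-- Functional calculus: operators with equal diagonalizations have equal functions. -/
lemma diagOp_congr (he : Orthonormal ℝ e) (hf : Orthonormal ℝ f)
    {c c' : Fin (finrank ℝ V) → ℝ} (h : ∀ l i, inner ℝ (e l) (f i) ≠ (0 : ℝ) → c l = c' i) :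
    diagOp e c = diagOp f c' := by
  have key : ∀ i, diagOp e c (f i) = c' i • f i := by
    intro i
    refine frame_ext he fun l => ?_
    rw [inner_diagOp he, real_inner_smul_right]
    by_cases hl : inner ℝ (e l) (f i) = (0 : ℝ)
    · simp [hl]
    · rw [h l i hl]
  ext v
  conv_lhs => rw [← frame_sum hf v]
  rw [map_sum, diagOp_apply]
  refine Finset.sum_congr rfl fun i _ => ?_
  rw [map_smul, key, smul_smul, mul_comm]

lemma tendsto_diagOp {ι : Type*} {l : Filter ι} {E : ι → Fin (finrank ℝ V) → V}
    {C : ι → Fin (finrank ℝ V) → ℝ} {c : Fin (finrank ℝ V) → ℝ}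
    (hE : ∀ i, Tendsto (fun j => E j i) l (𝓝 (e i)))
    (hC : ∀ i, Tendsto (fun j => C j i) l (𝓝 (c i))) :
    Tendsto (fun j => diagOp (E j) (C j)) l (𝓝 (diagOp e c)) := by
  unfold diagOp
  refine tendsto_finsetSum _ fun i _ => (hC i).smul ?_
  have : Continuous fun v : V => (innerSL ℝ v).smulRight v := by
    have h : Continuous fun p : StrongDual ℝ V × V =>
        ContinuousLinearMap.smulRightL ℝ V V p.1 p.2 :=
      (ContinuousLinearMap.smulRightL ℝ V V).continuous₂
    exact h.comp ((innerSL ℝ).continuous.prodMk continuous_id)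
  exact (this.tendsto _).comp (hE i)

lemma norm_diagOp_le (he : Orthonormal ℝ e) {c : Fin (finrank ℝ V) → ℝ} {C : ℝ}
    (hc : ∀ i, |c i| ≤ C) : ‖diagOp e c‖ ≤ finrank ℝ V * C := by
  unfold diagOp
  refine (norm_sum_le _ _).trans ?_
  have : ∀ i ∈ (Finset.univ : Finset (Fin (finrank ℝ V))),
      ‖c i • (innerSL ℝ (e i)).smulRight (e i)‖ ≤ C := by
    intro i _
    rw [norm_smul, ContinuousLinearMap.norm_smulRight_apply, innerSL_apply_norm, he.1 i]
    simpa using hc i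
  simpa using Finset.sum_le_sum this

lemma tendsto_diagOp_of_quadratic {ι : Type*} {l : Filter ι} {E : ι → Fin (finrank ℝ V) → V}
    {C : ι → Fin (finrank ℝ V) → ℝ} {c : Fin (finrank ℝ V) → ℝ}
    (h : ∀ v, Tendsto (fun j => inner ℝ (diagOp (E j) (C j) v) v) l
      (𝓝 (inner ℝ (diagOp e c v) v))) :
    Tendsto (fun j => diagOp (E j) (C j)) l (𝓝 (diagOp e c)) := by
  have key : ∀ v w, Tendsto (fun j => inner ℝ (diagOp (E j) (C j) v) w) l
      (𝓝 (inner ℝ (diagOp e c v) w)) := by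
    intro v w
    have pol : ∀ (e' : Fin (finrank ℝ V) → V) c', inner ℝ (diagOp e' c' v) w =
        2⁻¹ * (inner ℝ (diagOp e' c' (v + w)) (v + w) - inner ℝ (diagOp e' c' v) v
          - inner ℝ (diagOp e' c' w) w) := by
      intro e' c'
      have h2 : inner ℝ (diagOp e' c' w) v = inner ℝ (diagOp e' c' v) w := by
        rw [inner_diagOp_comm, real_inner_comm]
      simp only [map_add, inner_add_left, inner_add_right, h2]
      ring
    simp only [pol]
    exact (((h _).sub (h _)).sub (h _)).const_mul _
  rw [tendsto_iff_norm_sub_tendsto_zero]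
  let b := stdOrthonormalBasis ℝ V
  have hb : ∀ i, Tendsto (fun j => (diagOp (E j) (C j) - diagOp e c) (b i)) l (𝓝 0) := by
    intro i
    have : ∀ T : V →L[ℝ] V, T (b i) = ∑ k, inner ℝ (T (b i)) (b k) • b k := fun T => by
      conv_lhs => rw [← b.sum_repr' (T (b i))]
      exact Finset.sum_congr rfl fun k _ => by rw [real_inner_comm]
    have h0 : Tendsto (fun j => diagOp (E j) (C j) (b i)) l (𝓝 (diagOp e c (b i))) := by
      rw [this (diagOp e c)]
      refine Tendsto.congr (fun j => (this (diagOp (E j) (C j))).symm) ?_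
      exact tendsto_finsetSum _ fun k _ => (key _ _).smul_const _
    simpa using h0.sub_const (diagOp e c (b i))
  have hbound : ∀ T : V →L[ℝ] V, ‖T‖ ≤ ∑ i, ‖T (b i)‖ := by
    intro T
    refine T.opNorm_le_bound (Finset.sum_nonneg fun _ _ => norm_nonneg _) fun v => ?_
    conv_lhs => rw [← b.sum_repr' v]
    rw [map_sum, Finset.sum_mul]
    refine (norm_sum_le _ _).trans (Finset.sum_le_sum fun i _ => ?_)
    rw [map_smul, norm_smul, mul_comm]
    refine mul_le_mul_of_nonneg_left ?_ (norm_nonneg _)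
    simpa using norm_inner_le_norm (𝕜 := ℝ) (b i) v
  refine squeeze_zero (fun _ => norm_nonneg _) (fun j => hbound _) ?_
  simpa using tendsto_finsetSum Finset.univ fun i _ => (hb i).norm

end Frames

section Forms

lemma exists_posDefForm {V : Type u} [AddCommGroup V] [Module ℝ V] {A B : Submodule ℝ V}
    {ι : Type*} (s : Finset ι) (ℓ : ι → (A →ₗ[ℝ] ℝ)) (c : ι → ℝ) (hc : ∀ i ∈ s, 0 < c i)
    (h : ∀ v : A, (v : V) ∈ B ↔ ∀ i ∈ s, ℓ i v = 0) :
    ∃ Q : PosDefForm (SubQ A B), ∀ v : A, Q.1 (cls B v) = ∑ i ∈ s, c i * ℓ i v ^ 2 := by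
  have hker : ∀ i : s, B.submoduleOf A ≤ LinearMap.ker (ℓ i) := fun i v hv =>
    (h v).1 hv i i.2
  let L : s → (SubQ A B →ₗ[ℝ] ℝ) := fun i => (B.submoduleOf A).liftQ (ℓ i) (hker i)
  have hL : ∀ i v, L i (cls B v) = ℓ i v := fun i v => rfl
  let Q : QuadraticForm ℝ (SubQ A B) := ∑ i : s, c i • QuadraticMap.linMulLin (L i) (L i)
  have hQ : ∀ v : A, Q (cls B v) = ∑ i ∈ s, c i * ℓ i v ^ 2 := by
    intro v
    rw [← Finset.sum_coe_sort s]
    simp only [Q, _root_.sum_apply, _root_.smul_apply, QuadraticMap.linMulLin_apply,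
      hL, smul_eq_mul, sq]
  refine ⟨⟨Q, fun x hx => ?_⟩, hQ⟩
  induction x using Submodule.Quotient.induction_on with
  | H v =>
    change 0 < Q (cls B v)
    rw [hQ]
    have hv : ¬ (v : V) ∈ B := fun hv => hx ((Submodule.Quotient.mk_eq_zero _).2 hv)
    rw [h] at hv
    push Not at hv
    obtain ⟨i, hi, hiv⟩ := hv
    have h0 : 0 < ℓ i v ^ 2 := by positivity
    exact Finset.sum_pos' (fun j hj => mul_nonneg (hc j hj).le (sq_nonneg _))
      ⟨i, hi, mul_pos (hc i hi) h0⟩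

lemma posDef_nonneg {E : Type*} [AddCommGroup E] [Module ℝ E] (Q : PosDefForm E) (v : E) :
    0 ≤ Q.1 v := by
  by_cases h : v = 0
  · simp [h]
  · exact (Q.2 v h).le

lemma PosDefForm.ext {E : Type*} [AddCommGroup E] [Module ℝ E] {Q Q' : PosDefForm E}
    (h : ∀ v, Q.1 v = Q'.1 v) : Q = Q' := Subtype.ext (QuadraticMap.ext h)

lemma PE.mk_eq {E : Type*} [AddCommGroup E] [Module ℝ E] {Q R : PosDefForm E} :
    PE.mk Q = PE.mk R ↔ ∃ a : ℝ, 0 < a ∧ ∀ v, R.1 v = a * Q.1 v :=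
  Quotient.eq (r := posDefSetoid E)

lemma PE.exists_rep {E : Type*} [AddCommGroup E] [Module ℝ E] (q : PE E) :
    ∃ Q, q = PE.mk Q := by
  obtain ⟨Q, rfl⟩ := Quotient.exists_rep q
  exact ⟨Q, rfl⟩

/-- A positive multiple of a positive definite form. -/
def PosDefForm.scale {E : Type*} [AddCommGroup E] [Module ℝ E] (Q : PosDefForm E) (a : ℝ)
    (ha : 0 < a) : PosDefForm E :=
  ⟨a • Q.1, fun v hv => by simpa using mul_pos ha (Q.2 v hv)⟩

lemma PosDefForm.scale_apply {E : Type*} [AddCommGroup E] [Module ℝ E] (Q : PosDefForm E) (a : ℝ)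
    (ha : 0 < a) (v : E) : (Q.scale a ha).1 v = a * Q.1 v := rfl

lemma PE.mk_scale {E : Type*} [AddCommGroup E] [Module ℝ E] (Q : PosDefForm E) (a : ℝ)
    (ha : 0 < a) : PE.mk Q = PE.mk (Q.scale a ha) :=
  PE.mk_eq.2 ⟨a, ha, fun _ => rfl⟩

variable {V : Type u} [NormedAddCommGroup V] [InnerProductSpace ℝ V] [FiniteDimensional ℝ V]

/-- The spectral theorem for a positive definite form, with decreasing eigenvalues. -/
lemma exists_diagonalization (q : QuadraticForm ℝ V) (hq : q.PosDef) :
    ∃ (b : OrthonormalBasis (Fin (finrank ℝ V)) ℝ V) (c : Fin (finrank ℝ V) → ℝ),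
      Antitone c ∧ (∀ i, 0 < c i) ∧ ∀ v, q v = ∑ i, c i * inner ℝ (b i) v ^ 2 := by
  let β := QuadraticMap.associated (R := ℝ) q
  let b0 := stdOrthonormalBasis ℝ V
  let T : V →ₗ[ℝ] V := ∑ i, (β (b0 i)).smulRight (b0 i)
  have hT : ∀ v w, inner ℝ (T v) w = β v w := by
    intro v w
    conv_rhs => rw [← b0.sum_repr' w]
    simp only [T, LinearMap.sum_apply, LinearMap.smulRight_apply, sum_inner, map_sum, map_smul,
      smul_eq_mul]
    refine Finset.sum_congr rfl fun i _ => ?_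
    rw [real_inner_smul_left, mul_comm]
    congr 1
    exact QuadraticMap.associated_isSymm ℝ q (b0 i) v
  have hs : T.IsSymmetric := fun v w => by
    rw [hT, real_inner_comm, hT]
    exact QuadraticMap.associated_isSymm ℝ q v w
  have hqv : ∀ v, q v = inner ℝ (T v) v := fun v => by
    rw [hT, QuadraticMap.associated_eq_self_apply]
  refine ⟨hs.eigenvectorBasis rfl, hs.eigenvalues rfl, hs.eigenvalues_antitone rfl, ?_, ?_⟩
  · intro i
    have h1 := hq (hs.eigenvectorBasis rfl i)
      ((hs.eigenvectorBasis rfl).orthonormal.ne_zero i)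
    rw [hqv, hs.apply_eigenvectorBasis, real_inner_smul_left] at h1
    simpa using h1
  · intro v
    rw [hqv, ← (hs.eigenvectorBasis rfl).sum_inner_mul_inner]
    refine Finset.sum_congr rfl fun i _ => ?_
    rw [hs, hs.apply_eigenvectorBasis, real_inner_smul_right, real_inner_comm v]
    simp only [RCLike.ofReal_real_eq_id, id_eq]
    ring

/-! ### Frames diagonalizing a form on a subquotient -/

/-- `e` is an orthonormal basis of the whole space adapted to `B ⊆ A`, such that its part with
numbers in `block A B` diagonalizes `Q`, with eigenvalues `exp (μ_i)` in decreasing order. -/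
structure QFrame {A B : Submodule ℝ V} (Q : PosDefForm (SubQ A B))
    (e : Fin (finrank ℝ V) → V) (μ : Fin (finrank ℝ V) → ℝ) : Prop where
  orth : Orthonormal ℝ e
  adpA : Adp e A
  adpB : Adp e B
  anti : ∀ i ∈ block A B, ∀ j ∈ block A B, i ≤ j → μ j ≤ μ i
  diag : ∀ v : A, Q.1 (cls B v) = ∑ i ∈ block A B, Real.exp (μ i) * inner ℝ (e i) (v : V) ^ 2

variable {A B : Submodule ℝ V} {e f : Fin (finrank ℝ V) → V} {μ ν : Fin (finrank ℝ V) → ℝ}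

lemma QFrame.isEigenbasis {Q : PosDefForm (SubQ A B)} (h : QFrame Q e μ) : IsEigenbasis Q e μ where
  mem i hi := by
    rw [mem_block] at hi
    exact ⟨h.adpA.mem h.orth hi.1, h.adpB.mem_orthogonal hi.2⟩
  orthonormal i _ j _ := frame_inner_self h.orth i j
  antitone := h.anti
  diag := h.diag

lemma frame_glue (hAB : B ≤ A) (h1 : ∀ i, Before A i → e i ∈ Aᗮ)
    (h2 : ∀ i ∈ block A B, e i ∈ A ∧ e i ∈ Bᗮ) (h3 : ∀ i, ¬ Before B i → e i ∈ B)
    (o1 : ∀ i j, Before A i → Before A j → inner ℝ (e i) (e j) = if i = j then (1 : ℝ) else 0)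
    (o2 : ∀ i ∈ block A B, ∀ j ∈ block A B, inner ℝ (e i) (e j) = if i = j then (1 : ℝ) else 0)
    (o3 : ∀ i j, ¬ Before B i → ¬ Before B j →
      inner ℝ (e i) (e j) = if i = j then (1 : ℝ) else 0) :
    Orthonormal ℝ e ∧ Adp e A ∧ Adp e B := by
  have hA : ∀ i, ¬ Before A i → e i ∈ A := fun i hi => by
    by_cases hB : Before B i
    · exact (h2 i (mem_block.2 ⟨hi, hB⟩)).1
    · exact hAB (h3 i hB)
  have key : ∀ i j, i < j → inner ℝ (e i) (e j) = (0 : ℝ) := by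
    intro i j hij
    by_cases hi : Before A i
    · by_cases hj : Before A j
      · rw [o1 i j hi hj, if_neg hij.ne]
      · exact (Submodule.mem_orthogonal' _ _).1 (h1 i hi) _ (hA j hj)
    · have hj : ¬ Before A j := fun h => hi (h.of_le hij.le)
      by_cases hi' : Before B i
      · by_cases hj' : Before B j
        · rw [o2 i (mem_block.2 ⟨hi, hi'⟩) j (mem_block.2 ⟨hj, hj'⟩), if_neg hij.ne]
        · exact (Submodule.mem_orthogonal' _ _).1 (h2 i (mem_block.2 ⟨hi, hi'⟩)).2 _ (h3 j hj')
      · rw [o3 i j hi' (fun h => hi' (h.of_le hij.le)), if_neg hij.ne]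
  have he : Orthonormal ℝ e := by
    rw [orthonormal_iff_ite]
    intro i j
    rcases lt_trichotomy i j with h | h | h
    · rw [key i j h, if_neg h.ne]
    · subst h
      rw [if_pos rfl]
      by_cases hi : Before A i
      · simpa using o1 i i hi hi
      · by_cases hi' : Before B i
        · simpa using o2 i (mem_block.2 ⟨hi, hi'⟩) i (mem_block.2 ⟨hi, hi'⟩)
        · simpa using o3 i i hi' hi'
    · rw [real_inner_comm, key j i h, if_neg h.ne']
  exact ⟨he, adp_of_mem he hA, adp_of_mem he h3⟩

lemma finrank_orthogonal_inf (hAB : B ≤ A) :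
    finrank ℝ (Bᗮ ⊓ A : Submodule ℝ V) = finrank ℝ A - finrank ℝ B := by
  have := Submodule.finrank_add_inf_finrank_orthogonal hAB
  omega

/-- The numbering of `block A B` by `0, …, dim A - dim B - 1`. -/
def blockEmb (hAB : B ≤ A) :
    Fin (finrank ℝ (Bᗮ ⊓ A : Submodule ℝ V)) ↪ Fin (finrank ℝ V) :=
  ⟨fun i => ⟨i + (finrank ℝ V - finrank ℝ A), by
    have h1 := i.2
    have h2 := Submodule.finrank_le A
    have h3 := finrank_orthogonal_inf hAB
    omega⟩, fun i j h => by
      simp only [Fin.mk.injEq] at h; ext; omega⟩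

lemma blockEmb_val (hAB : B ≤ A) (i) :
    (blockEmb hAB i : ℕ) = i + (finrank ℝ V - finrank ℝ A) := rfl

lemma block_eq_map (hAB : B ≤ A) : block A B = Finset.univ.map (blockEmb hAB) := by
  ext i
  have h2 := Submodule.finrank_le A
  have h3 := finrank_orthogonal_inf hAB
  have h4 := Submodule.finrank_mono hAB
  simp only [mem_block, Before, Finset.mem_map, Finset.mem_univ, true_and]
  constructor
  · rintro ⟨h, h'⟩
    refine ⟨⟨i - (finrank ℝ V - finrank ℝ A), by omega⟩, ?_⟩
    ext
    rw [blockEmb_val]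
    simp only
    omega
  · rintro ⟨j, rfl⟩
    have := j.2
    rw [blockEmb_val]
    omega

lemma exists_partial_frame (hAB : B ≤ A)
    (b : OrthonormalBasis (Fin (finrank ℝ (Bᗮ ⊓ A : Submodule ℝ V))) ℝ
      (Bᗮ ⊓ A : Submodule ℝ V)) :
    ∃ e : Fin (finrank ℝ V) → V, (∀ k, e (blockEmb hAB k) = b k) ∧
      (∀ i ∈ block A B, e i ∈ A ∧ e i ∈ Bᗮ) ∧
      ∀ i ∈ block A B, ∀ j ∈ block A B,
        inner ℝ (e i) (e j) = if i = j then (1 : ℝ) else 0 := by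
  let e : Fin (finrank ℝ V) → V := Function.extend (blockEmb hAB) (fun k => (b k : V)) 0
  have he : ∀ k, e (blockEmb hAB k) = b k := fun k =>
    (blockEmb hAB).injective.extend_apply _ _ _
  refine ⟨e, he, ?_, ?_⟩
  · intro i hi
    rw [block_eq_map hAB] at hi
    obtain ⟨k, _, rfl⟩ := Finset.mem_map.1 hi
    rw [he]
    exact ⟨(b k).2.2, (b k).2.1⟩
  · intro i hi j hj
    rw [block_eq_map hAB] at hi hj
    obtain ⟨k, _, rfl⟩ := Finset.mem_map.1 hi
    obtain ⟨l, _, rfl⟩ := Finset.mem_map.1 hj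
    rw [he, he, ← Submodule.coe_inner, orthonormal_iff_ite.1 b.orthonormal k l]
    simp

lemma exists_adapted_frame (hAB : B ≤ A) :
    ∃ e : Fin (finrank ℝ V) → V, Orthonormal ℝ e ∧ Adp e A ∧ Adp e B := by
  classical
  obtain ⟨e₁, -, m₁, o₁⟩ := exists_partial_frame (le_top : A ≤ ⊤) (stdOrthonormalBasis ℝ _)
  obtain ⟨e₂, -, m₂, o₂⟩ := exists_partial_frame hAB (stdOrthonormalBasis ℝ _)
  obtain ⟨e₃, -, m₃, o₃⟩ := exists_partial_frame (bot_le : ⊥ ≤ B) (stdOrthonormalBasis ℝ _)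
  have hb1 : ∀ i, Before A i → i ∈ block (⊤ : Submodule ℝ V) A := fun i hi =>
    mem_block.2 ⟨not_before_top i, hi⟩
  have hb3 : ∀ i, ¬ Before B i → i ∈ block B (⊥ : Submodule ℝ V) := fun i hi =>
    mem_block.2 ⟨hi, before_bot i⟩
  let e : Fin (finrank ℝ V) → V := fun i =>
    if Before A i then e₁ i else if Before B i then e₂ i else e₃ i
  have he1 : ∀ i, Before A i → e i = e₁ i := fun i hi => if_pos hi
  have he2 : ∀ i ∈ block A B, e i = e₂ i := fun i hi => by
    rw [mem_block] at hi
    simp [e, hi.1, hi.2]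
  have he3 : ∀ i, ¬ Before B i → e i = e₃ i := fun i hi => by
    have : ¬ Before A i := fun h => hi (h.mono hAB)
    simp [e, hi, this]
  refine ⟨e, frame_glue hAB ?_ ?_ ?_ ?_ ?_ ?_⟩
  · intro i hi
    rw [he1 i hi]
    exact (m₁ i (hb1 i hi)).2
  · intro i hi
    rw [he2 i hi]
    exact m₂ i hi
  · intro i hi
    rw [he3 i hi]
    exact (m₃ i (hb3 i hi)).1
  · intro i j hi hj
    rw [he1 i hi, he1 j hj]
    exact o₁ i (hb1 i hi) j (hb1 j hj)
  · intro i hi j hj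
    rw [he2 i hi, he2 j hj]
    exact o₂ i hi j hj
  · intro i j hi hj
    rw [he3 i hi, he3 j hj]
    exact o₃ i (hb3 i hi) j (hb3 j hj)

lemma IsEigenbasis.exists_qframe (hAB : B ≤ A) {Q : PosDefForm (SubQ A B)}
    (h : IsEigenbasis Q e μ) : ∃ e', QFrame Q e' μ ∧ ∀ i ∈ block A B, e' i = e i := by
  classical
  obtain ⟨f, hf, fA, fB⟩ := exists_adapted_frame hAB
  let e' : Fin (finrank ℝ V) → V := fun i => if i ∈ block A B then e i else f i
  have he2 : ∀ i ∈ block A B, e' i = e i := fun i hi => if_pos hi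
  have he1 : ∀ i, Before A i → e' i = f i := fun i hi => if_neg fun h => (mem_block.1 h).1 hi
  have he3 : ∀ i, ¬ Before B i → e' i = f i := fun i hi => if_neg fun h => hi (mem_block.1 h).2
  obtain ⟨oe, aA, aB⟩ : Orthonormal ℝ e' ∧ Adp e' A ∧ Adp e' B := by
    refine frame_glue hAB ?_ ?_ ?_ ?_ ?_ ?_
    · intro i hi
      rw [he1 i hi]
      exact fA.mem_orthogonal hi
    · intro i hi
      rw [he2 i hi]
      exact h.mem i hi
    · intro i hi
      rw [he3 i hi]
      exact fB.mem hf hi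
    · intro i j hi hj
      rw [he1 i hi, he1 j hj, frame_inner_self hf]
    · intro i hi j hj
      rw [he2 i hi, he2 j hj, h.orthonormal i hi j hj]
    · intro i j hi hj
      rw [he3 i hi, he3 j hj, frame_inner_self hf]
  refine ⟨e', ⟨oe, aA, aB, h.antitone, fun v => ?_⟩, he2⟩
  rw [h.diag]
  exact Finset.sum_congr rfl fun i hi => by rw [he2 i hi]

lemma exists_qframe (hAB : B ≤ A) (Q : PosDefForm (SubQ A B)) : ∃ e μ, QFrame Q e μ := by
  let M : Submodule ℝ V := Bᗮ ⊓ A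
  let j : M →ₗ[ℝ] SubQ A B :=
    (B.submoduleOf A).mkQ ∘ₗ Submodule.inclusion (inf_le_right : M ≤ A)
  have hj : ∀ v : M, j v = cls B ⟨v, v.2.2⟩ := fun v => rfl
  obtain ⟨b, c, hc, hpos, hd⟩ := exists_diagonalization (Q.1.comp j) (fun v hv => by
    rw [QuadraticMap.comp_apply]
    refine Q.2 _ fun h0 => hv ?_
    rw [hj, Submodule.Quotient.mk_eq_zero] at h0
    have h1 : (v : V) ∈ B := h0
    have h2 := (Submodule.mem_orthogonal' _ _).1 v.2.1 _ h1
    exact Subtype.ext (by simpa using h2))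
  obtain ⟨e, he, hm, ho⟩ := exists_partial_frame hAB b
  let μ : Fin (finrank ℝ V) → ℝ := Function.extend (blockEmb hAB) (fun k => Real.log (c k)) 0
  have hμ : ∀ k, μ (blockEmb hAB k) = Real.log (c k) := fun k =>
    (blockEmb hAB).injective.extend_apply _ _ _
  have hE : IsEigenbasis Q e μ := by
    refine ⟨hm, ho, ?_, ?_⟩
    · intro i hi i' hi' hii
      rw [block_eq_map hAB] at hi hi'
      obtain ⟨k, _, rfl⟩ := Finset.mem_map.1 hi
      obtain ⟨l, _, rfl⟩ := Finset.mem_map.1 hi'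
      rw [hμ, hμ]
      refine Real.log_le_log (hpos _) (hc ?_)
      have : (blockEmb hAB k : ℕ) ≤ blockEmb hAB l := hii
      rw [blockEmb_val, blockEmb_val] at this
      exact Fin.le_def.2 (by omega)
    · intro v
      let w : V := v - B.starProjection (v : V)
      have hwB : w ∈ Bᗮ := Submodule.sub_starProjection_mem_orthogonal _
      have hwA : w ∈ A := A.sub_mem v.2 (hAB (Submodule.starProjection_apply_mem _ _))
      have hcls : cls B v = j ⟨w, hwB, hwA⟩ := by
        rw [hj]
        refine (Submodule.Quotient.eq _).2 ?_
        change (v : V) - w ∈ B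
        simp only [w, sub_sub_cancel]
        exact Submodule.starProjection_apply_mem _ _
      rw [hcls, ← QuadraticMap.comp_apply, hd, block_eq_map hAB, Finset.sum_map]
      refine Finset.sum_congr rfl fun k _ => ?_
      rw [hμ, Real.exp_log (hpos k), he]
      congr 2
      change inner ℝ (b k : V) w = _
      simp only [w, inner_sub_right]
      rw [(Submodule.mem_orthogonal' _ _).1 (b k).2.1 _ (Submodule.starProjection_apply_mem _ _),
        sub_zero]
  obtain ⟨e', h', -⟩ := hE.exists_qframe hAB
  exact ⟨e', μ, h'⟩

lemma qframe_of_diag (hAB : B ≤ A) {Q : PosDefForm (SubQ A B)} (he : Orthonormal ℝ e) (hA : Adp e A)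
    (hanti : ∀ i ∈ block A B, ∀ j ∈ block A B, i ≤ j → μ j ≤ μ i)
    (hd : ∀ v : A, Q.1 (cls B v) =
      ∑ i ∈ block A B, Real.exp (μ i) * inner ℝ (e i) (v : V) ^ 2) : QFrame Q e μ := by
  refine ⟨he, hA, adp_of_le he fun v hv i hi => ?_, hanti, hd⟩
  by_cases hiA : Before A i
  · exact (hA v).1 (hAB hv) i hiA
  · have h0 := hd ⟨v, hAB hv⟩
    have h1 : cls B (⟨v, hAB hv⟩ : A) = 0 := (Submodule.Quotient.mk_eq_zero _).2 hv
    rw [h1, map_zero, eq_comm, Finset.sum_eq_zero_iff_of_nonneg (fun i _ => by positivity)] at h0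
    have h2 := h0 i (mem_block.2 ⟨hiA, hi⟩)
    simpa using h2

lemma exists_form_of_frame (he : Orthonormal ℝ e) (hA : Adp e A) (hB : Adp e B)
    (hanti : ∀ i ∈ block A B, ∀ j ∈ block A B, i ≤ j → μ j ≤ μ i) :
    ∃ Q : PosDefForm (SubQ A B), QFrame Q e μ := by
  obtain ⟨Q, hQ⟩ := exists_posDefForm (A := A) (B := B) (block A B)
    (fun i => (innerₛₗ ℝ (e i)) ∘ₗ A.subtype) (fun i => Real.exp (μ i))
    (fun i _ => Real.exp_pos _) (fun v => by
      rw [hB]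
      constructor
      · intro h i hi
        exact h i (mem_block.1 hi).2
      · intro h i hi
        by_cases hiA : Before A i
        · exact (hA v).1 v.2 i hiA
        · exact h i (mem_block.2 ⟨hiA, hi⟩))
  exact ⟨Q, he, hA, hB, hanti, hQ⟩

lemma QFrame.scale {Q : PosDefForm (SubQ A B)} (h : QFrame Q e μ) (a : ℝ) (ha : 0 < a) :
    QFrame (Q.scale a ha) e (fun i => μ i + Real.log a) := by
  refine ⟨h.orth, h.adpA, h.adpB, fun i hi j hj hij => by have := h.anti i hi j hj hij; linarith,
    fun v => ?_⟩
  rw [PosDefForm.scale_apply, h.diag, Finset.mul_sum]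
  refine Finset.sum_congr rfl fun i _ => ?_
  rw [Real.exp_add, Real.exp_log ha]; ring

end Forms

section Comparison

variable {V : Type u} [NormedAddCommGroup V] [InnerProductSpace ℝ V] [FiniteDimensional ℝ V]
variable {A B : Submodule ℝ V} {e e' : Fin (finrank ℝ V) → V} {μ μ' : Fin (finrank ℝ V) → ℝ}

/-- Comparison of ordered eigenvalues of comparable forms. -/
lemma QFrame.exp_le {Q Q' : PosDefForm (SubQ A B)} (h : QFrame Q e μ) (h' : QFrame Q' e' μ')
    {C : ℝ} (hC : 0 ≤ C) (hQ : ∀ v, Q.1 v ≤ C * Q'.1 v) {p} (hp : p ∈ block A B) :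
    Real.exp (μ p) ≤ C * Real.exp (μ' p) := by
  classical
  have hpb := mem_block.1 hp
  let L : V →ₗ[ℝ] ({i : Fin (finrank ℝ V) // i ≠ p} → ℝ) :=
    LinearMap.pi fun i => if i.1 < p then innerₛₗ ℝ (e' i) else innerₛₗ ℝ (e i)
  have hker : LinearMap.ker L ≠ ⊥ := by
    apply LinearMap.ker_ne_bot_of_finrank_lt
    rw [finrank_fintype_fun_eq_card, Fintype.card_subtype_compl, Fintype.card_fin]
    have := p.2
    simp only [Fintype.card_unique]
    omega
  obtain ⟨v, hv, hv0⟩ := (Submodule.ne_bot_iff _).1 hker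
  have hv1 : ∀ i, i < p → inner ℝ (e' i) v = (0 : ℝ) := fun i hi => by
    have := congrFun (LinearMap.mem_ker.1 hv) ⟨i, hi.ne⟩
    simpa [L, hi] using this
  have hv2 : ∀ i, p < i → inner ℝ (e i) v = (0 : ℝ) := fun i hi => by
    have := congrFun (LinearMap.mem_ker.1 hv) ⟨i, hi.ne'⟩
    simpa [L, hi.not_gt] using this
  have hvA : v ∈ A := (h'.adpA v).2 fun i hi => hv1 i <| by
    by_contra hc
    exact hpb.1 (hi.of_le (not_lt.1 hc))
  have hnorm : 0 < ‖v‖ ^ 2 := by positivity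
  have h1 : Real.exp (μ p) * ‖v‖ ^ 2 ≤ Q.1 (cls B ⟨v, hvA⟩) := by
    have hs : ∑ i ∈ block A B, inner ℝ (e i) v ^ 2 = ‖v‖ ^ 2 := by
      rw [← frame_normSq h.orth]
      refine Finset.sum_subset (Finset.subset_univ _) fun i _ hi => ?_
      rw [mem_block] at hi
      by_cases hiA : Before A i
      · rw [(h.adpA v).1 hvA i hiA]; simp
      · rw [hv2 i ?_]
        · simp
        · by_contra hc
          exact hi ⟨hiA, hpb.2.of_le (not_lt.1 hc)⟩
    rw [h.diag, ← hs, Finset.mul_sum]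
    refine Finset.sum_le_sum fun i hi => ?_
    by_cases hip : p < i
    · simp [hv2 i hip]
    · exact mul_le_mul_of_nonneg_right (Real.exp_le_exp.2 (h.anti i hi p hp (not_lt.1 hip)))
        (sq_nonneg _)
  have h2 : Q'.1 (cls B ⟨v, hvA⟩) ≤ Real.exp (μ' p) * ‖v‖ ^ 2 := by
    rw [h'.diag, ← frame_normSq h'.orth, Finset.mul_sum]
    refine (Finset.sum_le_sum fun i hi => ?_).trans
      (Finset.sum_le_sum_of_subset_of_nonneg (Finset.subset_univ (block A B))
        fun i _ _ => by positivity)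
    by_cases hip : i < p
    · simp [hv1 i hip]
    · exact mul_le_mul_of_nonneg_right (Real.exp_le_exp.2 (h'.anti p hp i hi (not_lt.1 hip)))
        (sq_nonneg _)
  have h3 := hQ (cls B ⟨v, hvA⟩)
  have h4 := mul_le_mul_of_nonneg_left h2 hC
  refine le_of_mul_le_mul_right ?_ hnorm
  linarith

open Classical in
/-- The limit weights of the frame vectors at the scale of the eigenvalue number `p`. -/
def wt (A B : Submodule ℝ V) (μ : Fin (finrank ℝ V) → ℝ) (p i : Fin (finrank ℝ V)) : ℝ :=
  if Before A i then 1 else if Before B i then Real.sigmoid (μ i - μ p) else 0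

/-- The operator `X (X + λ_p)⁻¹` of a form on `A / B`, extended by `1` on `Aᗮ` and by `0`
on `B`. -/
def frameOp (A B : Submodule ℝ V) (e : Fin (finrank ℝ V) → V) (μ : Fin (finrank ℝ V) → ℝ)
    (p : Fin (finrank ℝ V)) : V →L[ℝ] V :=
  diagOp e (wt A B μ p)

lemma wt_before {i p} (h : Before A i) : wt A B μ p i = 1 := if_pos h

lemma wt_block {i p} (h : i ∈ block A B) : wt A B μ p i = Real.sigmoid (μ i - μ p) := by
  rw [mem_block] at h
  simp [wt, h.1, h.2]

lemma wt_after (hAB : B ≤ A) {i p} (h : ¬ Before B i) : wt A B μ p i = 0 := by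
  have : ¬ Before A i := fun h' => h (h'.mono hAB)
  simp [wt, h, this]

lemma wt_nonneg (p i) : 0 ≤ wt A B μ p i := by
  unfold wt
  split_ifs
  · exact zero_le_one
  · exact Real.sigmoid_nonneg _
  · exact le_rfl

lemma wt_le_one (p i) : wt A B μ p i ≤ 1 := by
  unfold wt
  split_ifs
  · exact le_rfl
  · exact Real.sigmoid_le_one _
  · exact zero_le_one

lemma wt_congr {p} (hp : p ∈ block A B)
    (h : ∀ i ∈ block A B, ∀ j ∈ block A B, μ i - μ j = μ' i - μ' j) :
    wt A B μ p = wt A B μ' p := by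
  ext i
  by_cases hi : i ∈ block A B
  · rw [wt_block hi, wt_block hi, h i hi p hp]
  · rw [mem_block] at hi
    unfold wt
    split_ifs with h1 h2
    · rfl
    · exact absurd ⟨h1, h2⟩ hi
    · rfl

lemma sigmoid_mul_sq_le (x a c : ℝ) :
    Real.sigmoid x * c ^ 2 ≤ Real.exp x * a ^ 2 + (c - a) ^ 2 := by
  have hx := Real.exp_pos x
  rw [Real.sigmoid_def, Real.exp_neg]
  have h1 : (1 + (Real.exp x)⁻¹)⁻¹ = Real.exp x / (1 + Real.exp x) := by
    field_simp
    ring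
  rw [h1, div_mul_eq_mul_div, div_le_iff₀ (by positivity)]
  nlinarith [sq_nonneg ((1 + Real.exp x) * a - c)]

lemma sigmoid_mul_sq_eq (x c : ℝ) :
    Real.sigmoid x * c ^ 2 =
      Real.exp x * ((1 - Real.sigmoid x) * c) ^ 2 + (c - (1 - Real.sigmoid x) * c) ^ 2 := by
  have hx := Real.exp_pos x
  have h1 : Real.sigmoid x = Real.exp x / (1 + Real.exp x) := by
    rw [Real.sigmoid_def, Real.exp_neg]
    field_simp
    ring
  rw [h1]
  field_simp
  ring

lemma QFrame.inner_frameOp_le {Q : PosDefForm (SubQ A B)} (h : QFrame Q e μ) (hAB : B ≤ A) (p)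
    (v : V) (a : A) :
    inner ℝ (frameOp A B e μ p v) v ≤ Real.exp (-μ p) * Q.1 (cls B a) + ‖v - a‖ ^ 2 := by
  classical
  rw [frameOp, inner_diagOp_self, h.diag, ← frame_normSq h.orth (v - a), Finset.mul_sum,
    ← Finset.sum_filter_add_sum_filter_not Finset.univ (· ∈ block A B)
      (fun i => inner ℝ (e i) (v - (a : V)) ^ 2), ← add_assoc, Finset.filter_univ_mem,
    ← Finset.sum_add_distrib,
    ← Finset.sum_filter_add_sum_filter_not Finset.univ (· ∈ block A B), Finset.filter_univ_mem]
  refine add_le_add (Finset.sum_le_sum fun i hi => ?_) (Finset.sum_le_sum fun i hi => ?_)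
  · rw [wt_block hi, inner_sub_right, ← mul_assoc, ← Real.exp_add]
    convert! sigmoid_mul_sq_le (μ i - μ p) (inner ℝ (e i) (a : V)) (inner ℝ (e i) v) using 3
    ring_nf
  · have hi : i ∉ block A B := (Finset.mem_filter.1 hi).2
    rw [mem_block] at hi
    by_cases hiA : Before A i
    · rw [wt_before hiA, inner_sub_right, (h.adpA a).1 a.2 i hiA]
      simp
    · rw [wt_after hAB (fun hB => hi ⟨hiA, hB⟩)]
      simp only [zero_mul]
      positivity

lemma QFrame.exists_inner_frameOp_eq {Q : PosDefForm (SubQ A B)} (h : QFrame Q e μ) (hAB : B ≤ A)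
    (p) (v : V) :
    ∃ a : A, inner ℝ (frameOp A B e μ p v) v =
      Real.exp (-μ p) * Q.1 (cls B a) + ‖v - a‖ ^ 2 := by
  classical
  let w : V := ∑ i, ((1 - wt A B μ p i) * inner ℝ (e i) v) • e i
  have hw : ∀ i, inner ℝ (e i) w = (1 - wt A B μ p i) * inner ℝ (e i) v := fun i =>
    inner_frame_sum h.orth _ i
  have hwA : w ∈ A := (h.adpA w).2 fun i hi => by rw [hw, wt_before hi]; simp
  refine ⟨⟨w, hwA⟩, ?_⟩
  rw [frameOp, inner_diagOp_self, h.diag, ← frame_normSq h.orth (v - w), Finset.mul_sum,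
    ← Finset.sum_filter_add_sum_filter_not Finset.univ (· ∈ block A B)
      (fun i => inner ℝ (e i) (v - (w : V)) ^ 2), ← add_assoc, Finset.filter_univ_mem,
    ← Finset.sum_add_distrib,
    ← Finset.sum_filter_add_sum_filter_not Finset.univ (· ∈ block A B), Finset.filter_univ_mem]
  congr 1
  · refine Finset.sum_congr rfl fun i hi => ?_
    rw [inner_sub_right, hw, wt_block hi, ← mul_assoc, ← Real.exp_add]
    convert! sigmoid_mul_sq_eq (μ i - μ p) (inner ℝ (e i) v) using 3
    ring_nf
  · refine Finset.sum_congr rfl fun i hi => ?_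
    have hi : i ∉ block A B := (Finset.mem_filter.1 hi).2
    rw [mem_block] at hi
    rw [inner_sub_right, hw]
    by_cases hiA : Before A i
    · rw [wt_before hiA]
      ring
    · rw [wt_after hAB (fun hB => hi ⟨hiA, hB⟩)]
      ring

lemma QFrame.inner_frameOp_le_norm {Q : PosDefForm (SubQ A B)} (h : QFrame Q e μ) (hAB : B ≤ A) (p)
    (v : V) : inner ℝ (frameOp A B e μ p v) v ≤ ‖v‖ ^ 2 := by
  have h1 : cls B (0 : A) = 0 := rfl
  simpa [h1] using h.inner_frameOp_le hAB p v 0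

lemma QFrame.inner_frameOp_le_mul {Q Q' : PosDefForm (SubQ A B)} (h : QFrame Q e μ)
    (h' : QFrame Q' e' μ') (hAB : B ≤ A) {C : ℝ} (hC : 1 ≤ C) (hQ : ∀ v, Q.1 v ≤ C * Q'.1 v)
    (hQ' : ∀ v, Q'.1 v ≤ C * Q.1 v) {p} (hp : p ∈ block A B) (v : V) :
    inner ℝ (frameOp A B e μ p v) v ≤ C ^ 2 * inner ℝ (frameOp A B e' μ' p v) v := by
  obtain ⟨a, ha⟩ := h'.exists_inner_frameOp_eq hAB p v
  refine (h.inner_frameOp_le hAB p v a).trans ?_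
  rw [ha, mul_add]
  have h1 := h'.exp_le h (by linarith) hQ' hp
  have h2 : Real.exp (-μ p) ≤ C * Real.exp (-μ' p) := by
    rw [Real.exp_neg, Real.exp_neg, ← div_eq_mul_inv, le_div_iff₀ (Real.exp_pos _),
      inv_mul_le_iff₀ (Real.exp_pos _)]
    linarith
  have h3 := hQ (cls B a)
  have h4 := posDef_nonneg Q (cls B a)
  refine add_le_add ?_ ?_
  · calc Real.exp (-μ p) * Q.1 (cls B a)
        ≤ (C * Real.exp (-μ' p)) * (C * Q'.1 (cls B a)) :=
          mul_le_mul h2 h3 h4 (by positivity)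
      _ = _ := by ring
  · exact le_mul_of_one_le_left (sq_nonneg _) (one_le_pow₀ hC)

lemma QFrame.eq_of_mk_eq {Q Q' : PosDefForm (SubQ A B)} (h : QFrame Q e μ)
    (h' : QFrame Q' e' μ') (hAB : B ≤ A) (hQ : PE.mk Q = PE.mk Q') :
    (∀ i ∈ block A B, ∀ j ∈ block A B, μ i - μ j = μ' i - μ' j) ∧
      ∀ p ∈ block A B, frameOp A B e μ p = frameOp A B e' μ' p := by
  obtain ⟨a, ha, hv⟩ := PE.mk_eq.1 hQ
  have hs : Q' = Q.scale a ha := PosDefForm.ext hv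
  subst hs
  have h1 := h.scale a ha
  have hd : ∀ i ∈ block A B, μ i + Real.log a = μ' i := fun i hi => by
    have k1 := h1.exp_le h' zero_le_one (fun v => by simp) hi
    have k2 := h'.exp_le h1 zero_le_one (fun v => by simp) hi
    rw [one_mul, Real.exp_le_exp] at k1 k2
    linarith
  have hdiff : ∀ i ∈ block A B, ∀ j ∈ block A B, μ i - μ j = μ' i - μ' j := fun i hi j hj => by
    rw [← hd i hi, ← hd j hj]; ring
  refine ⟨hdiff, fun p hp => ?_⟩
  have h3 : frameOp A B e μ p = frameOp A B e (fun i => μ i + Real.log a) p := by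
    exact congrArg (diagOp e) (wt_congr hp fun i _ j _ => by ring)
  rw [h3]
  refine diagOp_eq_of_quadratic fun v => le_antisymm ?_ ?_
  · have := h1.inner_frameOp_le_mul h' hAB le_rfl (fun v => by simp) (fun v => by simp) hp v
    rwa [one_pow, one_mul] at this
  · have := h'.inner_frameOp_le_mul h1 hAB le_rfl (fun v => by simp) (fun v => by simp) hp v
    rwa [one_pow, one_mul] at this

/-- If the ratio of two families of forms tends to `1`, then so do the ratios of their
eigenvalues. -/
lemma tendsto_eigenvalue_sub {ι : Type*} {l : Filter ι} {Q Q' : ι → PosDefForm (SubQ A B)}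
    {E E' : ι → Fin (finrank ℝ V) → V} {M M' : ι → Fin (finrank ℝ V) → ℝ}
    (h : ∀ j, QFrame (Q j) (E j) (M j)) (h' : ∀ j, QFrame (Q' j) (E' j) (M' j))
    (hr : ∀ C > (1 : ℝ), ∀ᶠ j in l, ∀ v, (Q j).1 v ≤ C * (Q' j).1 v ∧ (Q' j).1 v ≤ C * (Q j).1 v)
    {p} (hp : p ∈ block A B) : Tendsto (fun j => M j p - M' j p) l (𝓝 0) := by
  rw [Metric.tendsto_nhds]
  intro ε hε
  have hε2 : 0 < ε / 2 := by positivity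
  filter_upwards [hr (Real.exp (ε / 2)) (Real.one_lt_exp_iff.2 hε2)] with j hj
  have k1 := (h j).exp_le (h' j) (Real.exp_pos _).le (fun v => (hj v).1) hp
  have k2 := (h' j).exp_le (h j) (Real.exp_pos _).le (fun v => (hj v).2) hp
  rw [← Real.exp_add, Real.exp_le_exp] at k1 k2
  rw [Real.dist_eq, sub_zero, abs_lt]
  constructor <;> linarith

lemma tendsto_frameOp_sub {ι : Type*} {l : Filter ι} {Q Q' : ι → PosDefForm (SubQ A B)}
    {E E' : ι → Fin (finrank ℝ V) → V} {M M' : ι → Fin (finrank ℝ V) → ℝ} (hAB : B ≤ A)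
    (h : ∀ j, QFrame (Q j) (E j) (M j)) (h' : ∀ j, QFrame (Q' j) (E' j) (M' j))
    (hr : ∀ C > (1 : ℝ), ∀ᶠ j in l, ∀ v, (Q j).1 v ≤ C * (Q' j).1 v ∧ (Q' j).1 v ≤ C * (Q j).1 v)
    {p} (hp : p ∈ block A B) (v : V) :
    Tendsto (fun j => inner ℝ (frameOp A B (E j) (M j) p v) v -
      inner ℝ (frameOp A B (E' j) (M' j) p v) v) l (𝓝 0) := by
  rw [Metric.tendsto_nhds]
  intro ε hε
  have hc : Tendsto (fun C : ℝ => (C ^ 2 - 1) * ‖v‖ ^ 2) (𝓝[>] 1) (𝓝 0) := by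
    have : Continuous fun C : ℝ => (C ^ 2 - 1) * ‖v‖ ^ 2 := by fun_prop
    simpa using (this.tendsto 1).mono_left nhdsWithin_le_nhds
  obtain ⟨C, hCε, hC⟩ := ((hc.eventually (gt_mem_nhds hε)).and self_mem_nhdsWithin).exists
  have hC1 : (1 : ℝ) < C := hC
  have hC2 : 1 ≤ C ^ 2 := one_le_pow₀ hC1.le
  filter_upwards [hr C hC1] with j hj
  have k1 := (h j).inner_frameOp_le_mul (h' j) hAB hC1.le (fun v => (hj v).1)
    (fun v => (hj v).2) hp v
  have k2 := (h' j).inner_frameOp_le_mul (h j) hAB hC1.le (fun v => (hj v).2)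
    (fun v => (hj v).1) hp v
  have n1 := (h j).inner_frameOp_le_norm hAB p v
  have n2 := (h' j).inner_frameOp_le_norm hAB p v
  rw [Real.dist_eq, sub_zero, abs_lt]
  constructor <;> nlinarith

end Comparison

/-! ### Bounded coordinates on the Weyl chamber -/

section Scalars

/-- A bounded function of two differences of exponents. -/
def relDiff (a b : ℝ) : ℝ := a / (1 + |a| + |b|)

/-- The limit of `relDiff` at infinity in the direction `(a, b)`. -/
def dirDiff (a b : ℝ) : ℝ := a / (|a| + |b|)

lemma relDiff_den_pos (a b : ℝ) : 0 < 1 + |a| + |b| := by positivity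

lemma abs_relDiff_lt_one (a b : ℝ) : |relDiff a b| < 1 := by
  unfold relDiff
  rw [abs_div, abs_of_pos (relDiff_den_pos a b), div_lt_one (relDiff_den_pos a b)]
  linarith [abs_nonneg b]

lemma abs_relDiff_self_lt (a : ℝ) : |relDiff a a| < 1 / 2 := by
  unfold relDiff
  rw [abs_div, abs_of_pos (relDiff_den_pos a a), div_lt_iff₀ (relDiff_den_pos a a)]
  linarith

lemma dirDiff_self_of_pos {a : ℝ} (ha : 0 < a) : dirDiff a a = 1 / 2 := by
  unfold dirDiff
  rw [abs_of_pos ha]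
  field_simp
  norm_num

lemma dirDiff_self_of_neg {a : ℝ} (ha : a < 0) : dirDiff a a = -(1 / 2) := by
  have h := dirDiff_self_of_pos (neg_pos.2 ha)
  unfold dirDiff at *
  rw [abs_neg, neg_div] at h
  linarith

lemma dirDiff_affine {a : ℝ} (ha : 0 < a) (x y : ℝ) : dirDiff (a * x) (a * y) = dirDiff x y := by
  unfold dirDiff
  rw [abs_mul, abs_mul, abs_of_pos ha, ← mul_add, mul_div_mul_left _ _ ha.ne']

lemma continuous_relDiff : Continuous fun p : ℝ × ℝ => relDiff p.1 p.2 := by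
  unfold relDiff
  exact continuous_fst.div (by fun_prop) fun p => (relDiff_den_pos _ _).ne'

/-- Recovering the first argument of `relDiff`. -/
lemma eq_relDiff_mul (a b : ℝ) :
    a = relDiff a b * (1 + |b|) / (1 - |relDiff a b|) := by
  have h := relDiff_den_pos a b
  have h1 : 1 - |relDiff a b| = (1 + |b|) / (1 + |a| + |b|) := by
    unfold relDiff
    rw [abs_div, abs_of_pos h]
    field_simp
    ring
  rw [h1]
  unfold relDiff
  have h2 : 0 < 1 + |b| := by positivity
  field_simp

lemma eq_relDiff_self (a : ℝ) : a = relDiff a a / (1 - 2 * |relDiff a a|) := by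
  have h := relDiff_den_pos a a
  have h1 : 1 - 2 * |relDiff a a| = 1 / (1 + |a| + |a|) := by
    unfold relDiff
    rw [abs_div, abs_of_pos h]
    field_simp
    ring
  rw [h1]
  unfold relDiff
  field_simp

lemma relDiff_self_injective {a b : ℝ} (h : relDiff a a = relDiff b b) : a = b := by
  rw [eq_relDiff_self a, eq_relDiff_self b, h]

variable {ι : Type*} {l : Filter ι}

lemma tendsto_relDiff {a b : ι → ℝ} {α β : ℝ} (ha : Tendsto a l (𝓝 α)) (hb : Tendsto b l (𝓝 β)) :
    Tendsto (fun j => relDiff (a j) (b j)) l (𝓝 (relDiff α β)) :=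
  (continuous_relDiff.tendsto (α, β)).comp (ha.prodMk_nhds hb)

lemma tendsto_relDiff_dir {a b s : ι → ℝ} {α β : ℝ} (hs : Tendsto s l atTop)
    (ha : Tendsto (fun j => a j / s j) l (𝓝 α)) (hb : Tendsto (fun j => b j / s j) l (𝓝 β))
    (h : 0 < |α| + |β|) : Tendsto (fun j => relDiff (a j) (b j)) l (𝓝 (dirDiff α β)) := by
  have h1 : Tendsto (fun j => (a j / s j) / ((s j)⁻¹ + |a j / s j| + |b j / s j|)) l
      (𝓝 (α / (0 + |α| + |β|))) :=
    ha.div ((hs.inv_tendsto_atTop.add ha.abs).add hb.abs) (by simpa using h.ne')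
  rw [zero_add] at h1
  refine h1.congr' ?_
  filter_upwards [hs.eventually_gt_atTop 0] with j hj
  have := relDiff_den_pos (a j) (b j)
  unfold relDiff
  rw [abs_div, abs_div, abs_of_pos hj]
  field_simp

lemma tendsto_of_relDiff_self {a : ι → ℝ} {α : ℝ}
    (h : Tendsto (fun j => relDiff (a j) (a j)) l (𝓝 (relDiff α α))) : Tendsto a l (𝓝 α) := by
  have h1 : Tendsto (fun j => relDiff (a j) (a j) / (1 - 2 * |relDiff (a j) (a j)|)) l
      (𝓝 (relDiff α α / (1 - 2 * |relDiff α α|))) := by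
    refine h.div (tendsto_const_nhds.sub (h.abs.const_mul 2)) ?_
    have := abs_relDiff_self_lt α
    linarith
  rw [← eq_relDiff_self] at h1
  exact h1.congr fun j => (eq_relDiff_self _).symm

lemma tendsto_atTop_of_relDiff {a : ι → ℝ}
    (h : Tendsto (fun j => relDiff (a j) (a j)) l (𝓝 (1 / 2))) : Tendsto a l atTop := by
  have h1 : Tendsto (fun j => 1 - 2 * |relDiff (a j) (a j)|) l (𝓝[>] 0) := by
    refine tendsto_nhdsWithin_iff.2 ⟨?_, Eventually.of_forall fun j => ?_⟩
    · have := (tendsto_const_nhds (x := (1 : ℝ)) (f := l)).sub (h.abs.const_mul 2)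
      convert! this using 2
      rw [abs_of_pos] <;> norm_num
    · have := abs_relDiff_self_lt (a j)
      rw [Set.mem_Ioi]
      linarith
  have h2 := h.pos_mul_atTop (by norm_num) h1.inv_tendsto_nhdsGT_zero
  exact h2.congr fun j => by
    conv_rhs => rw [eq_relDiff_self (a j)]
    rfl

lemma relDiff_neg (a b : ℝ) : relDiff (-a) b = - relDiff a b := by
  simp [relDiff, neg_div]

lemma relDiff_neg_right (a b : ℝ) : relDiff a (-b) = relDiff a b := by
  simp [relDiff]

lemma tendsto_atBot_of_relDiff {a : ι → ℝ}
    (h : Tendsto (fun j => relDiff (a j) (a j)) l (𝓝 (-(1 / 2)))) : Tendsto a l atBot := by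
  have h1 : Tendsto (fun j => relDiff (-a j) (-a j)) l (𝓝 (1 / 2)) := by
    have := h.neg
    rw [neg_neg] at this
    exact this.congr fun j => by rw [relDiff_neg, relDiff_neg_right]
  exact tendsto_neg_atTop_iff.1 (tendsto_atTop_of_relDiff h1)

/-- Recovering the ratio from `relDiff` at infinity. -/
lemma tendsto_div_of_relDiff {a b : ι → ℝ} {α β : ℝ} (hα : 0 ≤ α) (hβ : 0 < β)
    (hb : Tendsto b l atTop) (h : Tendsto (fun j => relDiff (a j) (b j)) l (𝓝 (dirDiff α β))) :
    Tendsto (fun j => a j / b j) l (𝓝 (α / β)) := by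
  have h0 : dirDiff α β = α / (α + β) := by
    unfold dirDiff
    rw [abs_of_nonneg hα, abs_of_pos hβ]
  have h1 : 1 - |dirDiff α β| = β / (α + β) := by
    rw [h0, abs_of_nonneg (by positivity)]
    field_simp
    ring
  have h2 : Tendsto (fun j => relDiff (a j) (b j) * ((b j)⁻¹ + 1) / (1 - |relDiff (a j) (b j)|)) l
      (𝓝 (dirDiff α β * (0 + 1) / (1 - |dirDiff α β|))) := by
    refine (h.mul (hb.inv_tendsto_atTop.add_const 1)).div (tendsto_const_nhds.sub h.abs) ?_
    rw [h1]
    positivity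
  have h3 : dirDiff α β * (0 + 1) / (1 - |dirDiff α β|) = α / β := by
    rw [h1, h0]
    field_simp
    ring
  rw [h3] at h2
  refine h2.congr' ?_
  filter_upwards [hb.eventually_gt_atTop 0] with j hj
  have h4 := eq_relDiff_mul (a j) (b j)
  have h5 := abs_relDiff_lt_one (a j) (b j)
  have h6 : 1 - |relDiff (a j) (b j)| ≠ 0 := by linarith
  rw [abs_of_pos hj] at h4
  rw [eq_div_iff hj.ne']
  conv_rhs => rw [h4]
  field_simp

lemma abs_relDiff_sub_le (a b a' b' : ℝ) :
    |relDiff a b - relDiff a' b'| ≤ 2 * |a - a'| + |b - b'| := by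
  have hD := relDiff_den_pos a b
  have hD' := relDiff_den_pos a' b'
  set D := 1 + |a| + |b| with hDd
  set D' := 1 + |a'| + |b'| with hDd'
  have h1 : relDiff a b - relDiff a' b' = (a - a') / D + relDiff a' b' * ((D' - D) / D) := by
    unfold relDiff
    rw [← hDd, ← hDd']
    field_simp
    ring
  have hD1 : 1 ≤ D := by rw [hDd]; linarith [abs_nonneg a, abs_nonneg b]
  have h2 : |(a - a') / D| ≤ |a - a'| := by
    rw [abs_div, abs_of_pos hD]
    exact div_le_self (abs_nonneg _) hD1
  have h3 : |(D' - D) / D| ≤ |a - a'| + |b - b'| := by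
    rw [abs_div, abs_of_pos hD]
    refine (div_le_self (abs_nonneg _) hD1).trans ?_
    have e1 := abs_abs_sub_abs_le a' a
    have e2 := abs_abs_sub_abs_le b' b
    have e3 : D' - D = (|a'| - |a|) + (|b'| - |b|) := by rw [hDd, hDd']; ring
    rw [e3]
    refine (abs_add_le _ _).trans ?_
    rw [abs_sub_comm a a', abs_sub_comm b b']
    linarith
  have h4 := (abs_relDiff_lt_one a' b').le
  rw [h1]
  refine (abs_add_le _ _).trans ?_
  rw [abs_mul]
  have := mul_le_mul h4 h3 (abs_nonneg _) zero_le_one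
  linarith

lemma tendsto_relDiff_sub {a b a' b' : ι → ℝ} (ha : Tendsto (fun j => a j - a' j) l (𝓝 0))
    (hb : Tendsto (fun j => b j - b' j) l (𝓝 0)) :
    Tendsto (fun j => relDiff (a j) (b j) - relDiff (a' j) (b' j)) l (𝓝 0) := by
  refine squeeze_zero_norm (fun j => abs_relDiff_sub_le _ _ _ _) ?_
  simpa using (ha.abs.const_mul 2).add hb.abs

end Scalars

/-! ### Flags and the segments of their subquotients -/

section Coordinates

variable {V : Type u} [NormedAddCommGroup V] [InnerProductSpace ℝ V] [FiniteDimensional ℝ V]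
variable {A B : Submodule ℝ V} {m : ℕ}

lemma Flag.lt (F : Flag A B m) (k : Fin m) : F.W k.succ < F.W k.castSucc :=
  F.strictAnti (Fin.castSucc_lt_succ)

lemma Flag.le_first (F : Flag A B m) (k) : F.W k ≤ A := by
  conv_rhs => rw [← F.first]
  exact F.strictAnti.antitone (Fin.zero_le k)

lemma Flag.last_le (F : Flag A B m) (k) : B ≤ F.W k := by
  conv_lhs => rw [← F.last]
  exact F.strictAnti.antitone (Fin.le_last k)

/-- The segment of the `k`-th subquotient of a flag. -/
abbrev Flag.seg (F : Flag A B m) (k : Fin m) : Finset (Fin (finrank ℝ V)) :=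
  block (F.W k.castSucc) (F.W k.succ)

lemma Flag.seg_subset (F : Flag A B m) (k : Fin m) {i} (hi : i ∈ F.seg k) : i ∈ block A B := by
  rw [mem_block] at hi ⊢
  exact ⟨fun h => hi.1 (h.mono (F.le_first _)), hi.2.mono (F.last_le _)⟩

lemma Flag.seg_nonempty (F : Flag A B m) (k : Fin m) : (F.seg k).Nonempty :=
  block_nonempty (F.lt k)

lemma Flag.exists_seg (F : Flag A B m) {i} (hi : i ∈ block A B) : ∃ k, i ∈ F.seg k := by
  by_contra hc
  push Not at hc
  rw [mem_block] at hi
  have key : ∀ k, ¬ Before (F.W k) i := by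
    intro k
    induction k using Fin.induction with
    | zero => rw [F.first]; exact hi.1
    | succ k ih =>
      intro h
      exact hc k (mem_block.2 ⟨ih, h⟩)
  have := key (Fin.last m)
  rw [F.last] at this
  exact this hi.2

lemma Flag.lt_of_seg_lt (F : Flag A B m) {k k' : Fin m} (hk : k < k') {i i'}
    (hi : i ∈ F.seg k) (hi' : i' ∈ F.seg k') : i < i' := by
  rw [mem_block] at hi hi'
  by_contra hc
  have h1 : F.W k'.castSucc ≤ F.W k.succ := F.strictAnti.antitone (Fin.le_def.2 (by simpa using hk))
  exact hi'.1 ((hi.2.mono h1).of_le (not_lt.1 hc))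

lemma Flag.seg_unique (F : Flag A B m) {k k' : Fin m} {i} (hi : i ∈ F.seg k) (hi' : i ∈ F.seg k') :
    k = k' := by
  rcases lt_trichotomy k k' with h | h | h
  · exact absurd (F.lt_of_seg_lt h hi hi') (lt_irrefl _)
  · exact h
  · exact absurd (F.lt_of_seg_lt h hi' hi) (lt_irrefl _)

open Classical in
/-- The number of the subquotient of a flag to whose segment `i` belongs. -/
def Flag.idx (F : Flag A B m) (hm : 2 ≤ m) (i : Fin (finrank ℝ V)) : Fin m :=
  if h : ∃ k, i ∈ F.seg k then h.choose else ⟨0, by omega⟩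

lemma Flag.idx_eq (F : Flag A B m) (hm : 2 ≤ m) {i k} (hi : i ∈ F.seg k) : F.idx hm i = k := by
  have h : ∃ k, i ∈ F.seg k := ⟨k, hi⟩
  unfold Flag.idx
  rw [dif_pos h]
  exact F.seg_unique h.choose_spec hi

lemma PE.exists_frame (q : PE (SubQ A B)) :
    ∃ p : (Fin (finrank ℝ V) → V) × (Fin (finrank ℝ V) → ℝ),
      B ≤ A → ∃ Q, q = PE.mk Q ∧ QFrame Q p.1 p.2 := by
  by_cases hAB : B ≤ A
  · obtain ⟨Q, rfl⟩ := PE.exists_rep q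
    obtain ⟨e, μ, h⟩ := exists_qframe hAB Q
    exact ⟨(e, μ), fun _ => ⟨Q, rfl, h⟩⟩
  · exact ⟨0, fun h => absurd h hAB⟩

/-- A frame diagonalizing a representative of `q`. -/
def PE.frame (q : PE (SubQ A B)) : Fin (finrank ℝ V) → V := q.exists_frame.choose.1

/-- Logarithms of the eigenvalues of a representative of `q`. -/
def PE.logEig (q : PE (SubQ A B)) : Fin (finrank ℝ V) → ℝ := q.exists_frame.choose.2

lemma PE.frame_spec (hAB : B ≤ A) (q : PE (SubQ A B)) :
    ∃ Q, q = PE.mk Q ∧ QFrame Q q.frame q.logEig := q.exists_frame.choose_spec hAB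

lemma PE.logEig_sub (hAB : B ≤ A) {Q : PosDefForm (SubQ A B)} {e : Fin (finrank ℝ V) → V}
    {μ : Fin (finrank ℝ V) → ℝ} (h : QFrame Q e μ) {i j} (hi : i ∈ block A B)
    (hj : j ∈ block A B) : (PE.mk Q).logEig i - (PE.mk Q).logEig j = μ i - μ j := by
  obtain ⟨Q', hQ', hf⟩ := PE.frame_spec hAB (PE.mk Q)
  exact (hf.eq_of_mk_eq h hAB hQ'.symm).1 i hi j hj

lemma Simplex.exists_rep (v : Simplex m) : ∃ ψ hψ, v = Simplex.mk ψ hψ := by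
  obtain ⟨⟨ψ, hψ⟩, rfl⟩ := Quotient.exists_rep v
  exact ⟨ψ, hψ, rfl⟩

lemma Simplex.mk_eq {ψ χ : Fin m → ℝ} {hψ : StrictAnti ψ} {hχ : StrictAnti χ} :
    Simplex.mk ψ hψ = Simplex.mk χ hχ ↔ ∃ a b : ℝ, 0 < a ∧ ∀ k, χ k = a * ψ k + b :=
  Quotient.eq (r := velocitySetoid m)

/-- A decreasing sequence representing a point of the simplex. -/
def Simplex.rep (v : Simplex m) : Fin m → ℝ := v.exists_rep.choose

lemma Simplex.rep_spec (v : Simplex m) : ∃ h, v = Simplex.mk v.rep h := v.exists_rep.choose_spec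

/-- The velocity coordinates of a point of the compactification. -/
def rho : ∀ {A B : Submodule ℝ V}, Ass A B →
    Fin (finrank ℝ V) → Fin (finrank ℝ V) → Fin (finrank ℝ V) → ℝ
  | _, _, .interior q => fun i i' k =>
      relDiff (q.logEig i - q.logEig i') (q.logEig i - q.logEig k)
  | _, _, .boundary _ hm F v x => fun i i' k =>
      if F.idx hm i = F.idx hm i' ∧ F.idx hm i = F.idx hm k then rho (x (F.idx hm i)) i i' k
      else dirDiff (v.rep (F.idx hm i) - v.rep (F.idx hm i'))
        (v.rep (F.idx hm i) - v.rep (F.idx hm k))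

/-- The operator coordinates of a point of the compactification. -/
def Rop : ∀ {A B : Submodule ℝ V}, Ass A B → Fin (finrank ℝ V) → (V →L[ℝ] V)
  | A, B, .interior q => fun p => frameOp A B q.frame q.logEig p
  | _, _, .boundary _ hm F _ x => fun p => Rop (x (F.idx hm p)) p

lemma rho_interior (hAB : B ≤ A) {Q : PosDefForm (SubQ A B)} {e : Fin (finrank ℝ V) → V}
    {μ : Fin (finrank ℝ V) → ℝ} (h : QFrame Q e μ) {i i' k} (hi : i ∈ block A B)
    (hi' : i' ∈ block A B) (hk : k ∈ block A B) :
    rho (.interior (PE.mk Q) : Ass A B) i i' k = relDiff (μ i - μ i') (μ i - μ k) := by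
  simp only [rho]
  rw [PE.logEig_sub hAB h hi hi', PE.logEig_sub hAB h hi hk]

lemma Rop_interior (hAB : B ≤ A) {Q : PosDefForm (SubQ A B)} {e : Fin (finrank ℝ V) → V}
    {μ : Fin (finrank ℝ V) → ℝ} (h : QFrame Q e μ) {p} (hp : p ∈ block A B) :
    Rop (.interior (PE.mk Q) : Ass A B) p = frameOp A B e μ p := by
  obtain ⟨Q', hQ', hf⟩ := PE.frame_spec hAB (PE.mk Q)
  exact (hf.eq_of_mk_eq h hAB hQ'.symm).2 p hp

variable {hm : 2 ≤ m} {F : Flag A B m} {v : Simplex m}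
  {x : ∀ k : Fin m, Ass (F.W k.castSucc) (F.W k.succ)}

lemma rho_boundary_same {c : Fin m} {i i' k} (hi : i ∈ F.seg c) (hi' : i' ∈ F.seg c)
    (hk : k ∈ F.seg c) : rho (.boundary m hm F v x) i i' k = rho (x c) i i' k := by
  simp only [rho]
  rw [F.idx_eq hm hi, F.idx_eq hm hi', F.idx_eq hm hk, if_pos ⟨rfl, rfl⟩]

lemma rho_boundary_ne {ψ : Fin m → ℝ} {hψ : StrictAnti ψ} (hv : v = Simplex.mk ψ hψ)
    {c c' c'' : Fin m} {i i' k} (hi : i ∈ F.seg c) (hi' : i' ∈ F.seg c')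
    (hk : k ∈ F.seg c'') (h : ¬ (c = c' ∧ c = c'')) :
    rho (.boundary m hm F v x) i i' k = dirDiff (ψ c - ψ c') (ψ c - ψ c'') := by
  simp only [rho]
  rw [F.idx_eq hm hi, F.idx_eq hm hi', F.idx_eq hm hk, if_neg h]
  obtain ⟨hr, h1⟩ := v.rep_spec
  obtain ⟨a, b, ha, hab⟩ := Simplex.mk_eq.1 (h1.symm.trans hv)
  rw [hab c, hab c', hab c'', ← dirDiff_affine ha]
  congr 1 <;> ring

lemma Rop_boundary {c : Fin m} {p} (hp : p ∈ F.seg c) :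
    Rop (.boundary m hm F v x) p = Rop (x c) p := by
  simp only [Rop]
  rw [F.idx_eq hm hp]

end Coordinates

section Velocity

variable {V : Type u} [NormedAddCommGroup V] [InnerProductSpace ℝ V] [FiniteDimensional ℝ V]
variable {ι : Type*} {l : Filter ι}

/-- Convergence of exponents to the velocity coordinates of `x`. -/
def RhoTendsto (l : Filter ι) (φ : ι → Fin (finrank ℝ V) → ℝ) {A B : Submodule ℝ V}
    (x : Ass A B) : Prop :=
  ∀ i ∈ block A B, ∀ i' ∈ block A B, ∀ k ∈ block A B,
    Tendsto (fun j => relDiff (φ j i - φ j i') (φ j i - φ j k)) l (𝓝 (rho x i i' k))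

lemma RhoTendsto.child {φ : ι → Fin (finrank ℝ V) → ℝ} {A B : Submodule ℝ V} {m : ℕ} {hm : 2 ≤ m}
    {F : Flag A B m} {v : Simplex m} {x : ∀ k : Fin m, Ass (F.W k.castSucc) (F.W k.succ)}
    (h : RhoTendsto l φ (.boundary m hm F v x)) (c : Fin m) : RhoTendsto l φ (x c) := by
  intro i hi i' hi' k hk
  rw [← rho_boundary_same (hm := hm) (v := v) (x := x) hi hi' hk]
  exact h i (F.seg_subset c hi) i' (F.seg_subset c hi') k (F.seg_subset c hk)

lemma abs_sub_pos_of_strictAnti {m : ℕ} {ψ : Fin m → ℝ} (hψ : StrictAnti ψ) {c c' c'' : Fin m}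
    (h : ¬ (c = c' ∧ c = c'')) : 0 < |ψ c - ψ c'| + |ψ c - ψ c''| := by
  by_cases h1 : c = c'
  · have h2 : ψ c - ψ c'' ≠ 0 := sub_ne_zero.2 fun h3 => h ⟨h1, hψ.injective h3⟩
    have := abs_pos.2 h2
    positivity
  · have h2 : ψ c - ψ c' ≠ 0 := sub_ne_zero.2 fun h3 => h1 (hψ.injective h3)
    have := abs_pos.2 h2
    positivity

lemma rhoTendsto_boundary {φ : ι → Fin (finrank ℝ V) → ℝ} {A B : Submodule ℝ V} {m : ℕ}
    {hm : 2 ≤ m} {F : Flag A B m} {ψ : Fin m → ℝ} {hψ : StrictAnti ψ}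
    {x : ∀ k : Fin m, Ass (F.W k.castSucc) (F.W k.succ)} {s : ι → ℝ} (hs : Tendsto s l atTop)
    (h : ∀ (k k' : Fin m), ∀ i ∈ F.seg k, ∀ i' ∈ F.seg k',
      Tendsto (fun j => (φ j i - φ j i') / s j) l (𝓝 (ψ k - ψ k')))
    (hx : ∀ k, RhoTendsto l φ (x k)) :
    RhoTendsto l φ (.boundary m hm F (Simplex.mk ψ hψ) x) := by
  intro i hi i' hi' k hk
  obtain ⟨c, hc⟩ := F.exists_seg hi
  obtain ⟨c', hc'⟩ := F.exists_seg hi'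
  obtain ⟨c'', hc''⟩ := F.exists_seg hk
  by_cases hcc : c = c' ∧ c = c''
  · obtain ⟨rfl, rfl⟩ := hcc
    rw [rho_boundary_same hc hc' hc'']
    exact hx c i hc i' hc' k hc''
  · rw [rho_boundary_ne rfl hc hc' hc'' hcc]
    exact tendsto_relDiff_dir hs (h _ _ i hc i' hc') (h _ _ i hc k hc'')
      (abs_sub_pos_of_strictAnti hψ hcc)

lemma velocityTendsto_iff (φ : ℕ → Fin (finrank ℝ V) → ℝ) {A B : Submodule ℝ V} (x : Ass A B) :
    B ≤ A → (VelocityTendsto φ x ↔ RhoTendsto atTop φ x) := by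
  induction x with
  | @interior A B q =>
    intro hAB
    simp only [VelocityTendsto]
    constructor
    · rintro ⟨Q, e, μ, rfl, hE, ht⟩ i hi i' hi' k hk
      obtain ⟨e', he', -⟩ := hE.exists_qframe hAB
      rw [rho_interior hAB he' hi hi' hk]
      exact tendsto_relDiff (ht i hi i' hi') (ht i hi k hk)
    · intro h
      obtain ⟨Q, hQ, hf⟩ := PE.frame_spec hAB q
      refine ⟨Q, _, _, hQ, hf.isEigenbasis, fun i hi i' hi' => ?_⟩
      have := h i hi i' hi' i' hi'
      rw [rho] at this
      exact tendsto_of_relDiff_self this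
  | @boundary A B m hm F v x ih =>
    intro hAB
    simp only [VelocityTendsto]
    constructor
    · rintro ⟨⟨ψ, hψ, s, rfl, hs, ht⟩, hx⟩
      exact rhoTendsto_boundary hs ht fun k => (ih k (F.lt k).le).1 (hx k)
    · intro h
      refine ⟨?_, fun k => (ih k (F.lt k).le).2 (h.child k)⟩
      obtain ⟨ψ, hψ, hv⟩ := v.exists_rep
      let c0 : Fin m := ⟨0, by omega⟩
      let c1 : Fin m := ⟨m - 1, by omega⟩
      have hc01 : c0 < c1 := Fin.lt_def.2 (by simp only [c0, c1]; omega)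
      obtain ⟨i0, hi0⟩ := F.seg_nonempty c0
      obtain ⟨i1, hi1⟩ := F.seg_nonempty c1
      have hβ : 0 < ψ c0 - ψ c1 := sub_pos.2 (hψ hc01)
      have hD : Tendsto (fun j => φ j i0 - φ j i1) atTop atTop := by
        have h1 := h i0 (F.seg_subset _ hi0) i1 (F.seg_subset _ hi1) i1 (F.seg_subset _ hi1)
        rw [rho_boundary_ne hv hi0 hi1 hi1 (fun h => hc01.ne h.1), dirDiff_self_of_pos hβ] at h1
        exact tendsto_atTop_of_relDiff h1
      have key : ∀ k, ∀ i ∈ F.seg k, Tendsto (fun j => (φ j i0 - φ j i) / (φ j i0 - φ j i1)) atTop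
          (𝓝 ((ψ c0 - ψ k) / (ψ c0 - ψ c1))) := by
        intro k i hi
        refine tendsto_div_of_relDiff (sub_nonneg.2 (hψ.antitone (Fin.le_def.2 (Nat.zero_le _))))
          hβ hD ?_
        have h1 := h i0 (F.seg_subset _ hi0) i (F.seg_subset _ hi) i1 (F.seg_subset _ hi1)
        rwa [rho_boundary_ne hv hi0 hi hi1 (fun h => hc01.ne h.2)] at h1
      refine ⟨ψ, hψ, fun j => (φ j i0 - φ j i1) / (ψ c0 - ψ c1), hv, hD.atTop_div_const hβ,
        fun k k' i hi i' hi' => ?_⟩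
      have h1 := ((key k' i' hi').sub (key k i hi)).const_mul (ψ c0 - ψ c1)
      have h2 : (ψ c0 - ψ c1) * ((ψ c0 - ψ k') / (ψ c0 - ψ c1) - (ψ c0 - ψ k) / (ψ c0 - ψ c1)) =
          ψ k - ψ k' := by
        field_simp
        ring
      rw [h2] at h1
      refine h1.congr' ?_
      filter_upwards [hD.eventually_gt_atTop 0] with j hj
      have hβ' := hβ.ne'
      have hj' := hj.ne'
      field_simp
      ring

/-! ### Terminal subquotients -/

/-- `q` is the component of `x` in the terminal subquotient `A' / B'`. -/
inductive Term : ∀ {A B : Submodule ℝ V}, Ass A B →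
    ∀ A' B' : Submodule ℝ V, PE (SubQ A' B') → Prop
  | interior {A B : Submodule ℝ V} (q : PE (SubQ A B)) : Term (.interior q) A B q
  | boundary {A B : Submodule ℝ V} (m : ℕ) (hm : 2 ≤ m) (F : Flag A B m) (v : Simplex m)
      (x : ∀ k : Fin m, Ass (F.W k.castSucc) (F.W k.succ)) (k : Fin m) {A' B' : Submodule ℝ V}
      (q : PE (SubQ A' B')) (h : Term (x k) A' B' q) : Term (.boundary m hm F v x) A' B' q

variable {A B A' B' : Submodule ℝ V} {x : Ass A B} {q : PE (SubQ A' B')}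

lemma Term.bounds (h : Term x A' B' q) : A' ≤ A ∧ B ≤ B' ∧ (B < A → B' < A') := by
  induction h with
  | interior q => exact ⟨le_rfl, le_rfl, id⟩
  | boundary m hm F v x k q h ih =>
    exact ⟨ih.1.trans (F.le_first _), (F.last_le _).trans ih.2.1, fun _ => ih.2.2 (F.lt k)⟩

lemma Term.block_subset (h : Term x A' B' q) {i} (hi : i ∈ block A' B') : i ∈ block A B := by
  rw [mem_block] at hi ⊢
  exact ⟨fun h' => hi.1 (h'.mono h.bounds.1), hi.2.mono h.bounds.2.1⟩

lemma Term.rho_eq (h : Term x A' B' q) {i i' k} (hi : i ∈ block A' B') (hi' : i' ∈ block A' B')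
    (hk : k ∈ block A' B') :
    rho x i i' k = relDiff (q.logEig i - q.logEig i') (q.logEig i - q.logEig k) := by
  induction h with
  | interior q => rw [rho]
  | boundary m hm F v x c q h ih =>
    rw [rho_boundary_same (h.block_subset hi) (h.block_subset hi') (h.block_subset hk)]
    exact ih hi hi' hk

lemma Term.Rop_eq (h : Term x A' B' q) {p} (hp : p ∈ block A' B') :
    Rop x p = frameOp A' B' q.frame q.logEig p := by
  induction h with
  | interior q => rw [Rop]
  | boundary m hm F v x c q h ih =>
    rw [Rop_boundary (h.block_subset hp)]
    exact ih hp

lemma exists_term {A B : Submodule ℝ V} (x : Ass A B) {p} (hp : p ∈ block A B) :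
    ∃ A' B' q, Term x A' B' q ∧ p ∈ block A' B' := by
  induction x with
  | interior q => exact ⟨_, _, q, .interior q, hp⟩
  | boundary m hm F v x ih =>
    obtain ⟨c, hc⟩ := F.exists_seg hp
    obtain ⟨A', B', q, h, h'⟩ := ih c hc
    exact ⟨A', B', q, .boundary m hm F v x c q h, h'⟩

lemma rho_boundary_lt {A B : Submodule ℝ V} {m : ℕ} {hm : 2 ≤ m} {F : Flag A B m} {v : Simplex m}
    {x : ∀ k : Fin m, Ass (F.W k.castSucc) (F.W k.succ)} {c c' : Fin m} {i i'}
    (hi : i ∈ F.seg c) (hi' : i' ∈ F.seg c') (h : c < c') :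
    rho (.boundary m hm F v x) i i' i' = 1 / 2 := by
  obtain ⟨ψ, hψ, hv⟩ := v.exists_rep
  rw [rho_boundary_ne hv hi hi' hi' (fun hc => h.ne hc.1), dirDiff_self_of_pos]
  exact sub_pos.2 (hψ h)

lemma rho_boundary_gt {A B : Submodule ℝ V} {m : ℕ} {hm : 2 ≤ m} {F : Flag A B m} {v : Simplex m}
    {x : ∀ k : Fin m, Ass (F.W k.castSucc) (F.W k.succ)} {c c' : Fin m} {i i'}
    (hi : i ∈ F.seg c) (hi' : i' ∈ F.seg c') (h : c' < c) :
    rho (.boundary m hm F v x) i i' i' = -(1 / 2) := by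
  obtain ⟨ψ, hψ, hv⟩ := v.exists_rep
  rw [rho_boundary_ne hv hi hi' hi' (fun hc => h.ne' hc.1), dirDiff_self_of_neg]
  exact sub_neg.2 (hψ h)

lemma Term.rho_before (h : Term x A' B' q) {i p} (hi : i ∈ block A B) (hp : p ∈ block A' B')
    (hb : Before A' i) : rho x i p p = 1 / 2 := by
  have hip : i < p := by
    by_contra hc
    exact (mem_block.1 hp).1 (hb.of_le (not_lt.1 hc))
  induction h with
  | interior q => exact absurd hb (mem_block.1 hi).1
  | boundary m hm F v x c q h ih =>
    have hpc := h.block_subset hp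
    obtain ⟨c', hc'⟩ := F.exists_seg hi
    rcases lt_trichotomy c' c with hcc | hcc | hcc
    · exact rho_boundary_lt hc' hpc hcc
    · subst hcc
      rw [rho_boundary_same hc' hpc hpc]
      exact ih hc' hp hb
    · exact absurd (F.lt_of_seg_lt hcc hpc hc') hip.not_gt

lemma Term.rho_after (h : Term x A' B' q) {i p} (hi : i ∈ block A B) (hp : p ∈ block A' B')
    (hb : ¬ Before B' i) : rho x i p p = -(1 / 2) := by
  have hip : p < i := by
    by_contra hc
    exact hb ((mem_block.1 hp).2.of_le (not_lt.1 hc))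
  induction h with
  | interior q => exact absurd (mem_block.1 hi).2 hb
  | boundary m hm F v x c q h ih =>
    have hpc := h.block_subset hp
    obtain ⟨c', hc'⟩ := F.exists_seg hi
    rcases lt_trichotomy c' c with hcc | hcc | hcc
    · exact absurd (F.lt_of_seg_lt hcc hc' hpc) hip.not_gt
    · subst hcc
      rw [rho_boundary_same hc' hpc hpc]
      exact ih hc' hp hb
    · exact rho_boundary_gt hc' hpc hcc

/-- The behaviour of exponents relative to a terminal segment. -/
structure ScaleTendsto (l : Filter ι) (φ : ι → Fin (finrank ℝ V) → ℝ) (A B : Submodule ℝ V)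
    (μ : Fin (finrank ℝ V) → ℝ) : Prop where
  blk : ∀ i ∈ block A B, ∀ p ∈ block A B, Tendsto (fun j => φ j i - φ j p) l (𝓝 (μ i - μ p))
  up : ∀ i, Before A i → ∀ p ∈ block A B, Tendsto (fun j => φ j i - φ j p) l atTop
  down : ∀ i, ¬ Before B i → ∀ p ∈ block A B, Tendsto (fun j => φ j i - φ j p) l atBot

lemma Term.scaleTendsto {x : Ass (⊤ : Submodule ℝ V) ⊥} (h : Term x A' B' q)
    {φ : ι → Fin (finrank ℝ V) → ℝ} (hφ : RhoTendsto l φ x) :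
    ScaleTendsto l φ A' B' q.logEig where
  blk i hi p hp := by
    have := hφ i (h.block_subset hi) p (h.block_subset hp) p (h.block_subset hp)
    rw [h.rho_eq hi hp hp] at this
    exact tendsto_of_relDiff_self this
  up i hi p hp := by
    have := hφ i (mem_block_top_bot i) p (h.block_subset hp) p (h.block_subset hp)
    rw [h.rho_before (mem_block_top_bot i) hp hi] at this
    exact tendsto_atTop_of_relDiff this
  down i hi p hp := by
    have := hφ i (mem_block_top_bot i) p (h.block_subset hp) p (h.block_subset hp)
    rw [h.rho_after (mem_block_top_bot i) hp hi] at this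
    exact tendsto_atBot_of_relDiff this

lemma ScaleTendsto.mono {l' : Filter ι} (hl : l' ≤ l) {φ : ι → Fin (finrank ℝ V) → ℝ}
    {μ : Fin (finrank ℝ V) → ℝ} (h : ScaleTendsto l φ A B μ) : ScaleTendsto l' φ A B μ :=
  ⟨fun i hi p hp => (h.blk i hi p hp).mono_left hl, fun i hi p hp => (h.up i hi p hp).mono_left hl,
    fun i hi p hp => (h.down i hi p hp).mono_left hl⟩

lemma ScaleTendsto.tendsto_wt {φ : ι → Fin (finrank ℝ V) → ℝ} {μ : Fin (finrank ℝ V) → ℝ}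
    (h : ScaleTendsto l φ A B μ) {p} (hp : p ∈ block A B) (i) :
    Tendsto (fun j => wt ⊤ ⊥ (φ j) p i) l (𝓝 (wt A B μ p i)) := by
  simp only [wt_block (mem_block_top_bot i)]
  by_cases hA : Before A i
  · rw [wt_before hA]
    exact Real.tendsto_sigmoid_atTop.comp (h.up i hA p hp)
  by_cases hB : Before B i
  · rw [wt_block (mem_block.2 ⟨hA, hB⟩)]
    exact (_root_.continuous_sigmoid.tendsto _).comp (h.blk i (mem_block.2 ⟨hA, hB⟩) p hp)
  · have h0 : wt A B μ p i = 0 := by simp [wt, hA, hB]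
    rw [h0]
    exact Real.tendsto_sigmoid_atBot.comp (h.down i hB p hp)

end Velocity

section Criterion

lemma exists_tendsto_of_bounded {ι E : Type*} [PseudoMetricSpace E] [ProperSpace E]
    (U : Ultrafilter ι) {f : ι → E} {x : E} {C : ℝ} (hf : ∀ᶠ j in U, dist (f j) x ≤ C) :
    ∃ y, Tendsto f U (𝓝 y) := by
  obtain ⟨y, -, hy⟩ := (isCompact_closedBall x C).ultrafilter_le_nhds (U.map f)
    (Filter.le_principal_iff.2 hf)
  exact ⟨y, hy⟩

variable {V : Type u} [NormedAddCommGroup V] [InnerProductSpace ℝ V] [FiniteDimensional ℝ V]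
variable {ι : Type*} {l : Filter ι}

lemma orthonormal_of_tendsto [l.NeBot] {E : ι → Fin (finrank ℝ V) → V} {e : Fin (finrank ℝ V) → V}
    (hE : ∀ j, Orthonormal ℝ (E j)) (h : ∀ i, Tendsto (fun j => E j i) l (𝓝 (e i))) :
    Orthonormal ℝ e := by
  rw [orthonormal_iff_ite]
  intro i i'
  refine tendsto_nhds_unique ((h i).inner (h i')) ?_
  simp only [frame_inner_self (hE _)]
  exact tendsto_const_nhds

lemma exists_frame_tendsto (U : Ultrafilter ι) {E : ι → Fin (finrank ℝ V) → V}
    (hE : ∀ j, Orthonormal ℝ (E j)) :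
    ∃ e, Orthonormal ℝ e ∧ ∀ i, Tendsto (fun j => E j i) U (𝓝 (e i)) := by
  have : ∀ i, ∃ y, Tendsto (fun j => E j i) U (𝓝 y) := fun i =>
    exists_tendsto_of_bounded U (x := 0) (C := 1)
      (Eventually.of_forall fun j => by simp [(hE j).1 i])
  choose e he using this
  exact ⟨e, orthonormal_of_tendsto hE he, he⟩

/-- The frame `e` diagonalizes a representative of `q`. -/
def Diagonalizes {A B : Submodule ℝ V} (e : Fin (finrank ℝ V) → V) (q : PE (SubQ A B)) : Prop :=
  ∃ Q μ, q = PE.mk Q ∧ QFrame Q e μ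

variable {A B : Submodule ℝ V} {q : PE (SubQ A B)} {e : Fin (finrank ℝ V) → V}

lemma Diagonalizes.frameOp_eq (hAB : B ≤ A) (h : Diagonalizes e q) {p} (hp : p ∈ block A B) :
    frameOp A B q.frame q.logEig p = diagOp e (wt A B q.logEig p) := by
  obtain ⟨Q, μ, hQ, hf⟩ := h
  obtain ⟨Q', hQ', hf'⟩ := PE.frame_spec hAB q
  have h1 := hf'.eq_of_mk_eq hf hAB (hQ'.symm.trans hQ)
  rw [h1.2 p hp, wt_congr hp h1.1]
  rfl

lemma Diagonalizes.qframe (h : Diagonalizes e q) {Q : PosDefForm (SubQ A B)}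
    (hQ : q = PE.mk Q) : ∃ μ, QFrame Q e μ := by
  obtain ⟨Q', μ, hQ', hf⟩ := h
  obtain ⟨a, ha, h1⟩ := PE.mk_eq.1 (hQ'.symm.trans hQ)
  have : Q = Q'.scale a ha := PosDefForm.ext h1
  subst this
  exact ⟨_, hf.scale a ha⟩

lemma inner_sum_frame {f : Fin (finrank ℝ V) → V} (hf : Orthonormal ℝ f) (u v : V) :
    inner ℝ u v = ∑ l, inner ℝ u (f l) * inner ℝ (f l) v := by
  rw [← frame_inner hf]
  exact Finset.sum_congr rfl fun i _ => by rw [real_inner_comm u]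

/-- A frame that produces the right operator diagonalizes the form. -/
lemma diagonalizes_of_diagOp_eq (hAB : B ≤ A) (he : Orthonormal ℝ e) {p}
    (h : diagOp e (wt A B q.logEig p) = frameOp A B q.frame q.logEig p) : Diagonalizes e q := by
  classical
  obtain ⟨Q, hQ, hf⟩ := PE.frame_spec hAB q
  set f := q.frame
  set μ := q.logEig
  have hw : ∀ a b, inner ℝ (e a) (f b) ≠ (0 : ℝ) → wt A B μ p a = wt A B μ p b := fun a b hab =>
    weight_eq_of_diagOp_eq he hf.orth h hab
  have hblk : ∀ i ∈ block A B, 0 < wt A B μ p i ∧ wt A B μ p i < 1 := fun i hi => by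
    rw [wt_block hi]
    exact ⟨Real.sigmoid_pos _, Real.sigmoid_lt_one _⟩
  have hreg : ∀ i, Before A i ∨ i ∈ block A B ∨ ¬ Before B i := fun i => by
    rw [mem_block]; tauto
  have hone : ∀ i, wt A B μ p i = 1 → Before A i := fun i hi => by
    rcases hreg i with h | h | h
    · exact h
    · exact absurd hi (hblk i h).2.ne
    · rw [wt_after hAB h] at hi; norm_num at hi
  have hA : Adp e A := by
    refine adp_of_le he fun v hv i hi => ?_
    rw [inner_sum_frame hf.orth]
    refine Finset.sum_eq_zero fun b _ => ?_
    by_cases hab : inner ℝ (e i) (f b) = (0 : ℝ)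
    · simp [hab]
    · have := hw i b hab
      rw [wt_before hi] at this
      rw [(hf.adpA v).1 hv b (hone b this.symm), mul_zero]
  let c : Fin (finrank ℝ V) → ℝ := fun i => if i ∈ block A B then Real.exp (μ i) else 0
  have hc : diagOp e c = diagOp f c := by
    refine diagOp_congr he hf.orth fun a b hab => ?_
    have hab' := hw a b hab
    have key : ∀ a b, wt A B μ p a = wt A B μ p b → a ∈ block A B →
        b ∈ block A B ∧ μ a = μ b := by
      intro a b hab ha
      have h1 := hblk a ha
      have hb : b ∈ block A B := by
        rcases hreg b with h | h | h
        · rw [wt_before h] at hab; exact absurd hab h1.2.ne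
        · exact h
        · rw [wt_after hAB h] at hab; exact absurd hab h1.1.ne'
      refine ⟨hb, ?_⟩
      rw [wt_block ha, wt_block hb, Real.sigmoid_inj] at hab
      linarith
    by_cases ha : a ∈ block A B
    · obtain ⟨hb, hμ⟩ := key a b hab' ha
      simp [c, ha, hb, hμ]
    · have hb : b ∉ block A B := fun hb => ha (key b a hab'.symm hb).1
      simp [c, ha, hb]
  have hsum : ∀ (g : Fin (finrank ℝ V) → V) (v : V), inner ℝ (diagOp g c v) v =
      ∑ i ∈ block A B, Real.exp (μ i) * inner ℝ (g i) v ^ 2 := by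
    intro g v
    rw [inner_diagOp_self, ← Finset.sum_subset (Finset.subset_univ (block A B))]
    · exact Finset.sum_congr rfl fun i hi => by simp [c, hi]
    · intro i _ hi
      simp [c, hi]
  refine ⟨Q, μ, hQ, qframe_of_diag hAB he hA hf.anti fun v => ?_⟩
  rw [hf.diag, ← hsum, ← hsum, hc]

section Satake

variable {X : ι → PosDefForm (SubQ (⊤ : Submodule ℝ V) ⊥)} {E : ι → Fin (finrank ℝ V) → V}
  {φ : ι → Fin (finrank ℝ V) → ℝ}

/-- The convergence of the Satake component in one terminal subquotient. -/
def SatakeAt (l : Filter ι) (X : ι → PosDefForm (SubQ (⊤ : Submodule ℝ V) ⊥))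
    (E : ι → Fin (finrank ℝ V) → V) (q : PE (SubQ A B)) : Prop :=
  ∃ (Q : PosDefForm (SubQ A B)) (a : ι → ℝ), q = PE.mk Q ∧ (∀ j, 0 < a j) ∧
    ∀ v : A,
      Tendsto (fun j => (eigenTail (E j) A).starProjection (v : V)) l (𝓝 (v : V)) ∧
      Tendsto
        (fun j => a j * (X j).1 (cls ⊥ ⟨(eigenTail (E j) A).starProjection (v : V), trivial⟩))
        l (𝓝 (Q.1 (cls B v)))

lemma SatakeAt.mono {l' : Filter ι} (hl : l' ≤ l) (h : SatakeAt l X E q) : SatakeAt l' X E q := by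
  obtain ⟨Q, a, hQ, ha, h⟩ := h
  exact ⟨Q, a, hQ, ha, fun v => ⟨(h v).1.mono_left hl, (h v).2.mono_left hl⟩⟩

lemma satakeTendsto_iff (X : ℕ → PosDefForm (SubQ (⊤ : Submodule ℝ V) ⊥))
    (E : ℕ → Fin (finrank ℝ V) → V) {A B : Submodule ℝ V} (x : Ass A B) :
    SatakeTendsto X E x ↔
      ∀ A' B' (q : PE (SubQ A' B')), Term x A' B' q → SatakeAt atTop X E q := by
  induction x with
  | interior q =>
    rw [SatakeTendsto]
    constructor
    · rintro h A' B' q' ⟨⟩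
      exact h
    · intro h
      exact h _ _ q (.interior q)
  | boundary m hm F v x ih =>
    rw [SatakeTendsto]
    constructor
    · intro h A' B' q hq
      cases hq with
      | boundary _ _ _ _ _ k _ hk => exact (ih k).1 (h k) A' B' q hk
    · intro h k
      exact (ih k).2 fun A' B' q hq => h A' B' q (.boundary m hm F v x k q hq)

lemma tendsto_starProjection (hE : ∀ j, Orthonormal ℝ (E j)) (he : Orthonormal ℝ e)
    (hl : ∀ i, Tendsto (fun j => E j i) l (𝓝 (e i))) (A : Submodule ℝ V) (v : V) :
    Tendsto (fun j => (eigenTail (E j) A).starProjection v) l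
      (𝓝 ((eigenTail e A).starProjection v)) := by
  classical
  simp only [starProjection_eigenTail (hE _), starProjection_eigenTail he]
  refine tendsto_finsetSum _ fun i _ => Tendsto.smul ?_ (hl i)
  split_ifs
  · exact tendsto_const_nhds
  · exact (hl i).inner tendsto_const_nhds

lemma tendsto_restricted_form (hX : ∀ j, QFrame (X j) (E j) (φ j))
    (hl : ∀ i, Tendsto (fun j => E j i) l (𝓝 (e i))) {μ : Fin (finrank ℝ V) → ℝ}
    (hφ : ScaleTendsto l φ A B μ) {p} (hp : p ∈ block A B) (v : V) :
    Tendsto (fun j => Real.exp (-φ j p) *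
        (X j).1 (cls ⊥ ⟨(eigenTail (E j) A).starProjection v, trivial⟩)) l
      (𝓝 (∑ i ∈ block A B, Real.exp (μ i - μ p) * inner ℝ (e i) v ^ 2)) := by
  classical
  have h1 : ∀ j, Real.exp (-φ j p) *
      (X j).1 (cls ⊥ ⟨(eigenTail (E j) A).starProjection v, trivial⟩) =
      ∑ i, if Before A i then 0 else Real.exp (φ j i - φ j p) * inner ℝ (E j i) v ^ 2 := by
    intro j
    have hu : block (⊤ : Submodule ℝ V) ⊥ = Finset.univ :=
      Finset.eq_univ_of_forall mem_block_top_bot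
    rw [(hX j).diag, hu, Finset.mul_sum]
    refine Finset.sum_congr rfl fun i _ => ?_
    rw [starProjection_eigenTail (hX j).orth, inner_frame_sum (hX j).orth]
    split_ifs
    · simp
    · rw [← mul_assoc, ← Real.exp_add]
      ring_nf
  have h2 : ∑ i ∈ block A B, Real.exp (μ i - μ p) * inner ℝ (e i) v ^ 2 =
      ∑ i, if i ∈ block A B then Real.exp (μ i - μ p) * inner ℝ (e i) v ^ 2 else 0 := by
    rw [Finset.sum_ite_mem, Finset.univ_inter]
  simp only [h1, h2]
  refine tendsto_finsetSum _ fun i _ => ?_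
  have hin : Tendsto (fun j => inner ℝ (E j i) v ^ 2) l (𝓝 (inner ℝ (e i) v ^ 2)) :=
    ((hl i).inner tendsto_const_nhds).pow 2
  by_cases hA : Before A i
  · have hib : i ∉ block A B := fun h => (mem_block.1 h).1 hA
    simp only [hA, hib, if_true, if_false]
    exact tendsto_const_nhds
  simp only [hA, if_false]
  by_cases hB : Before B i
  · have hib : i ∈ block A B := mem_block.2 ⟨hA, hB⟩
    simp only [hib, if_true]
    exact ((Real.continuous_exp.tendsto _).comp (hφ.blk i hib p hp)).mul hin
  · have hib : i ∉ block A B := fun h => hB (mem_block.1 h).2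
    simp only [hib, if_false]
    have := (Real.tendsto_exp_atBot.comp (hφ.down i hB p hp)).mul hin
    simpa using this

lemma Diagonalizes.satake (hAB : B ≤ A) (hX : ∀ j, QFrame (X j) (E j) (φ j))
    (he : Orthonormal ℝ e) (hl : ∀ i, Tendsto (fun j => E j i) l (𝓝 (e i)))
    (hφ : ScaleTendsto l φ A B q.logEig) {p} (hp : p ∈ block A B) (h : Diagonalizes e q)
    {Q : PosDefForm (SubQ A B)} (hQ : q = PE.mk Q) (hQf : QFrame Q q.frame q.logEig) (v : A) :
    Tendsto (fun j => (eigenTail (E j) A).starProjection (v : V)) l (𝓝 (v : V)) ∧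
      Tendsto (fun j => Real.exp (-φ j p) *
        (X j).1 (cls ⊥ ⟨(eigenTail (E j) A).starProjection (v : V), trivial⟩))
        l (𝓝 (Real.exp (-q.logEig p) * Q.1 (cls B v))) := by
  obtain ⟨μ, hμ⟩ := h.qframe hQ
  have hA := hμ.adpA
  constructor
  · have h1 := tendsto_starProjection (fun j => (hX j).orth) he hl A (v : V)
    rw [(adp_iff he A).1 hA, Submodule.starProjection_eq_self_iff.2 v.2] at h1
    exact h1
  · have h1 := tendsto_restricted_form hX hl hφ hp (v : V)
    convert! h1 using 2
    have hd := (hμ.eq_of_mk_eq hQf hAB rfl).1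
    have hexp : Real.exp (μ p) = Real.exp (q.logEig p) := by
      have k1 := hμ.exp_le hQf zero_le_one (fun v => by simp) hp
      have k2 := hQf.exp_le hμ zero_le_one (fun v => by simp) hp
      linarith
    rw [hμ.diag, Finset.mul_sum]
    refine Finset.sum_congr rfl fun i hi => ?_
    rw [← mul_assoc, Real.exp_neg, ← hexp, ← Real.exp_neg, ← Real.exp_add, ← hd i hi p hp]
    ring_nf

lemma SatakeAt.diagonalizes [l.NeBot] (hAB : B ≤ A) (hX : ∀ j, QFrame (X j) (E j) (φ j))
    (he : Orthonormal ℝ e) (hl : ∀ i, Tendsto (fun j => E j i) l (𝓝 (e i)))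
    (hφ : ScaleTendsto l φ A B q.logEig) {p} (hp : p ∈ block A B) (h : SatakeAt l X E q) :
    Diagonalizes e q := by
  classical
  obtain ⟨Q, a, hQ, ha, hv⟩ := h
  obtain ⟨Q', hQ', hf'⟩ := PE.frame_spec hAB q
  set μ := q.logEig
  have hA : Adp e A := by
    rw [adp_iff he]
    refine (Submodule.eq_of_le_of_finrank_eq (fun v hvA => ?_) (finrank_eigenTail he A).symm).symm
    have h1 := tendsto_nhds_unique (hv ⟨v, hvA⟩).1
      (tendsto_starProjection (fun j => (hX j).orth) he hl A v)
    exact Submodule.starProjection_eq_self_iff.1 h1.symm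
  let G : V → ℝ := fun v => ∑ i ∈ block A B, Real.exp (μ i - μ p) * inner ℝ (e i) v ^ 2
  let Gj : ι → V → ℝ := fun j v => Real.exp (-φ j p) *
    (X j).1 (cls ⊥ ⟨(eigenTail (E j) A).starProjection v, trivial⟩)
  have hG : ∀ v, Tendsto (fun j => Gj j v) l (𝓝 (G v)) := tendsto_restricted_form hX hl hφ hp
  let β : ι → ℝ := fun j => a j * Real.exp (φ j p)
  have hβG : ∀ v : A, Tendsto (fun j => β j * Gj j v) l (𝓝 (Q.1 (cls B v))) := fun v => by
    refine (hv v).2.congr fun j => ?_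
    simp only [β, Gj]
    rw [mul_assoc, ← mul_assoc (Real.exp (φ j p)), ← Real.exp_add]
    simp
  have hepA : e p ∈ A := hA.mem he (mem_block.1 hp).1
  have hGp : G (e p) = 1 := by
    simp only [G, frame_inner_self he]
    rw [Finset.sum_eq_single p]
    · simp
    · intro i _ hi
      simp [hi]
    · exact fun h => absurd hp h
  let b := Q.1 (cls B ⟨e p, hepA⟩)
  have hβ : Tendsto β l (𝓝 b) := by
    have h1 := (hβG ⟨e p, hepA⟩).div (hG (e p)) (by rw [hGp]; exact one_ne_zero)
    rw [hGp, div_one] at h1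
    refine h1.congr' ?_
    have h2 := (hG (e p)).eventually_ne (by rw [hGp]; exact one_ne_zero : G (e p) ≠ 0)
    filter_upwards [h2] with j hj
    exact mul_div_cancel_right₀ _ hj
  have hQG : ∀ v : A, Q.1 (cls B v) = b * G v := fun v =>
    tendsto_nhds_unique (hβG v) (hβ.mul (hG v))
  have hb : 0 < b := by
    refine lt_of_le_of_ne (posDef_nonneg _ _) fun hb0 => ?_
    have hfp : q.frame p ∈ A := hf'.adpA.mem hf'.orth (mem_block.1 hp).1
    have h1 := hQG ⟨q.frame p, hfp⟩
    rw [← hb0, zero_mul] at h1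
    have h2 : cls B (⟨q.frame p, hfp⟩ : A) ≠ 0 := fun h0 => by
      have h3 : q.frame p ∈ B := (Submodule.Quotient.mk_eq_zero (B.submoduleOf A)).1 h0
      have h4 := (hf'.adpB _).1 h3 p (mem_block.1 hp).2
      rw [frame_inner_self hf'.orth] at h4
      simp at h4
    exact (Q.2 _ h2).ne' h1
  refine ⟨Q, fun i => μ i - μ p + Real.log b, hQ, qframe_of_diag hAB he hA ?_ ?_⟩
  · intro i hi j hj hij
    have := hf'.anti i hi j hj hij
    linarith
  · intro v
    rw [hQG, Finset.mul_sum]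
    refine Finset.sum_congr rfl fun i _ => ?_
    rw [Real.exp_add, Real.exp_log hb]
    ring

lemma tendsto_frameOp_diagOp {μ : Fin (finrank ℝ V) → ℝ}
    (hl : ∀ i, Tendsto (fun j => E j i) l (𝓝 (e i))) (hφ : ScaleTendsto l φ A B μ) {p}
    (hp : p ∈ block A B) :
    Tendsto (fun j => frameOp ⊤ ⊥ (E j) (φ j) p) l (𝓝 (diagOp e (wt A B μ p))) :=
  tendsto_diagOp hl fun i => hφ.tendsto_wt hp i

lemma satakeAt_iff (hAB : B ≤ A) (hX : ∀ j, QFrame (X j) (E j) (φ j))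
    (hφ : ScaleTendsto l φ A B q.logEig) {p} (hp : p ∈ block A B) :
    SatakeAt l X E q ↔ Tendsto (fun j => frameOp ⊤ ⊥ (E j) (φ j) p) l
      (𝓝 (frameOp A B q.frame q.logEig p)) := by
  constructor
  · intro h
    rw [tendsto_iff_ultrafilter]
    intro U hU
    obtain ⟨e, he, hl⟩ := exists_frame_tendsto U fun j => (hX j).orth
    have hd := (h.mono hU).diagonalizes hAB hX he hl (hφ.mono hU) hp
    rw [hd.frameOp_eq hAB hp]
    exact tendsto_frameOp_diagOp hl (hφ.mono hU) hp
  · intro h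
    obtain ⟨Q, hQ, hf⟩ := PE.frame_spec hAB q
    have key : ∀ (v : A) (U : Ultrafilter ι), (U : Filter ι) ≤ l →
        Tendsto (fun j => (eigenTail (E j) A).starProjection (v : V)) U (𝓝 (v : V)) ∧
        Tendsto (fun j => Real.exp (-φ j p) *
          (X j).1 (cls ⊥ ⟨(eigenTail (E j) A).starProjection (v : V), trivial⟩))
          U (𝓝 (Real.exp (-q.logEig p) * Q.1 (cls B v))) := by
      intro v U hU
      obtain ⟨e, he, hl⟩ := exists_frame_tendsto U fun j => (hX j).orth
      have hd : Diagonalizes e q := diagonalizes_of_diagOp_eq hAB he <|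
        tendsto_nhds_unique (tendsto_frameOp_diagOp hl (hφ.mono hU) hp) (h.mono_left hU)
      exact hd.satake hAB hX he hl (hφ.mono hU) hp hQ hf v
    refine ⟨Q.scale (Real.exp (-q.logEig p)) (Real.exp_pos _), fun j => Real.exp (-φ j p),
      hQ.trans (PE.mk_scale _ _ _), fun j => Real.exp_pos _, fun v => ⟨?_, ?_⟩⟩
    · rw [tendsto_iff_ultrafilter]
      exact fun U hU => (key v U hU).1
    · rw [tendsto_iff_ultrafilter]
      exact fun U hU => (key v U hU).2

lemma satakeAt_of_subsingleton [Subsingleton V] (q : PE (SubQ A B)) : SatakeAt l X E q := by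
  obtain ⟨Q, rfl⟩ := PE.exists_rep q
  refine ⟨Q, fun _ => 1, rfl, fun _ => one_pos, fun v => ⟨?_, ?_⟩⟩
  · exact tendsto_const_nhds.congr fun _ => Subsingleton.elim _ _
  · have h1 : cls B v = 0 := by
      rw [Subsingleton.elim v 0]
      rfl
    rw [h1, map_zero]
    refine tendsto_const_nhds.congr fun j => ?_
    have h2 : ∀ w : (⊤ : Submodule ℝ V), cls ⊥ w = 0 := fun w => by
      rw [Subsingleton.elim w 0]
      rfl
    rw [h2, map_zero, mul_zero]

/-- Convergence in the hybrid sense is convergence of all the coordinates. -/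
theorem hybrid_iff {X : ℕ → PosDefForm (SubQ (⊤ : Submodule ℝ V) ⊥)}
    {E : ℕ → Fin (finrank ℝ V) → V} {φ : ℕ → Fin (finrank ℝ V) → ℝ}
    (hX : ∀ j, QFrame (X j) (E j) (φ j)) (x : Ass (⊤ : Submodule ℝ V) ⊥) :
    VelocityTendsto φ x ∧ SatakeTendsto X E x ↔
      RhoTendsto atTop φ x ∧
        ∀ p, Tendsto (fun j => frameOp ⊤ ⊥ (E j) (φ j) p) atTop (𝓝 (Rop x p)) := by
  rw [velocityTendsto_iff φ x bot_le, satakeTendsto_iff]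
  refine and_congr_right fun hρ => ⟨fun h p => ?_, fun h A' B' q hq => ?_⟩
  · obtain ⟨A', B', q, hq, hp⟩ := exists_term x (mem_block_top_bot p)
    have hAB : B' ≤ A' := by
      have h1 := mem_block.1 hp
      rcases subsingleton_or_nontrivial V with h0 | h0
      · exact fun v _ => by rw [Subsingleton.elim v 0]; exact A'.zero_mem
      · exact (hq.bounds.2.2 bot_lt_top).le
    rw [hq.Rop_eq hp]
    exact (satakeAt_iff hAB hX (hq.scaleTendsto hρ) hp).1 (h A' B' q hq)
  · rcases subsingleton_or_nontrivial V with h0 | h0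
    · exact satakeAt_of_subsingleton q
    · have hlt := hq.bounds.2.2 bot_lt_top
      obtain ⟨p, hp⟩ := block_nonempty hlt
      refine (satakeAt_iff hlt.le hX (hq.scaleTendsto hρ) hp).2 ?_
      rw [← hq.Rop_eq hp]
      exact h p

end Satake
end Criterion

section Compactness

/-- The level sets of a decreasing function on `[a, b)`. -/
lemma exists_levels (u : ℕ → ℝ) (n : ℕ) : ∀ a, AntitoneOn u (Set.Ico a (a + n + 1)) →
    ∃ (m : ℕ) (c : Fin (m + 1) → ℕ) (ψ : Fin m → ℝ), StrictMono c ∧ StrictAnti ψ ∧ c 0 = a ∧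
      c (Fin.last m) = a + n + 1 ∧ ∀ k i, c k.castSucc ≤ i → i < c k.succ → u i = ψ k := by
  induction n with
  | zero =>
    intro a _
    refine ⟨1, ![a, a + 1], fun _ => u a, ?_, Subsingleton.strictAnti _, rfl, rfl, ?_⟩
    · intro i j hij
      fin_cases i <;> fin_cases j <;> simp_all
    · intro k i h1 h2
      fin_cases k
      simp at h1 h2
      rw [show i = a by omega]
  | succ n ih =>
    intro a hu
    obtain ⟨m, c, ψ, hc, hψ, hc0, hc1, h⟩ := ih (a + 1)
      (hu.mono (Set.Ico_subset_Ico (by omega) (by omega)))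
    have hm : m ≠ 0 := by
      rintro rfl
      have : c 0 = c (Fin.last 0) := rfl
      omega
    obtain ⟨m, rfl⟩ := Nat.exists_eq_succ_of_ne_zero hm
    have hlt : ∀ k : Fin m.succ, c k.castSucc < c k.succ := fun k => hc Fin.castSucc_lt_succ
    have h0 : u (a + 1) = ψ 0 := h 0 (a + 1) (by simp [hc0]) (by
      have := hlt 0
      rw [Fin.castSucc_zero, hc0] at this
      exact this)
    have hua : u (a + 1) ≤ u a := hu (by simp) (by simp) (by omega)
    rcases hua.eq_or_lt with heq | hlt'
    · refine ⟨m.succ, Function.update c 0 a, ψ, ?_, hψ, by simp, ?_, ?_⟩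
      · intro i j hij
        have hj : j ≠ 0 := (Fin.zero_le i |>.trans_lt hij).ne'
        rw [Function.update_of_ne hj]
        by_cases hi : i = 0
        · subst hi
          have := hc hij
          simp only [Function.update_self]
          omega
        · rw [Function.update_of_ne hi]
          exact hc hij
      · rw [Function.update_of_ne (by simp [Fin.ext_iff]), hc1]
        omega
      · intro k i h1 h2
        rw [Function.update_of_ne (Fin.succ_ne_zero k)] at h2
        by_cases hk : k = 0
        · subst hk
          simp only [Fin.castSucc_zero, Function.update_self] at h1
          rcases h1.eq_or_lt with rfl | h3
          · rw [← heq, h0]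
          · exact h 0 i (by rw [Fin.castSucc_zero, hc0]; omega) h2
        · have hk' : k.castSucc ≠ 0 := fun h => hk (Fin.ext (congrArg Fin.val h :))
          rw [Function.update_of_ne hk'] at h1
          exact h k i h1 h2
    · refine ⟨m.succ + 1, Fin.cons a c, Fin.cons (u a) ψ, ?_, ?_, rfl, ?_, ?_⟩
      · refine Fin.strictMono_iff_lt_succ.2 fun k => ?_
        refine Fin.cases ?_ (fun k => ?_) k
        · simp only [Fin.castSucc_zero, Fin.cons_zero, Fin.cons_succ, hc0]
          omega
        · rw [Fin.castSucc_succ, Fin.cons_succ, Fin.cons_succ]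
          exact hlt k
      · refine Fin.strictAnti_iff_succ_lt.2 fun k => ?_
        refine Fin.cases ?_ (fun k => ?_) k
        · simp only [Fin.castSucc_zero, Fin.cons_zero, Fin.cons_succ]
          rw [← h0]; exact hlt'
        · rw [Fin.castSucc_succ, Fin.cons_succ, Fin.cons_succ]
          exact hψ Fin.castSucc_lt_succ
      · rw [← Fin.succ_last, Fin.cons_succ, hc1]
        omega
      · intro k i h1 h2
        induction k using Fin.cases with
        | zero =>
          simp only [Fin.castSucc_zero, Fin.cons_zero, Fin.cons_succ, hc0] at h1 h2 ⊢
          rw [show i = a by omega]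
        | succ k =>
          rw [Fin.castSucc_succ, Fin.cons_succ] at h1
          rw [Fin.cons_succ] at h2 ⊢
          exact h k i h1 h2

variable {V : Type u} [NormedAddCommGroup V] [InnerProductSpace ℝ V] [FiniteDimensional ℝ V]
variable {e : Fin (finrank ℝ V) → V}

lemma before_tail (he : Orthonormal ℝ e) {a : ℕ} (ha : a ≤ finrank ℝ V) (i) :
    Before (tail e a) i ↔ (i : ℕ) < a := by
  unfold Before
  rw [finrank_tail he]
  omega

lemma mem_block_tail (he : Orthonormal ℝ e) {a b : ℕ} (ha : a ≤ finrank ℝ V)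
    (hb : b ≤ finrank ℝ V) (i) : i ∈ block (tail e a) (tail e b) ↔ a ≤ (i : ℕ) ∧ (i : ℕ) < b := by
  rw [mem_block, before_tail he ha, before_tail he hb, not_lt]

lemma adp_tail (he : Orthonormal ℝ e) {a : ℕ} (ha : a ≤ finrank ℝ V) : Adp e (tail e a) :=
  adp_of_mem he fun i hi => by
    rw [before_tail he ha, not_lt] at hi
    exact Submodule.subset_span ⟨i, hi, rfl⟩

lemma tail_le {a b : ℕ} (h : a ≤ b) : tail e b ≤ tail e a :=
  Submodule.span_mono (Set.image_mono fun _ hi => h.trans hi)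

lemma tail_lt (he : Orthonormal ℝ e) {a b : ℕ} (h : a < b) (hb : b ≤ finrank ℝ V) :
    tail e b < tail e a := by
  refine lt_of_le_of_ne (tail_le h.le) fun heq => ?_
  have h1 := finrank_tail he a
  rw [← heq, finrank_tail he] at h1
  omega

/-- The frame `e` diagonalizes all the terminal components of `x`. -/
def AdaptedTo {A B : Submodule ℝ V} (e : Fin (finrank ℝ V) → V) (x : Ass A B) : Prop :=
  ∀ A' B' (q : PE (SubQ A' B')), Term x A' B' q → Diagonalizes e q

lemma adaptedTo_boundary {A B : Submodule ℝ V} {m : ℕ} {hm : 2 ≤ m} {F : Flag A B m}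
    {v : Simplex m} {x : ∀ k : Fin m, Ass (F.W k.castSucc) (F.W k.succ)} :
    AdaptedTo e (.boundary m hm F v x) ↔ ∀ k, AdaptedTo e (x k) := by
  constructor
  · intro h k A' B' q hq
    exact h A' B' q (.boundary m hm F v x k q hq)
  · intro h A' B' q hq
    cases hq with
    | boundary _ _ _ _ _ k _ hk => exact h k A' B' q hk

lemma adaptedTo_interior {A B : Submodule ℝ V} {q : PE (SubQ A B)} :
    AdaptedTo e (.interior q : Ass A B) ↔ Diagonalizes e q := by
  constructor
  · intro h
    exact h A B q (.interior q)
  · rintro h A' B' q' ⟨⟩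
    exact h

variable {ι : Type*}

lemma exists_interior_limit {A B : Submodule ℝ V} (hAB : B ≤ A) (he : Orthonormal ℝ e)
    (hA : Adp e A) (hB : Adp e B) (l : Filter ι) [l.NeBot] {φ : ι → Fin (finrank ℝ V) → ℝ}
    (hφ : ∀ j, Antitone (φ j)) {μ : Fin (finrank ℝ V) → ℝ}
    (h : ∀ i ∈ block A B, ∀ i' ∈ block A B,
      Tendsto (fun j => φ j i - φ j i') l (𝓝 (μ i - μ i'))) :
    ∃ x : Ass A B, RhoTendsto l φ x ∧ AdaptedTo e x := by
  obtain ⟨Q, hQ⟩ := exists_form_of_frame (μ := μ) he hA hB fun i hi i' hi' hii => by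
    have := ge_of_tendsto' (h i hi i' hi') fun j => sub_nonneg.2 (hφ j hii)
    linarith
  refine ⟨.interior (PE.mk Q), fun i hi i' hi' k hk => ?_, adaptedTo_interior.2 ⟨Q, μ, rfl, hQ⟩⟩
  rw [rho_interior hAB hQ hi hi' hk]
  exact tendsto_relDiff (h i hi i' hi') (h i hi k hk)

lemma exists_limit_tail (U : Ultrafilter ι) (he : Orthonormal ℝ e)
    {φ : ι → Fin (finrank ℝ V) → ℝ} (hφ : ∀ j, Antitone (φ j)) (d : ℕ) :
    ∀ a b, a < b → b ≤ finrank ℝ V → b - a ≤ d →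
      ∃ x : Ass (tail e a) (tail e b), RhoTendsto U φ x ∧ AdaptedTo e x := by
  induction d with
  | zero => intro a b h1 _ h2; omega
  | succ d ih =>
    intro a b hab hb hd
    have ha : a ≤ finrank ℝ V := by omega
    let i0 : Fin (finrank ℝ V) := ⟨a, by omega⟩
    let i1 : Fin (finrank ℝ V) := ⟨b - 1, by omega⟩
    have hblk : ∀ i ∈ block (tail e a) (tail e b), i0 ≤ i ∧ i ≤ i1 := fun i hi => by
      rw [mem_block_tail he ha hb] at hi
      exact ⟨Fin.le_def.2 hi.1, Fin.le_def.2 (by simp only [i1]; omega)⟩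
    by_cases hbd : ∃ C : ℝ, ∀ᶠ j in U, φ j i0 - φ j i1 ≤ C
    · obtain ⟨C, hC⟩ := hbd
      have : ∀ i, ∃ y, i ∈ block (tail e a) (tail e b) →
          Tendsto (fun j => φ j i - φ j i1) U (𝓝 y) := by
        intro i
        by_cases hi : i ∈ block (tail e a) (tail e b)
        · obtain ⟨y, hy⟩ := exists_tendsto_of_bounded U (f := fun j => φ j i - φ j i1) (x := 0)
            (C := C) (by
              filter_upwards [hC] with j hj
              have h1 := hφ j (hblk i hi).1
              have h2 := hφ j (hblk i hi).2
              rw [Real.dist_eq, sub_zero, abs_of_nonneg (by linarith)]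
              linarith)
          exact ⟨y, fun _ => hy⟩
        · exact ⟨0, fun h => absurd h hi⟩
      choose μ hμ using this
      refine exists_interior_limit (tail_le hab.le) he (adp_tail he ha) (adp_tail he hb) U hφ
        (μ := μ) fun i hi i' hi' => ?_
      exact ((hμ i hi).sub (hμ i' hi')).congr fun j => by ring
    · push Not at hbd
      have hD : Tendsto (fun j => φ j i0 - φ j i1) U atTop := by
        rw [tendsto_atTop]
        intro C
        filter_upwards [hbd C] with j hj
        exact hj.le
      have : ∀ i, ∃ y, i ∈ block (tail e a) (tail e b) →
          Tendsto (fun j => (φ j i - φ j i1) / (φ j i0 - φ j i1)) U (𝓝 y) := by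
        intro i
        by_cases hi : i ∈ block (tail e a) (tail e b)
        · obtain ⟨y, hy⟩ := exists_tendsto_of_bounded U
            (f := fun j => (φ j i - φ j i1) / (φ j i0 - φ j i1)) (x := 0) (C := 1) (by
              filter_upwards [hD.eventually_gt_atTop 0] with j hj
              have h1 := hφ j (hblk i hi).1
              have h2 := hφ j (hblk i hi).2
              rw [Real.dist_eq, sub_zero, abs_of_nonneg (div_nonneg (by linarith) hj.le),
                div_le_one hj]
              linarith)
          exact ⟨y, fun _ => hy⟩
        · exact ⟨0, fun h => absurd h hi⟩
      choose u hu using this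
      have hmem0 : i0 ∈ block (tail e a) (tail e b) :=
        (mem_block_tail he ha hb _).2 ⟨le_rfl, hab⟩
      have hmem1 : i1 ∈ block (tail e a) (tail e b) :=
        (mem_block_tail he ha hb _).2 ⟨by simp only [i1]; omega, by simp only [i1]; omega⟩
      have hu0 : u i0 = 1 := by
        refine tendsto_nhds_unique (hu i0 hmem0) (tendsto_const_nhds.congr' ?_)
        filter_upwards [hD.eventually_gt_atTop 0] with j hj
        rw [div_self hj.ne']
      have hu1 : u i1 = 0 :=
        tendsto_nhds_unique (hu i1 hmem1) (tendsto_const_nhds.congr fun j => by simp)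
      have huanti : ∀ i ∈ block (tail e a) (tail e b), ∀ i' ∈ block (tail e a) (tail e b),
          i ≤ i' → u i' ≤ u i := by
        intro i hi i' hi' hii
        refine le_of_tendsto_of_tendsto (hu i' hi') (hu i hi) ?_
        filter_upwards [hD.eventually_gt_atTop 0] with j hj
        have := hφ j hii
        gcongr
      let u' : ℕ → ℝ := fun i => if h : i < finrank ℝ V then u ⟨i, h⟩ else 0
      have hu' : ∀ i : Fin (finrank ℝ V), u' i = u i := fun i => by simp [u']
      obtain ⟨n, rfl⟩ : ∃ n, b = a + n + 1 := ⟨b - a - 1, by omega⟩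
      obtain ⟨m, c, ψ, hc, hψ, hc0, hc1, hlev⟩ := exists_levels u' n a (by
        intro i hi i' hi' hii
        have h1 : i < finrank ℝ V := by have := hi.2; omega
        have h2 : i' < finrank ℝ V := by have := hi'.2; omega
        rw [hu' ⟨i, h1⟩, hu' ⟨i', h2⟩]
        exact huanti _ ((mem_block_tail he ha hb _).2 ⟨hi.1, hi.2⟩) _
          ((mem_block_tail he ha hb _).2 ⟨hi'.1, hi'.2⟩) hii)
      have hcle : ∀ k, c k ≤ finrank ℝ V := fun k =>
        (hc.monotone (Fin.le_last k)).trans (by omega)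
      have hcge : ∀ k, a ≤ c k := fun k => by
        rw [← hc0]; exact hc.monotone (Fin.zero_le k)
      have hcle' : ∀ k, c k ≤ a + n + 1 := fun k => by
        rw [← hc1]; exact hc.monotone (Fin.le_last k)
      have hm : 2 ≤ m := by
        by_contra hlt
        have hm01 : m = 0 ∨ m = 1 := by omega
        rcases hm01 with rfl | rfl
        · have : c 0 = c (Fin.last 0) := rfl
          omega
        · have e0 := hlev 0 i0 (by rw [Fin.castSucc_zero, hc0])
            (by have : c (Fin.succ 0) = c (Fin.last 1) := rfl
                rw [this, hc1]; exact hab)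
          have e1 := hlev 0 i1 (by rw [Fin.castSucc_zero, hc0]; simp only [i1]; omega)
            (by have : c (Fin.succ 0) = c (Fin.last 1) := rfl
                rw [this, hc1]; simp only [i1]; omega)
          rw [hu', hu0] at e0
          rw [hu', hu1, ← e0] at e1
          norm_num at e1
      let F : Flag (tail e a) (tail e (a + n + 1)) m :=
        { W := fun k => tail e (c k)
          strictAnti := fun k k' h => tail_lt he (hc h) (hcle k')
          first := by rw [hc0]
          last := by rw [hc1] }
      have hseg : ∀ k i, i ∈ F.seg k ↔ c k.castSucc ≤ (i : ℕ) ∧ (i : ℕ) < c k.succ := fun k i =>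
        mem_block_tail he (hcle _) (hcle _) i
      have hchild : ∀ k : Fin m, ∃ x : Ass (F.W k.castSucc) (F.W k.succ),
          RhoTendsto U φ x ∧ AdaptedTo e x := fun k => by
        refine ih (c k.castSucc) (c k.succ) (hc Fin.castSucc_lt_succ) (hcle _) ?_
        have hk : k.castSucc ≠ 0 ∨ k.succ ≠ Fin.last m := by
          by_contra hcon
          push Not at hcon
          have h1 := congrArg Fin.val hcon.1
          have h2 := congrArg Fin.val hcon.2
          simp at h1 h2
          omega
        have h1 := hcge k.castSucc
        have h2 := hcle' k.succ
        rcases hk with h | h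
        · have : c 0 < c k.castSucc := hc (Fin.pos_iff_ne_zero.2 h)
          omega
        · have : c k.succ < c (Fin.last m) := hc (lt_of_le_of_ne (Fin.le_last _) h)
          omega
      choose x hx hxe using hchild
      refine ⟨.boundary m hm F (Simplex.mk ψ hψ) x,
        rhoTendsto_boundary hD (fun k k' i hi i' hi' => ?_) hx, adaptedTo_boundary.2 hxe⟩
      have e1 := hlev k i ((hseg k i).1 hi).1 ((hseg k i).1 hi).2
      have e2 := hlev k' i' ((hseg k' i').1 hi').1 ((hseg k' i').1 hi').2
      rw [hu'] at e1 e2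
      rw [← e1, ← e2]
      refine ((hu i (F.seg_subset k hi)).sub (hu i' (F.seg_subset k' hi'))).congr fun j => ?_
      ring

lemma exists_limit (U : Ultrafilter ι) (he : Orthonormal ℝ e)
    {φ : ι → Fin (finrank ℝ V) → ℝ} (hφ : ∀ j, Antitone (φ j)) :
    ∃ x : Ass (⊤ : Submodule ℝ V) ⊥, RhoTendsto U φ x ∧ AdaptedTo e x := by
  rcases Nat.eq_zero_or_pos (finrank ℝ V) with h0 | h0
  · refine exists_interior_limit bot_le he (adp_top e) (adp_bot he) U hφ (μ := 0) fun i => ?_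
    exact absurd i.2 (by omega)
  · have h1 : tail e 0 = ⊤ := by
      refine Submodule.eq_top_of_finrank_eq ?_
      rw [finrank_tail he, Nat.sub_zero]
    have h2 : tail e (finrank ℝ V) = ⊥ := by
      refine Submodule.finrank_eq_zero.1 ?_
      rw [finrank_tail he, Nat.sub_self]
    have := exists_limit_tail U he hφ (finrank ℝ V) 0 (finrank ℝ V) h0 le_rfl (by omega)
    rwa [h1, h2] at this

lemma AdaptedTo.tendsto_frameOp {x : Ass (⊤ : Submodule ℝ V) ⊥} {l : Filter ι}
    (h : AdaptedTo e x) {E : ι → Fin (finrank ℝ V) → V} {φ : ι → Fin (finrank ℝ V) → ℝ}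
    (hl : ∀ i, Tendsto (fun j => E j i) l (𝓝 (e i))) (hφ : RhoTendsto l φ x) (p) :
    Tendsto (fun j => frameOp ⊤ ⊥ (E j) (φ j) p) l (𝓝 (Rop x p)) := by
  obtain ⟨A', B', q, hq, hp⟩ := exists_term x (mem_block_top_bot p)
  have hd := h A' B' q hq
  have hAB : B' ≤ A' := by
    rcases subsingleton_or_nontrivial V with h0 | h0
    · exact fun v _ => by rw [Subsingleton.elim v 0]; exact A'.zero_mem
    · exact (hq.bounds.2.2 bot_lt_top).le
  rw [hq.Rop_eq hp, hd.frameOp_eq hAB hp]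
  exact tendsto_frameOp_diagOp hl (hq.scaleTendsto hφ) hp

end Compactness

section Density

variable {V : Type u} [NormedAddCommGroup V] [InnerProductSpace ℝ V] [FiniteDimensional ℝ V]

lemma Diagonalizes.congr {A B : Submodule ℝ V} {e f : Fin (finrank ℝ V) → V} {q : PE (SubQ A B)}
    (hAB : B ≤ A) (h : Diagonalizes f q) (he : Orthonormal ℝ e)
    (hef : ∀ i ∈ block A B, e i = f i) (hB : ∀ i, ¬ Before B i → e i ∈ B) : Diagonalizes e q := by
  obtain ⟨Q, μ, hQ, hf⟩ := h
  refine ⟨Q, μ, hQ, qframe_of_diag hAB he (adp_of_mem he fun i hi => ?_) hf.anti fun v => ?_⟩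
  · by_cases hiB : Before B i
    · rw [hef i (mem_block.2 ⟨hi, hiB⟩)]
      exact hf.adpA.mem hf.orth hi
    · exact hAB (hB i hiB)
  · rw [hf.diag]
    exact Finset.sum_congr rfl fun i hi => by rw [hef i hi]

lemma exists_adaptedTo {A B : Submodule ℝ V} (x : Ass A B) :
    B ≤ A → ∃ e, Orthonormal ℝ e ∧ Adp e A ∧ Adp e B ∧ AdaptedTo e x := by
  classical
  induction x with
  | @interior A B q =>
    intro hAB
    obtain ⟨Q, hQ, hf⟩ := PE.frame_spec hAB q
    exact ⟨_, hf.orth, hf.adpA, hf.adpB, adaptedTo_interior.2 ⟨Q, _, hQ, hf⟩⟩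
  | @boundary A B m hm F v x ih =>
    intro hAB
    choose E hE hEA hEB hEx using fun k => ih k (F.lt k).le
    obtain ⟨f, hf, fA, fB⟩ := exists_adapted_frame hAB
    let e : Fin (finrank ℝ V) → V := fun i =>
      if i ∈ block A B then E (F.idx hm i) i else f i
    have heseg : ∀ k, ∀ i ∈ F.seg k, e i = E k i := fun k i hi => by
      simp only [e, F.seg_subset k hi, if_true]
      rw [F.idx_eq hm hi]
    have he1 : ∀ i, Before A i → e i = f i := fun i hi => if_neg fun h => (mem_block.1 h).1 hi
    have he3 : ∀ i, ¬ Before B i → e i = f i := fun i hi => if_neg fun h => hi (mem_block.1 h).2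
    have hmemW : ∀ k, ∀ i ∈ F.seg k, e i ∈ F.W k.castSucc := fun k i hi => by
      rw [heseg k i hi]
      exact (hEA k).mem (hE k) (mem_block.1 hi).1
    have hmemO : ∀ k, ∀ i ∈ F.seg k, e i ∈ (F.W k.succ)ᗮ := fun k i hi => by
      rw [heseg k i hi]
      exact (hEB k).mem_orthogonal (mem_block.1 hi).2
    have hzero : ∀ k k', k < k' → ∀ i ∈ F.seg k, ∀ i' ∈ F.seg k',
        inner ℝ (e i) (e i') = (0 : ℝ) := by
      intro k k' hk i hi i' hi'
      refine (Submodule.mem_orthogonal' _ _).1 (hmemO k i hi) _ ?_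
      exact F.strictAnti.antitone (Fin.le_def.2 (by simpa using hk)) (hmemW k' i' hi')
    obtain ⟨oe, aA, aB⟩ : Orthonormal ℝ e ∧ Adp e A ∧ Adp e B := by
      refine frame_glue hAB ?_ ?_ ?_ ?_ ?_ ?_
      · intro i hi
        rw [he1 i hi]
        exact fA.mem_orthogonal hi
      · intro i hi
        obtain ⟨k, hk⟩ := F.exists_seg hi
        exact ⟨F.le_first _ (hmemW k i hk),
          Submodule.orthogonal_le (F.last_le _) (hmemO k i hk)⟩
      · intro i hi
        rw [he3 i hi]
        exact fB.mem hf hi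
      · intro i j hi hj
        rw [he1 i hi, he1 j hj, frame_inner_self hf]
      · intro i hi j hj
        obtain ⟨k, hk⟩ := F.exists_seg hi
        obtain ⟨k', hk'⟩ := F.exists_seg hj
        rcases lt_trichotomy k k' with h | h | h
        · rw [hzero k k' h i hk j hk', if_neg]
          exact (F.lt_of_seg_lt h hk hk').ne
        · subst h
          rw [heseg k i hk, heseg k j hk', frame_inner_self (hE k)]
        · rw [real_inner_comm, hzero k' k h j hk' i hk, if_neg]
          exact (F.lt_of_seg_lt h hk' hk).ne'
      · intro i j hi hj
        rw [he3 i hi, he3 j hj, frame_inner_self hf]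
    have aW : ∀ k i, ¬ Before (F.W k) i → e i ∈ F.W k := by
      intro k i hi
      by_cases hib : i ∈ block A B
      · obtain ⟨c, hc⟩ := F.exists_seg hib
        have hkc : k ≤ c.castSucc := by
          by_contra hcon
          have h1 : c.succ ≤ k := Fin.castSucc_lt_iff_succ_le.1 (not_le.1 hcon)
          exact hi ((mem_block.1 hc).2.mono (F.strictAnti.antitone h1))
        exact F.strictAnti.antitone hkc (hmemW c i hc)
      · have : ¬ Before B i := fun h => hib (mem_block.2 ⟨fun hA => hi (hA.mono (F.le_first k)), h⟩)
        exact F.last_le k (aB.mem oe this)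
    refine ⟨e, oe, aA, aB, adaptedTo_boundary.2 fun k A' B' q hq => ?_⟩
    have hlt := hq.bounds.2.2 (F.lt k)
    have hd := hEx k A' B' q hq
    refine hd.congr hlt.le oe (fun i hi => heseg k i (hq.block_subset hi)) fun i hi => ?_
    by_cases his : i ∈ F.seg k
    · obtain ⟨Q, μ, -, hfr⟩ := hd
      rw [heseg k i his]
      exact hfr.adpB.mem hfr.orth hi
    · refine hq.bounds.2.1 (aW _ i fun hb => his (mem_block.2 ⟨fun hA => hi ?_, hb⟩))
      exact (hA.mono hq.bounds.1).mono hlt.le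

lemma exists_velocity_sequence {A B : Submodule ℝ V} (x : Ass A B) :
    B ≤ A → ∃ φ : ℕ → Fin (finrank ℝ V) → ℝ, RhoTendsto atTop φ x ∧
      ∀ i ∈ block A B, ∀ i' ∈ block A B, i ≤ i' → ∀ᶠ j in atTop, φ j i' ≤ φ j i := by
  induction x with
  | @interior A B q =>
    intro hAB
    obtain ⟨Q, hQ, hf⟩ := PE.frame_spec hAB q
    refine ⟨fun _ => q.logEig, fun i _ i' _ k _ => ?_, fun i hi i' hi' hii =>
      Eventually.of_forall fun _ => hf.anti i hi i' hi' hii⟩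
    rw [rho]
    exact tendsto_const_nhds
  | @boundary A B m hm F v x ih =>
    intro hAB
    choose Φ hΦ hanti using fun k => ih k (F.lt k).le
    obtain ⟨ψ, hψ, rfl⟩ := v.exists_rep
    let M : ℕ → ℝ := fun j => ∑ k, ∑ i, |Φ k j i|
    have hM : ∀ j, 0 ≤ M j := fun j =>
      Finset.sum_nonneg fun _ _ => Finset.sum_nonneg fun _ _ => abs_nonneg _
    have hle : ∀ j k i, |Φ k j i| ≤ M j := fun j k i =>
      (Finset.single_le_sum (f := fun i => |Φ k j i|) (fun _ _ => abs_nonneg _)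
        (Finset.mem_univ i)).trans
      (Finset.single_le_sum (f := fun k => ∑ i, |Φ k j i|)
        (fun _ _ => Finset.sum_nonneg fun _ _ => abs_nonneg _) (Finset.mem_univ k))
    let s : ℕ → ℝ := fun j => ((j : ℝ) + 1) * (1 + M j)
    have hj1 : Tendsto (fun j : ℕ => (j : ℝ) + 1) atTop atTop :=
      tendsto_natCast_atTop_atTop.atTop_add tendsto_const_nhds
    have hs : Tendsto s atTop atTop := by
      refine tendsto_atTop_mono (fun j => ?_) hj1
      have := hM j
      exact le_mul_of_one_le_right (by positivity) (by linarith)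
    have hspos : ∀ j, 0 < s j := fun j => by
      have := hM j
      positivity
    have hsmall : ∀ k i, Tendsto (fun j => Φ k j i / s j) atTop (𝓝 0) := by
      intro k i
      refine squeeze_zero_norm (fun j => ?_) hj1.inv_tendsto_atTop
      rw [Real.norm_eq_abs, abs_div, abs_of_pos (hspos j), div_le_iff₀ (hspos j)]
      simp only [s, Pi.inv_apply]
      have h1 : (0 : ℝ) < (j : ℝ) + 1 := by positivity
      rw [inv_mul_cancel_left₀ h1.ne']
      have := hle j k i
      linarith
    let φ : ℕ → Fin (finrank ℝ V) → ℝ := fun j i => s j * ψ (F.idx hm i) + Φ (F.idx hm i) j i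
    have hφ : ∀ k, ∀ i ∈ F.seg k, ∀ j, φ j i = s j * ψ k + Φ k j i := fun k i hi j => by
      simp only [φ]
      rw [F.idx_eq hm hi]
    have hdir : ∀ (k k' : Fin m), ∀ i ∈ F.seg k, ∀ i' ∈ F.seg k',
        Tendsto (fun j => (φ j i - φ j i') / s j) atTop (𝓝 (ψ k - ψ k')) := by
      intro k k' i hi i' hi'
      have h1 := ((hsmall k i).sub (hsmall k' i')).const_add (ψ k - ψ k')
      rw [sub_zero, add_zero] at h1
      refine h1.congr fun j => ?_
      rw [hφ k i hi, hφ k' i' hi']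
      have := (hspos j).ne'
      field_simp
      ring
    refine ⟨φ, rhoTendsto_boundary hs hdir fun k i hi i' hi' i'' hi'' => ?_, ?_⟩
    · refine (hΦ k i hi i' hi' i'' hi'').congr fun j => ?_
      rw [hφ k i hi, hφ k i' hi', hφ k i'' hi'']
      congr 1 <;> ring
    · intro i hi i' hi' hii
      obtain ⟨k, hk⟩ := F.exists_seg hi
      obtain ⟨k', hk'⟩ := F.exists_seg hi'
      rcases lt_trichotomy k k' with h | h | h
      · have h1 := (hdir k k' i hk i' hk').eventually (lt_mem_nhds (sub_pos.2 (hψ h)))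
        filter_upwards [h1] with j hj
        have := (div_pos_iff_of_pos_right (hspos j)).1 hj
        linarith
      · subst h
        filter_upwards [hanti k i hk i' hk' hii] with j hj
        rw [hφ k i hk, hφ k i' hk']
        linarith
      · exact absurd (F.lt_of_seg_lt h hk' hk) hii.not_gt

lemma exists_approximation (x : Ass (⊤ : Submodule ℝ V) ⊥) {e : Fin (finrank ℝ V) → V}
    (he : Orthonormal ℝ e) :
    ∃ (X : ℕ → PosDefForm (SubQ (⊤ : Submodule ℝ V) ⊥)) (φ : ℕ → Fin (finrank ℝ V) → ℝ),
      (∀ j, QFrame (X j) e (φ j)) ∧ RhoTendsto atTop φ x := by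
  classical
  obtain ⟨φ, hφ, hanti⟩ := exists_velocity_sequence x bot_le
  let φ' : ℕ → Fin (finrank ℝ V) → ℝ := fun j => if Antitone (φ j) then φ j else 0
  have hφ' : ∀ j, Antitone (φ' j) := fun j => by
    by_cases h : Antitone (φ j)
    · simp [φ', h]
    · simp only [φ', h, if_false]
      exact antitone_const
  have hev : ∀ᶠ j in atTop, φ j = φ' j := by
    have h1 : ∀ᶠ j in atTop, ∀ i i', i ≤ i' → φ j i' ≤ φ j i := by
      refine eventually_all.2 fun i => eventually_all.2 fun i' => ?_
      by_cases hii : i ≤ i'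
      · filter_upwards [hanti i (mem_block_top_bot i) i' (mem_block_top_bot i') hii] with j hj _
        exact hj
      · exact Eventually.of_forall fun _ h => absurd h hii
    filter_upwards [h1] with j hj
    have : Antitone (φ j) := fun i i' h => hj i i' h
    simp [φ', this]
  have hX : ∀ j, ∃ Q : PosDefForm (SubQ (⊤ : Submodule ℝ V) ⊥), QFrame Q e (φ' j) := fun j =>
    exists_form_of_frame he (adp_top e) (adp_bot he) fun i _ i' _ h => hφ' j h
  choose X hX using hX
  refine ⟨X, φ', hX, fun i hi i' hi' k hk => (hφ i hi i' hi' k hk).congr' ?_⟩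
  filter_upwards [hev] with j hj
  rw [hj]

end Density

section Injectivity

variable {V : Type u} [NormedAddCommGroup V] [InnerProductSpace ℝ V] [FiniteDimensional ℝ V]

lemma AdaptedTo.adp {A B : Submodule ℝ V} {e : Fin (finrank ℝ V) → V} {x : Ass A B}
    (h : AdaptedTo e x) : Adp e A ∧ Adp e B := by
  induction x with
  | interior q =>
    obtain ⟨Q, μ, -, hf⟩ := adaptedTo_interior.1 h
    exact ⟨hf.adpA, hf.adpB⟩
  | @boundary A B m hm F v x ih =>
    rw [adaptedTo_boundary] at h
    have h0 := (ih ⟨0, by omega⟩ (h _)).1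
    have h1 := (ih ⟨m - 1, by omega⟩ (h _)).2
    have e0 : F.W (Fin.castSucc ⟨0, by omega⟩) = A := F.first
    have e1 : F.W (Fin.succ ⟨m - 1, by omega⟩) = B := by
      refine Eq.trans (congrArg F.W ?_) F.last
      ext
      simp only [Fin.val_succ, Fin.val_last]
      omega
    rw [e0] at h0
    rw [e1] at h1
    exact ⟨h0, h1⟩

lemma Adp.eq_of_finrank {A B : Submodule ℝ V} {e : Fin (finrank ℝ V) → V} (hA : Adp e A)
    (hB : Adp e B) (h : finrank ℝ A = finrank ℝ B) : A = B := by
  ext v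
  rw [hA v, hB v]
  unfold Before
  rw [h]

lemma finrank_le_of_block_subset {A B A' : Submodule ℝ V} (hlt : B < A)
    (h : ∀ i ∈ block A B, ¬ Before A' i) : finrank ℝ A ≤ finrank ℝ A' := by
  have h1 := Submodule.finrank_lt_finrank_of_lt hlt
  have h2 := Submodule.finrank_le A
  have h3 := h ⟨finrank ℝ V - finrank ℝ A, by omega⟩
    (mem_block.2 ⟨by simp only [Before]; omega, by simp only [Before]; omega⟩)
  simp only [Before] at h3
  omega

lemma dirDiff_eq_iff {α β α' β' : ℝ} (hα : 0 ≤ α) (hβ : 0 < β) (hα' : 0 ≤ α') (hβ' : 0 < β')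
    (h : dirDiff α β = dirDiff α' β') : α' = β' / β * α := by
  unfold dirDiff at h
  rw [abs_of_nonneg hα, abs_of_nonneg hα', abs_of_pos hβ, abs_of_pos hβ',
    div_eq_div_iff (by positivity) (by positivity)] at h
  field_simp
  linarith

lemma Flag.mem_seg_first {A B : Submodule ℝ V} {m : ℕ} (F : Flag A B m) (hm : 0 < m) {i}
    (hi : i ∈ block A B) (hmin : ∀ i' ∈ block A B, i ≤ i') : i ∈ F.seg ⟨0, hm⟩ := by
  obtain ⟨c, hc⟩ := F.exists_seg hi
  obtain ⟨i', hi'⟩ := F.seg_nonempty ⟨0, hm⟩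
  by_cases h : c = ⟨0, hm⟩
  · rwa [← h]
  · have : (⟨0, hm⟩ : Fin m) < c := lt_of_le_of_ne (Fin.le_def.2 (Nat.zero_le _)) (Ne.symm h)
    exact absurd (F.lt_of_seg_lt this hi' hc) (hmin i' (F.seg_subset _ hi')).not_gt

lemma Flag.mem_seg_last {A B : Submodule ℝ V} {m : ℕ} (F : Flag A B m) (hm : 0 < m) {i}
    (hi : i ∈ block A B) (hmax : ∀ i' ∈ block A B, i' ≤ i) :
    i ∈ F.seg ⟨m - 1, by omega⟩ := by
  obtain ⟨c, hc⟩ := F.exists_seg hi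
  obtain ⟨i', hi'⟩ := F.seg_nonempty ⟨m - 1, by omega⟩
  by_cases h : c = ⟨m - 1, by omega⟩
  · rwa [← h]
  · have : c < ⟨m - 1, by omega⟩ :=
      lt_of_le_of_ne (Fin.le_def.2 (by have := c.2; simp only; omega)) h
    exact absurd (F.lt_of_seg_lt this hc hi') (hmax i' (F.seg_subset _ hi')).not_gt

/-- The velocities of two boundary points with the same velocity coordinates are related by an
affine map. -/
lemma exists_affine_of_rho_eq {A B : Submodule ℝ V} {m m' : ℕ} {hm : 2 ≤ m} {hm' : 2 ≤ m'}
    {F : Flag A B m} {F' : Flag A B m'} {ψ : Fin m → ℝ} {ψ' : Fin m' → ℝ} {hψ : StrictAnti ψ}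
    {hψ' : StrictAnti ψ'} {x : ∀ k : Fin m, Ass (F.W k.castSucc) (F.W k.succ)}
    {y : ∀ k : Fin m', Ass (F'.W k.castSucc) (F'.W k.succ)}
    (h : ∀ i ∈ block A B, ∀ i' ∈ block A B, ∀ k ∈ block A B,
      rho (.boundary m hm F (Simplex.mk ψ hψ) x) i i' k =
        rho (.boundary m' hm' F' (Simplex.mk ψ' hψ') y) i i' k) :
    ∃ a b : ℝ, 0 < a ∧ ∀ i c d, i ∈ F.seg c → i ∈ F'.seg d → ψ' d = a * ψ c + b := by
  let c0 : Fin m := ⟨0, by omega⟩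
  let c1 : Fin m := ⟨m - 1, by omega⟩
  let d0 : Fin m' := ⟨0, by omega⟩
  let d1 : Fin m' := ⟨m' - 1, by omega⟩
  have hc01 : c0 < c1 := Fin.lt_def.2 (by simp only [c0, c1]; omega)
  have hd01 : d0 < d1 := Fin.lt_def.2 (by simp only [d0, d1]; omega)
  have hne : (block A B).Nonempty := by
    obtain ⟨i, hi⟩ := F.seg_nonempty c0
    exact ⟨i, F.seg_subset c0 hi⟩
  have hb0 := (block A B).min'_mem hne
  have hb1 := (block A B).max'_mem hne
  set i0 := (block A B).min' hne
  set i1 := (block A B).max' hne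
  have hmin : ∀ i' ∈ block A B, i0 ≤ i' := fun i' hi' => Finset.min'_le _ _ hi'
  have hmax : ∀ i' ∈ block A B, i' ≤ i1 := fun i' hi' => Finset.le_max' _ _ hi'
  have hi0 : i0 ∈ F.seg c0 := F.mem_seg_first _ hb0 hmin
  have hi1 : i1 ∈ F.seg c1 := F.mem_seg_last (by omega) hb1 hmax
  have hi0' : i0 ∈ F'.seg d0 := F'.mem_seg_first _ hb0 hmin
  have hi1' : i1 ∈ F'.seg d1 := F'.mem_seg_last (by omega) hb1 hmax
  have hβ : 0 < ψ c0 - ψ c1 := sub_pos.2 (hψ hc01)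
  have hβ' : 0 < ψ' d0 - ψ' d1 := sub_pos.2 (hψ' hd01)
  refine ⟨(ψ' d0 - ψ' d1) / (ψ c0 - ψ c1),
    ψ' d0 - (ψ' d0 - ψ' d1) / (ψ c0 - ψ c1) * ψ c0, div_pos hβ' hβ, fun i c d hc hd => ?_⟩
  have h1 := h i0 hb0 i (F.seg_subset c hc) i1 hb1
  rw [rho_boundary_ne rfl hi0 hc hi1 (fun h => hc01.ne h.2),
    rho_boundary_ne rfl hi0' hd hi1' (fun h => hd01.ne h.2)] at h1
  have h2 := dirDiff_eq_iff (sub_nonneg.2 (hψ.antitone (Fin.le_def.2 (Nat.zero_le _)))) hβ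
    (sub_nonneg.2 (hψ'.antitone (Fin.le_def.2 (Nat.zero_le _)))) hβ' h1
  linarith

lemma range_subset_of_rho_eq {A B : Submodule ℝ V} {m m' : ℕ} {hm : 2 ≤ m} {hm' : 2 ≤ m'}
    {F : Flag A B m} {F' : Flag A B m'} {ψ : Fin m → ℝ} {ψ' : Fin m' → ℝ} {hψ : StrictAnti ψ}
    {hψ' : StrictAnti ψ'} {x : ∀ k : Fin m, Ass (F.W k.castSucc) (F.W k.succ)}
    {y : ∀ k : Fin m', Ass (F'.W k.castSucc) (F'.W k.succ)} {e : Fin (finrank ℝ V) → V}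
    (hx : ∀ k, AdaptedTo e (x k)) (hy : ∀ k, AdaptedTo e (y k))
    (h : ∀ i ∈ block A B, ∀ i' ∈ block A B, ∀ k ∈ block A B,
      rho (.boundary m hm F (Simplex.mk ψ hψ) x) i i' k =
        rho (.boundary m' hm' F' (Simplex.mk ψ' hψ') y) i i' k) :
    Set.range F.W ⊆ Set.range F'.W := by
  obtain ⟨a, b, ha, hab⟩ := exists_affine_of_rho_eq h
  rintro _ ⟨k, rfl⟩
  induction k using Fin.lastCases with
  | last => exact ⟨Fin.last m', by rw [F.last, F'.last]⟩
  | cast c =>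
    obtain ⟨i, hi⟩ := F.seg_nonempty c
    obtain ⟨d, hd⟩ := F'.exists_seg (F.seg_subset c hi)
    refine ⟨d.castSucc, Adp.eq_of_finrank (hy d).adp.1 (hx c).adp.1 (le_antisymm ?_ ?_)⟩
    · refine finrank_le_of_block_subset (F'.lt d) fun i' hi' => ?_
      obtain ⟨c', hc'⟩ := F.exists_seg (F'.seg_subset d hi')
      have h1 := (hab i c d hi hd).symm.trans (hab i' c' d hc' hi')
      have h2 : ψ c = ψ c' := mul_left_cancel₀ ha.ne' (by linarith)
      rw [← hψ.injective h2] at hc'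
      exact (mem_block.1 hc').1
    · refine finrank_le_of_block_subset (F.lt c) fun i' hi' => ?_
      obtain ⟨d', hd'⟩ := F'.exists_seg (F.seg_subset c hi')
      have h1 : ψ' d = ψ' d' := (hab i c d hi hd).trans (hab i' c d' hi' hd').symm
      rw [← hψ'.injective h1] at hd'
      exact (mem_block.1 hd').1

/-- Points adapted to the same frame are determined by their velocity coordinates. -/
lemma eq_of_rho_eq {A B : Submodule ℝ V} {e : Fin (finrank ℝ V) → V} (x : Ass A B) :
    B ≤ A → ∀ y : Ass A B, AdaptedTo e x → AdaptedTo e y →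
      (∀ i ∈ block A B, ∀ i' ∈ block A B, ∀ k ∈ block A B, rho x i i' k = rho y i i' k) →
      x = y := by
  have mixed : ∀ {A B : Submodule ℝ V}, ∀ (q : PE (SubQ A B)) (m : ℕ) (hm : 2 ≤ m)
      (F : Flag A B m) (v : Simplex m) (x : ∀ k : Fin m, Ass (F.W k.castSucc) (F.W k.succ)),
      ¬ ∀ i ∈ block A B, ∀ i' ∈ block A B, ∀ k ∈ block A B,
        rho (.boundary m hm F v x) i i' k = rho (.interior q : Ass A B) i i' k := by
    intro A B q m hm F v x h
    obtain ⟨i0, hi0⟩ := F.seg_nonempty ⟨0, by omega⟩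
    obtain ⟨i1, hi1⟩ := F.seg_nonempty ⟨1, by omega⟩
    have h1 := h i0 (F.seg_subset _ hi0) i1 (F.seg_subset _ hi1) i1 (F.seg_subset _ hi1)
    rw [rho_boundary_lt hi0 hi1 (Fin.lt_def.2 (by simp))] at h1
    simp only [rho] at h1
    have h2 := abs_relDiff_self_lt (q.logEig i0 - q.logEig i1)
    rw [← h1] at h2
    norm_num at h2
  induction x with
  | @interior A B q =>
    intro hAB y hx hy h
    cases y with
    | interior q' =>
      obtain ⟨Q, μ, rfl, hf⟩ := adaptedTo_interior.1 hx
      obtain ⟨Q', μ', rfl, hf'⟩ := adaptedTo_interior.1 hy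
      have hd : ∀ i ∈ block A B, ∀ i' ∈ block A B, μ i - μ i' = μ' i - μ' i' := by
        intro i hi i' hi'
        have h1 := h i hi i' hi' i' hi'
        rw [rho_interior hAB hf hi hi' hi', rho_interior hAB hf' hi hi' hi'] at h1
        exact relDiff_self_injective h1
      have hdiag : ∀ a, (∀ i ∈ block A B, μ' i = μ i + a) → PE.mk Q = PE.mk Q' := by
        intro a ha
        refine PE.mk_eq.2 ⟨Real.exp a, Real.exp_pos _, fun w => ?_⟩
        induction w using Submodule.Quotient.induction_on with
        | H w =>
          change Q'.1 (cls B w) = _ * Q.1 (cls B w)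
          rw [hf.diag, hf'.diag, Finset.mul_sum]
          refine Finset.sum_congr rfl fun i hi => ?_
          rw [ha i hi, Real.exp_add]
          ring
      congr 1
      rcases (block A B).eq_empty_or_nonempty with hemp | ⟨p, hp⟩
      · exact hdiag 0 fun i hi => by simp [hemp] at hi
      · exact hdiag (μ' p - μ p) fun i hi => by linarith [hd i hi p hp]
    | boundary m hm F v y =>
      exact absurd (fun i hi i' hi' k hk => (h i hi i' hi' k hk).symm) (mixed q m hm F v y)
  | @boundary A B m hm F v x ih =>
    intro hAB y hx hy h
    cases y with
    | interior q => exact absurd h (mixed q m hm F v x)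
    | boundary m' hm' F' v' y =>
      obtain ⟨ψ, hψ, rfl⟩ := v.exists_rep
      obtain ⟨ψ', hψ', rfl⟩ := v'.exists_rep
      rw [adaptedTo_boundary] at hx hy
      have hr : Set.range F.W = Set.range F'.W :=
        (range_subset_of_rho_eq hx hy h).antisymm
          (range_subset_of_rho_eq hy hx fun i hi i' hi' k hk => (h i hi i' hi' k hk).symm)
      have hmm : m = m' := by
        have h1 : Nat.card (Set.range F.W) = m + 1 := by
          rw [Nat.card_range_of_injective F.strictAnti.injective, Nat.card_fin]
        have h2 : Nat.card (Set.range F'.W) = m' + 1 := by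
          rw [Nat.card_range_of_injective F'.strictAnti.injective, Nat.card_fin]
        rw [hr, h2] at h1
        omega
      subst hmm
      have hW : F.W = F'.W := (F.strictAnti.range_inj F'.strictAnti).1 hr
      have hF : F = F' := by
        cases F
        cases F'
        congr
      subst hF
      obtain ⟨a, b, ha, hab⟩ := exists_affine_of_rho_eq h
      have hv : Simplex.mk ψ hψ = Simplex.mk ψ' hψ' := Simplex.mk_eq.2 ⟨a, b, ha, fun k => by
        obtain ⟨i, hi⟩ := F.seg_nonempty k
        exact hab i k k hi hi⟩
      have hxy : x = y := by
        funext k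
        refine ih k (F.lt k).le (y k) (hx k) (hy k) fun i hi i' hi' i'' hi'' => ?_
        have := h i (F.seg_subset k hi) i' (F.seg_subset k hi') i'' (F.seg_subset k hi'')
        rwa [rho_boundary_same hi hi' hi'', rho_boundary_same hi hi' hi''] at this
      rw [hv, hxy]

/-- A point of the compactification is determined by its coordinates. -/
theorem eq_of_coords_eq {x y : Ass (⊤ : Submodule ℝ V) ⊥} (hρ : rho x = rho y)
    (hR : Rop x = Rop y) : x = y := by
  obtain ⟨e, he, -, -, hx⟩ := exists_adaptedTo x bot_le
  obtain ⟨X, φ, hX, hφ⟩ := exists_approximation x he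
  have hφy : RhoTendsto atTop φ y := fun i hi i' hi' k hk => by
    rw [← hρ]
    exact hφ i hi i' hi' k hk
  have hE : ∀ i, Tendsto (fun _ : ℕ => e i) atTop (𝓝 (e i)) := fun i => tendsto_const_nhds
  rcases subsingleton_or_nontrivial V with h0 | h0
  · have hN : finrank ℝ V = 0 := finrank_zero_of_subsingleton
    have hy : AdaptedTo e y := fun A' B' q hq => by
      obtain ⟨Q, rfl⟩ := PE.exists_rep q
      have hall : ∀ v : V, v = 0 := fun v => Subsingleton.elim _ _
      have hAB : B' ≤ A' := fun v _ => by rw [hall v]; exact A'.zero_mem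
      refine ⟨Q, 0, rfl, qframe_of_diag hAB he (adp_of_mem he fun i => absurd i.2 (by omega))
        (fun i => absurd i.2 (by omega)) fun v => ?_⟩
      have h1 : cls B' v = 0 := by
        rw [Subsingleton.elim v 0]
        rfl
      rw [h1, map_zero, Finset.sum_eq_zero fun i _ => absurd i.2 (by omega)]
    exact eq_of_rho_eq x bot_le y hx hy fun i _ i' _ k _ => by rw [hρ]
  have hy : AdaptedTo e y := fun A' B' q hq => by
    have hlt := hq.bounds.2.2 bot_lt_top
    obtain ⟨p, hp⟩ := block_nonempty hlt
    refine diagonalizes_of_diagOp_eq hlt.le he (p := p) ?_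
    rw [← hq.Rop_eq hp, ← hR]
    exact tendsto_nhds_unique (tendsto_frameOp_diagOp hE (hq.scaleTendsto hφy) hp)
      (hx.tendsto_frameOp hE hφ p)
  exact eq_of_rho_eq x bot_le y hx hy fun i _ i' _ k _ => by rw [hρ]

end Injectivity

section Triangular

lemma add_sq_le_weighted {ε : ℝ} (hε : 0 < ε) (a b : ℝ) :
    (a + b) ^ 2 ≤ (1 + ε) * a ^ 2 + (1 + ε⁻¹) * b ^ 2 := by
  have h : (1 + ε) * a ^ 2 + (1 + ε⁻¹) * b ^ 2 - (a + b) ^ 2 = (ε * a - b) ^ 2 * ε⁻¹ := by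
    field_simp
    ring
  have : 0 ≤ (ε * a - b) ^ 2 * ε⁻¹ := by positivity
  linarith

lemma sum_exp_fiberwise {I : Type*} [Fintype I] {m : ℕ} (ψ : Fin m → ℝ) (κ : I → Fin m)
    (c : I → ℝ) (t : ℝ) :
    ∑ i, Real.exp (ψ (κ i) * t) * c i = ∑ k, Real.exp (ψ k * t) * ∑ i with κ i = k, c i := by
  rw [← Finset.sum_fiberwise Finset.univ κ]
  refine Finset.sum_congr rfl fun k _ => ?_
  rw [Finset.mul_sum]
  refine Finset.sum_congr rfl fun i hi => ?_
  rw [(Finset.mem_filter.1 hi).2]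

/-- Diagonal forms in two bases which define the same flag and the same forms on its subquotients
are asymptotically equal. -/
lemma eventually_diagonal_le {E I J : Type*} [AddCommGroup E] [Module ℝ E] [Fintype I] [Fintype J]
    {m : ℕ} (b : Basis I ℝ E) (g : Basis J ℝ E) (κ : I → Fin m) (τ : J → Fin m) {ψ : Fin m → ℝ}
    (hψ : StrictAnti ψ)
    (h : ∀ k v, (∀ j, τ j < k → g.repr v j = 0) →
      ∑ i with κ i = k, b.repr v i ^ 2 = ∑ j with τ j = k, g.repr v j ^ 2)
    {C : ℝ} (hC : 1 < C) :
    ∀ᶠ t : ℝ in atTop, ∀ v, ∑ i, Real.exp (ψ (κ i) * t) * b.repr v i ^ 2 ≤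
      C * ∑ j, Real.exp (ψ (τ j) * t) * g.repr v j ^ 2 := by
  classical
  let ε : ℝ := (C - 1) / 2
  have hε : 0 < ε := by simp only [ε]; linarith
  let K : ℝ := ∑ i, ∑ j, b.repr (g j) i ^ 2
  have hK : 0 ≤ K := Finset.sum_nonneg fun _ _ => Finset.sum_nonneg fun _ _ => sq_nonneg _
  let K' : ℝ := (1 + ε⁻¹) * K
  have hK' : 0 ≤ K' := mul_nonneg (by positivity) hK
  have hlevel : ∀ k v, ∑ i with κ i = k, b.repr v i ^ 2 ≤
      (1 + ε) * ∑ j with τ j = k, g.repr v j ^ 2 + K' * ∑ j with τ j < k, g.repr v j ^ 2 := by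
    intro k v
    let u : E := ∑ j with τ j < k, g.repr v j • g j
    have hu : ∀ j, g.repr u j = if τ j < k then g.repr v j else 0 := by
      intro j
      simp only [u, map_sum, map_smul, Basis.repr_self, Finsupp.smul_single, smul_eq_mul, mul_one,
        Finsupp.coe_finsetSum, Finset.sum_apply, Finsupp.single_apply]
      rw [Finset.sum_ite_eq']
      simp
    have hw : ∀ j, g.repr (v - u) j = if τ j < k then 0 else g.repr v j := by
      intro j
      rw [map_sub, Finsupp.sub_apply, hu]
      split_ifs <;> simp
    have h1 := h k (v - u) fun j hj => by rw [hw, if_pos hj]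
    have h2 : ∑ j with τ j = k, g.repr (v - u) j ^ 2 = ∑ j with τ j = k, g.repr v j ^ 2 := by
      refine Finset.sum_congr rfl fun j hj => ?_
      rw [hw, if_neg]
      rw [(Finset.mem_filter.1 hj).2]
      exact lt_irrefl _
    have h3 : ∀ i, b.repr u i ^ 2 ≤
        (∑ j, b.repr (g j) i ^ 2) * ∑ j with τ j < k, g.repr v j ^ 2 := by
      intro i
      have h4 : b.repr u i = ∑ j with τ j < k, b.repr (g j) i * g.repr v j := by
        simp only [u, map_sum, map_smul, Finsupp.coe_finsetSum, Finset.sum_apply,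
          Finsupp.smul_apply, smul_eq_mul]
        exact Finset.sum_congr rfl fun j _ => mul_comm _ _
      rw [h4]
      refine (Finset.sum_mul_sq_le_sq_mul_sq _ _ _).trans ?_
      refine mul_le_mul_of_nonneg_right ?_ (Finset.sum_nonneg fun _ _ => sq_nonneg _)
      exact Finset.sum_le_sum_of_subset_of_nonneg (Finset.subset_univ _) fun _ _ _ => sq_nonneg _
    have h5 : ∑ i with κ i = k, b.repr u i ^ 2 ≤ K * ∑ j with τ j < k, g.repr v j ^ 2 := by
      refine (Finset.sum_le_sum_of_subset_of_nonneg (Finset.subset_univ _)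
        fun _ _ _ => sq_nonneg _).trans ((Finset.sum_le_sum fun i _ => h3 i).trans ?_)
      rw [← Finset.sum_mul]
    calc ∑ i with κ i = k, b.repr v i ^ 2
        ≤ ∑ i with κ i = k, ((1 + ε) * b.repr (v - u) i ^ 2 + (1 + ε⁻¹) * b.repr u i ^ 2) := by
          refine Finset.sum_le_sum fun i _ => ?_
          have := add_sq_le_weighted hε (b.repr (v - u) i) (b.repr u i)
          rwa [← Finsupp.add_apply, ← map_add, sub_add_cancel] at this
      _ = (1 + ε) * ∑ j with τ j = k, g.repr v j ^ 2 +
            (1 + ε⁻¹) * ∑ i with κ i = k, b.repr u i ^ 2 := by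
          rw [Finset.sum_add_distrib, ← Finset.mul_sum, ← Finset.mul_sum, h1, h2]
      _ ≤ _ := by
          have h6 : 0 ≤ 1 + ε⁻¹ := by positivity
          have := mul_le_mul_of_nonneg_left h5 h6
          simp only [K']
          linarith
  let δ : ℝ := ε / (m + 1)
  have hδ : 0 < δ := by positivity
  have hev : ∀ᶠ t : ℝ in atTop, ∀ k k' : Fin m, k' < k →
      K' * Real.exp (ψ k * t) ≤ δ * Real.exp (ψ k' * t) := by
    refine eventually_all.2 fun k => eventually_all.2 fun k' => ?_
    by_cases hk : k' < k
    · have h1 : Tendsto (fun t : ℝ => K' * Real.exp ((ψ k - ψ k') * t)) atTop (𝓝 (K' * 0)) := by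
        refine Tendsto.const_mul _ (Real.tendsto_exp_atBot.comp ?_)
        exact tendsto_id.const_mul_atTop_of_neg (sub_neg.2 (hψ hk))
      rw [mul_zero] at h1
      filter_upwards [h1.eventually (gt_mem_nhds hδ)] with t ht _
      have h2 : Real.exp (ψ k * t) = Real.exp ((ψ k - ψ k') * t) * Real.exp (ψ k' * t) := by
        rw [← Real.exp_add]
        ring_nf
      rw [h2, ← mul_assoc]
      exact mul_le_mul_of_nonneg_right ht.le (Real.exp_pos _).le
    · exact Eventually.of_forall fun _ h => absurd h hk
  filter_upwards [hev] with t ht v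
  have hR : 0 ≤ ∑ j, Real.exp (ψ (τ j) * t) * g.repr v j ^ 2 :=
    Finset.sum_nonneg fun _ _ => by positivity
  set R := ∑ j, Real.exp (ψ (τ j) * t) * g.repr v j ^ 2 with hRdef
  have hoff : ∀ k, K' * (Real.exp (ψ k * t) * ∑ j with τ j < k, g.repr v j ^ 2) ≤ δ * R := by
    intro k
    rw [hRdef, Finset.mul_sum, Finset.mul_sum, Finset.mul_sum]
    refine (Finset.sum_le_sum fun j hj => ?_).trans (Finset.sum_le_sum_of_subset_of_nonneg
      (Finset.subset_univ _) fun _ _ _ => by positivity)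
    rw [← mul_assoc, ← mul_assoc]
    exact mul_le_mul_of_nonneg_right (ht k _ (Finset.mem_filter.1 hj).2) (sq_nonneg _)
  calc ∑ i, Real.exp (ψ (κ i) * t) * b.repr v i ^ 2
      = ∑ k, Real.exp (ψ k * t) * ∑ i with κ i = k, b.repr v i ^ 2 := sum_exp_fiberwise ψ κ _ t
    _ ≤ ∑ k, ((1 + ε) * (Real.exp (ψ k * t) * ∑ j with τ j = k, g.repr v j ^ 2) +
          K' * (Real.exp (ψ k * t) * ∑ j with τ j < k, g.repr v j ^ 2)) := by
        refine Finset.sum_le_sum fun k _ => ?_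
        have := mul_le_mul_of_nonneg_left (hlevel k v) (Real.exp_pos (ψ k * t)).le
        linarith
    _ ≤ ∑ k : Fin m, ((1 + ε) * (Real.exp (ψ k * t) * ∑ j with τ j = k, g.repr v j ^ 2) +
          δ * R) := Finset.sum_le_sum fun k _ => by linarith [hoff k]
    _ = (1 + ε) * R + m * (δ * R) := by
        rw [Finset.sum_add_distrib, ← Finset.mul_sum, ← sum_exp_fiberwise ψ τ, Finset.sum_const, Finset.card_univ,
          Fintype.card_fin, nsmul_eq_mul]
    _ ≤ C * R := by
        have h1 : m * δ ≤ ε := by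
          simp only [δ]
          rw [mul_div_assoc', div_le_iff₀ (by positivity)]
          nlinarith
        have h2 : C = 1 + ε + ε := by simp only [ε]; ring
        have h3 := mul_le_mul_of_nonneg_right h1 hR
        rw [h2]
        linarith

/-- The basis given by a dual system of vectors and functionals. -/
def basisOfDual {E J : Type*} [AddCommGroup E] [Module ℝ E] [Fintype J] [DecidableEq J]
    (y : J → E →ₗ[ℝ] ℝ) (g : J → E) (h1 : ∀ i j, y i (g j) = if i = j then 1 else 0)
    (h2 : ∀ v, ∑ j, y j v • g j = v) : Basis J ℝ E :=
  Basis.ofEquivFun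
    { toFun := fun v j => y j v
      map_add' := fun v w => by ext j; simp
      map_smul' := fun a v => by ext j; simp
      invFun := fun c => ∑ j, c j • g j
      left_inv := fun v => h2 v
      right_inv := fun c => by ext j; simp [h1] }

lemma basisOfDual_repr {E J : Type*} [AddCommGroup E] [Module ℝ E] [Fintype J] [DecidableEq J]
    (y : J → E →ₗ[ℝ] ℝ) (g : J → E) (h1 : ∀ i j, y i (g j) = if i = j then 1 else 0)
    (h2 : ∀ v, ∑ j, y j v • g j = v) (v : E) (j : J) :
    (basisOfDual y g h1 h2).repr v j = y j v := by
  simp [basisOfDual]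

end Triangular

section Geodesics

variable {V : Type u} [NormedAddCommGroup V] [InnerProductSpace ℝ V] [FiniteDimensional ℝ V]
variable {ι : Type*} {l : Filter ι} {A B : Submodule ℝ V}

/-- The basis of `A / B` given by multiples of the vectors of an adapted frame. -/
lemma exists_frame_basis {f : Fin (finrank ℝ V) → V} (hf : Orthonormal ℝ f)
    (fA : Adp f A) (fB : Adp f B) (c : Fin (finrank ℝ V) → ℝ) (hc : ∀ i, c i ≠ 0) :
    ∃ g : Basis (block A B) ℝ (SubQ A B), ∀ (v : A) (j : block A B),
      g.repr (cls B v) j = c j * inner ℝ (f j) (v : V) := by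
  classical
  let y : block A B → SubQ A B →ₗ[ℝ] ℝ := fun j =>
    (B.submoduleOf A).liftQ (c j • (innerₛₗ ℝ (f j)) ∘ₗ A.subtype) fun v hv => by
      have h1 : (v : V) ∈ B := hv
      have h2 := (fB v).1 h1 j (mem_block.1 j.2).2
      simp [h2]
  have hy : ∀ j (v : A), y j (cls B v) = c j * inner ℝ (f j) (v : V) := fun j v => rfl
  have hfA : ∀ j : block A B, f j ∈ A := fun j => fA.mem hf (mem_block.1 j.2).1
  let g : block A B → SubQ A B := fun j => (c j)⁻¹ • cls B ⟨f j, hfA j⟩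
  refine ⟨basisOfDual y g (fun i j => ?_) (fun w => ?_), fun v j => ?_⟩
  · simp only [g, map_smul, hy, frame_inner_self hf, smul_eq_mul]
    by_cases hij : i = j
    · subst hij
      simp [hc]
    · have : (i : Fin (finrank ℝ V)) ≠ j := fun h => hij (Subtype.ext h)
      simp [hij, this]
  · induction w using Submodule.Quotient.induction_on with
    | H v =>
      have h1 : ∀ j, y j (cls B v) • g j = cls B (inner ℝ (f j) (v : V) • ⟨f j, hfA j⟩) := by
        intro j
        simp only [hy, g]
        rw [smul_smul, mul_right_comm, mul_inv_cancel₀ (hc j), one_mul]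
        rfl
      change ∑ j, y j (cls B v) • g j = cls B v
      simp only [h1]
      have h2 : ∑ j : block A B, cls B (inner ℝ (f j) (v : V) • (⟨f j, hfA j⟩ : A)) =
          cls B (∑ j : block A B, inner ℝ (f j) (v : V) • (⟨f j, hfA j⟩ : A)) :=
        (map_sum (B.submoduleOf A).mkQ _ _).symm
      rw [h2]
      refine (Submodule.Quotient.eq _).2 ?_
      change ((∑ j : block A B, inner ℝ (f j) (v : V) • (⟨f j, hfA j⟩ : A)) - v : A).1 ∈ B
      rw [fB]
      intro i hi
      simp only [Submodule.coe_sub, Submodule.coe_sum, Submodule.coe_smul, inner_sub_right,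
        inner_sum, inner_smul_right, frame_inner_self hf]
      by_cases hiA : Before A i
      · rw [(fA v).1 v.2 i hiA, Finset.sum_eq_zero, sub_zero]
        intro j _
        have : i ≠ j := fun h => (mem_block.1 j.2).1 (h ▸ hiA)
        simp [this]
      · rw [Finset.sum_eq_single ⟨i, mem_block.2 ⟨hiA, hi⟩⟩]
        · simp
        · intro j _ hj
          have : i ≠ j := fun h => hj (Subtype.ext h.symm)
          simp [this]
        · simp
  · rw [basisOfDual_repr, hy]

/-- Convergence of all the coordinates of a family of points. -/
def CoordTendsto (l : Filter ι) (γ : ι → Ass A B) (x : Ass A B) : Prop :=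
  (∀ i ∈ block A B, ∀ i' ∈ block A B, ∀ k ∈ block A B,
    Tendsto (fun j => rho (γ j) i i' k) l (𝓝 (rho x i i' k))) ∧
  ∀ p ∈ block A B, Tendsto (fun j => Rop (γ j) p) l (𝓝 (Rop x p))

/-- Transfer of convergence between families of forms with ratio tending to `1`. -/
lemma coordTendsto_of_ratio (hAB : B ≤ A) {Q Q' : ι → PosDefForm (SubQ A B)}
    {E' : ι → Fin (finrank ℝ V) → V} {M' : ι → Fin (finrank ℝ V) → ℝ}
    (h' : ∀ j, QFrame (Q' j) (E' j) (M' j))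
    (hr : ∀ C > (1 : ℝ), ∀ᶠ j in l, ∀ v, (Q j).1 v ≤ C * (Q' j).1 v ∧ (Q' j).1 v ≤ C * (Q j).1 v)
    {x : Ass A B} (hρ : RhoTendsto l M' x)
    {f : Fin (finrank ℝ V) → V} {c : Fin (finrank ℝ V) → Fin (finrank ℝ V) → ℝ}
    (hR : ∀ p ∈ block A B, Rop x p = diagOp f (c p))
    (hR' : ∀ p ∈ block A B, Tendsto (fun j => frameOp A B (E' j) (M' j) p) l (𝓝 (Rop x p))) :
    CoordTendsto l (fun j => .interior (PE.mk (Q j))) x := by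
  choose E M h using fun j => exists_qframe hAB (Q j)
  constructor
  · intro i hi i' hi' k hk
    have e1 := tendsto_eigenvalue_sub h h' hr hi
    have e2 := tendsto_eigenvalue_sub h h' hr hi'
    have e3 := tendsto_eigenvalue_sub h h' hr hk
    have h1 : Tendsto (fun j => relDiff (M j i - M j i') (M j i - M j k) -
        relDiff (M' j i - M' j i') (M' j i - M' j k)) l (𝓝 0) := by
      refine tendsto_relDiff_sub ?_ ?_
      · have := e1.sub e2
        rw [sub_zero] at this
        exact this.congr fun j => by ring
      · have := e1.sub e3
        rw [sub_zero] at this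
        exact this.congr fun j => by ring
    have h2 := h1.add (hρ i hi i' hi' k hk)
    rw [zero_add] at h2
    refine h2.congr fun j => ?_
    rw [rho_interior hAB (h j) hi hi' hk]
    ring
  · intro p hp
    simp only [Rop_interior hAB (h _) hp]
    rw [hR p hp]
    refine tendsto_diagOp_of_quadratic fun v => ?_
    have h1 := tendsto_frameOp_sub hAB h h' hr hp v
    have h2 := hR' p hp
    rw [hR p hp] at h2
    have h3 : Tendsto (fun j => inner ℝ (frameOp A B (E' j) (M' j) p v) v) l
        (𝓝 (inner ℝ (diagOp f (c p) v) v)) :=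
      (((ContinuousLinearMap.apply ℝ V v).continuous.tendsto _).comp h2).inner tendsto_const_nhds
    have h4 := h1.add h3
    rw [zero_add] at h4
    refine h4.congr fun j => ?_
    simp only [frameOp]
    ring

end Geodesics

section Geodesics

variable {V : Type u} [NormedAddCommGroup V] [InnerProductSpace ℝ V] [FiniteDimensional ℝ V]

/-- The exponents of a diagonal geodesic converge to its boundary data. -/
lemma rhoTendsto_linear {A B : Submodule ℝ V} {m : ℕ} {hm : 2 ≤ m} {F : Flag A B m}
    {ψ : Fin m → ℝ} {hψ : StrictAnti ψ}
    {q : ∀ k : Fin m, PosDefForm (SubQ (F.W k.castSucc) (F.W k.succ))}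
    {f : Fin (finrank ℝ V) → V} {ν : Fin (finrank ℝ V) → ℝ} (hf : ∀ k, QFrame (q k) f ν) :
    RhoTendsto atTop (fun (t : ℝ) i => ψ (F.idx hm i) * t + ν i)
      (.boundary m hm F (Simplex.mk ψ hψ) fun k => .interior (PE.mk (q k))) := by
  refine rhoTendsto_boundary (s := id) tendsto_id (fun k k' i hi i' hi' => ?_)
    fun k i hi i' hi' i'' hi'' => ?_
  · rw [F.idx_eq hm hi, F.idx_eq hm hi']
    have h1 := (tendsto_inv_atTop_zero (𝕜 := ℝ)).const_mul (ν i - ν i')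
    have h2 := h1.const_add (ψ k - ψ k')
    rw [mul_zero, add_zero] at h2
    refine h2.congr' ?_
    filter_upwards [eventually_gt_atTop 0] with t ht
    simp only [id_eq]
    field_simp
    ring
  · rw [F.idx_eq hm hi, F.idx_eq hm hi', F.idx_eq hm hi'',
      rho_interior (F.lt k).le (hf k) hi hi' hi'']
    refine tendsto_const_nhds.congr fun t => ?_
    congr 1 <;> ring

lemma tendsto_frameOp_linear {A B : Submodule ℝ V} (hAB : B ≤ A) {m : ℕ} (hm : 2 ≤ m)
    {F : Flag A B m} {ψ : Fin m → ℝ} (hψ : StrictAnti ψ) {f : Fin (finrank ℝ V) → V}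
    {ν : Fin (finrank ℝ V) → ℝ} {k : Fin m} {p} (hp : p ∈ F.seg k) :
    Tendsto (fun t : ℝ => frameOp A B f (fun i => ψ (F.idx hm i) * t + ν i) p) atTop
      (𝓝 (frameOp (F.W k.castSucc) (F.W k.succ) f ν p)) := by
  refine tendsto_diagOp (fun i => tendsto_const_nhds) fun i => ?_
  by_cases hA : Before A i
  · simp only [wt_before hA, wt_before (hA.mono (F.le_first _))]
    exact tendsto_const_nhds
  by_cases hB : Before B i
  · have hi : i ∈ block A B := mem_block.2 ⟨hA, hB⟩
    simp only [wt_block hi]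
    obtain ⟨c, hc⟩ := F.exists_seg hi
    rw [F.idx_eq hm hc, F.idx_eq hm hp]
    have hlin : ∀ t : ℝ, ψ c * t + ν i - (ψ k * t + ν p) = (ψ c - ψ k) * t + (ν i - ν p) :=
      fun t => by ring
    simp only [hlin]
    rcases lt_trichotomy c k with h | h | h
    · have hb : Before (F.W k.castSucc) i :=
        (mem_block.1 hc).2.mono (F.strictAnti.antitone (Fin.le_def.2 (by simpa using h)))
      rw [wt_before hb]
      refine Real.tendsto_sigmoid_atTop.comp (tendsto_atTop_add_const_right _ _ ?_)
      exact tendsto_id.const_mul_atTop (sub_pos.2 (hψ h))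
    · subst h
      rw [wt_block hc]
      simp
    · have hb : ¬ Before (F.W k.succ) i := fun hb => (mem_block.1 hc).1
        (hb.mono (F.strictAnti.antitone (Fin.le_def.2 (by simpa using h))))
      rw [wt_after (F.lt k).le hb]
      refine Real.tendsto_sigmoid_atBot.comp (tendsto_atBot_add_const_right _ _ ?_)
      exact tendsto_id.const_mul_atTop_of_neg (sub_neg.2 (hψ h))
  · simp only [wt_after hAB hB, wt_after (F.lt k).le fun h => hB (h.mono (F.last_le _))]
    exact tendsto_const_nhds

lemma eventually_antitone_linear {A B : Submodule ℝ V} {m : ℕ} (hm : 2 ≤ m) {F : Flag A B m}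
    {ψ : Fin m → ℝ} (hψ : StrictAnti ψ)
    {q : ∀ k : Fin m, PosDefForm (SubQ (F.W k.castSucc) (F.W k.succ))}
    {f : Fin (finrank ℝ V) → V} {ν : Fin (finrank ℝ V) → ℝ} (hf : ∀ k, QFrame (q k) f ν) :
    ∀ᶠ t : ℝ in atTop, ∀ i ∈ block A B, ∀ i' ∈ block A B, i ≤ i' →
      ψ (F.idx hm i') * t + ν i' ≤ ψ (F.idx hm i) * t + ν i := by
  refine eventually_all.2 fun i => eventually_imp_distrib_left.2 fun hi =>
    eventually_all.2 fun i' => eventually_imp_distrib_left.2 fun hi' =>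
    eventually_imp_distrib_left.2 fun hii => ?_
  obtain ⟨c, hc⟩ := F.exists_seg hi
  obtain ⟨c', hc'⟩ := F.exists_seg hi'
  rw [F.idx_eq hm hc, F.idx_eq hm hc']
  rcases lt_trichotomy c c' with h | h | h
  · have h1 : Tendsto (fun t : ℝ => (ψ c - ψ c') * t) atTop atTop :=
      tendsto_id.const_mul_atTop (sub_pos.2 (hψ h))
    filter_upwards [h1.eventually_ge_atTop (ν i' - ν i)] with t ht
    linarith
  · subst h
    filter_upwards with t
    have := (hf c).anti i hc i' hc' hii
    linarith
  · exact absurd (F.lt_of_seg_lt h hc' hc) hii.not_gt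

lemma IsGeodesicLimit.coordTendsto {A B : Submodule ℝ V} (hAB : B ≤ A) {c : ℝ → PE (SubQ A B)}
    {x : Ass A B} (h : IsGeodesicLimit c x) : CoordTendsto atTop (fun t => .interior (c t)) x := by
  classical
  rcases h with ⟨q, hc, rfl⟩ | ⟨m, hm, ψ, hψ, d, b, κ, Q, F, q, hQ, hc, hF, hq, rfl⟩
  · simp only [hc]
    exact ⟨fun _ _ _ _ _ _ => tendsto_const_nhds, fun _ _ => tendsto_const_nhds⟩
  obtain ⟨f, fo, fA, fB, hfx⟩ := exists_adaptedTo
    (.boundary m hm F (Simplex.mk ψ hψ) fun k => .interior (PE.mk (q k))) hAB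
  rw [adaptedTo_boundary] at hfx
  choose ν' hν' using fun k => (adaptedTo_interior.1 (hfx k)).qframe rfl
  let ν : Fin (finrank ℝ V) → ℝ := fun i => ν' (F.idx hm i) i
  have hν : ∀ k, ∀ i ∈ F.seg k, ν i = ν' k i := fun k i hi => by
    simp only [ν]
    rw [F.idx_eq hm hi]
  have hf : ∀ k, QFrame (q k) f ν := fun k =>
    ⟨fo, (hν' k).adpA, (hν' k).adpB, fun i hi j hj hij => by
      rw [hν k i hi, hν k j hj]
      exact (hν' k).anti i hi j hj hij, fun v => by
      rw [(hν' k).diag]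
      exact Finset.sum_congr rfl fun i hi => by rw [hν k i hi]⟩
  obtain ⟨g, hg⟩ := exists_frame_basis fo fA fB (fun i => Real.exp (ν i / 2))
    (fun i => (Real.exp_pos _).ne')
  have hg2 : ∀ (v : A) (j : block A B),
      g.repr (cls B v) j ^ 2 = Real.exp (ν j) * inner ℝ (f j) (v : V) ^ 2 := fun v j => by
    rw [hg, mul_pow, ← Real.exp_nat_mul]
    congr 2
    push_cast
    ring
  let τ : block A B → Fin m := fun j => F.idx hm j
  have hflag : ∀ (k : Fin m) (v : A),
      (∀ j, τ j < k → g.repr (cls B v) j = 0) ↔ (v : V) ∈ F.W k.castSucc := by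
    intro k v
    rw [(hf k).adpA]
    constructor
    · intro h i hi
      by_cases hiA : Before A i
      · exact (fA v).1 v.2 i hiA
      have hib : i ∈ block A B := mem_block.2 ⟨hiA, hi.mono (F.last_le _)⟩
      obtain ⟨c, hc⟩ := F.exists_seg hib
      have hck : c < k := by
        by_contra hcon
        exact (mem_block.1 hc).1
          (hi.mono (F.strictAnti.antitone (Fin.le_def.2 (by simpa using hcon))))
      have h1 := h ⟨i, hib⟩ (by simp only [τ]; rwa [F.idx_eq hm hc])
      rw [hg] at h1
      exact (mul_eq_zero.1 h1).resolve_left (Real.exp_pos _).ne'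
    · intro h j hj
      obtain ⟨c, hc⟩ := F.exists_seg j.2
      simp only [τ] at hj
      rw [F.idx_eq hm hc] at hj
      rw [hg, h j, mul_zero]
      exact (mem_block.1 hc).2.mono (F.strictAnti.antitone (Fin.le_def.2 (by simpa using hj)))
  have hlevel : ∀ (k : Fin m) (v : A), (v : V) ∈ F.W k.castSucc →
      ∑ i with κ i = k, b.repr (cls B v) i ^ 2 = ∑ j with τ j = k, g.repr (cls B v) j ^ 2 := by
    intro k v hv
    rw [← hq k v v.2 hv, (hf k).diag]
    simp only [hg2]
    symm
    refine Finset.sum_bij (fun j _ => j.1) ?_ ?_ ?_ ?_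
    · intro j hj
      obtain ⟨c, hc⟩ := F.exists_seg j.2
      have h1 := (Finset.mem_filter.1 hj).2
      simp only [τ] at h1
      rw [F.idx_eq hm hc] at h1
      rwa [← h1]
    · exact fun j _ j' _ h => Subtype.ext h
    · intro i hi
      refine ⟨⟨i, F.seg_subset k hi⟩, ?_, rfl⟩
      simp only [Finset.mem_filter, Finset.mem_univ, true_and, τ]
      exact F.idx_eq hm hi
    · exact fun j _ => rfl
  have hup : ∀ C > (1 : ℝ), ∀ᶠ t : ℝ in atTop, ∀ v,
      ∑ i, Real.exp (ψ (κ i) * t) * b.repr v i ^ 2 ≤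
        C * ∑ j, Real.exp (ψ (τ j) * t) * g.repr v j ^ 2 := fun C hC =>
    eventually_diagonal_le b g κ τ hψ (fun k w hw => by
      induction w using Submodule.Quotient.induction_on with
      | H v => exact hlevel k v ((hflag k v).1 hw)) hC
  have hlow : ∀ C > (1 : ℝ), ∀ᶠ t : ℝ in atTop, ∀ v,
      ∑ j, Real.exp (ψ (τ j) * t) * g.repr v j ^ 2 ≤
        C * ∑ i, Real.exp (ψ (κ i) * t) * b.repr v i ^ 2 := fun C hC =>
    eventually_diagonal_le g b τ κ hψ (fun k w hw => by
      induction w using Submodule.Quotient.induction_on with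
      | H v =>
        refine (hlevel k v ((hF k.castSucc v).2 fun i hi => hw i ?_)).symm
        exact Fin.lt_def.2 (by simpa using hi)) hC
  let P : ℝ → Prop := fun t => ∀ i ∈ block A B, ∀ i' ∈ block A B, i ≤ i' →
      ψ (F.idx hm i') * t + ν i' ≤ ψ (F.idx hm i) * t + ν i
  have hP : ∀ᶠ t in atTop, P t := eventually_antitone_linear hm hψ hf
  let M' : ℝ → Fin (finrank ℝ V) → ℝ := fun t i => if P t then ψ (F.idx hm i) * t + ν i else 0
  have hM' : ∀ t, P t → M' t = fun i => ψ (F.idx hm i) * t + ν i := fun t ht => by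
    simp [M', ht]
  have hex : ∀ t, ∃ Q' : PosDefForm (SubQ A B), QFrame Q' f (M' t) := fun t => by
    refine exists_form_of_frame fo fA fB fun i hi i' hi' hii => ?_
    by_cases ht : P t
    · rw [hM' t ht]
      exact ht i hi i' hi' hii
    · simp [M', ht]
  choose Q' hQ' using hex
  have hQ'eq : ∀ t, P t → ∀ v, (Q' t).1 v = ∑ j, Real.exp (ψ (τ j) * t) * g.repr v j ^ 2 := by
    intro t ht w
    induction w using Submodule.Quotient.induction_on with
    | H v =>
      change (Q' t).1 (cls B v) = ∑ j, Real.exp (ψ (τ j) * t) * g.repr (cls B v) j ^ 2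
      rw [(hQ' t).diag, hM' t ht, ← Finset.sum_coe_sort (block A B)]
      refine Finset.sum_congr rfl fun j _ => ?_
      rw [hg2, Real.exp_add, mul_assoc]
  have hcfun : (fun t => (.interior (c t) : Ass A B)) = fun t => .interior (PE.mk (Q t)) := by
    funext t
    rw [hc]
  rw [hcfun]
  refine coordTendsto_of_ratio hAB hQ' (fun C hC => ?_) ?_ (f := f)
    (c := fun p => wt (F.W (F.idx hm p).castSucc) (F.W (F.idx hm p).succ) ν p)
    (fun p hp => ?_) (fun p hp => ?_)
  · filter_upwards [hP, hup C hC, hlow C hC] with t h1 h2 h3 v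
    rw [hQ'eq t h1, hQ]
    exact ⟨h2 v, h3 v⟩
  · intro i hi i' hi' k hk
    refine (rhoTendsto_linear (hψ := hψ) hf i hi i' hi' k hk).congr' ?_
    filter_upwards [hP] with t ht
    rw [hM' t ht]
  · obtain ⟨k, hk⟩ := F.exists_seg hp
    rw [Rop_boundary hk, Rop_interior (F.lt k).le (hf k) hk, F.idx_eq hm hk]
    rfl
  · obtain ⟨k, hk⟩ := F.exists_seg hp
    rw [Rop_boundary hk, Rop_interior (F.lt k).le (hf k) hk]
    refine (tendsto_frameOp_linear hAB hm hψ hk).congr' ?_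
    filter_upwards [hP] with t ht
    rw [hM' t ht]

/-- The limit of a geodesic in terms of boundary data is its limit in the coordinates. -/
theorem IsAssLimit.coordTendsto {A B : Submodule ℝ V} {γ : ℝ → Ass A B} {x : Ass A B}
    (h : IsAssLimit γ x) : B ≤ A → CoordTendsto atTop γ x := by
  induction h with
  | interior c x h => exact fun hAB => h.coordTendsto hAB
  | boundary m hm F v γ x h ih =>
    intro hAB
    constructor
    · intro i hi i' hi' k hk
      obtain ⟨c, hc⟩ := F.exists_seg hi
      obtain ⟨c', hc'⟩ := F.exists_seg hi'
      obtain ⟨c'', hc''⟩ := F.exists_seg hk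
      by_cases hcc : c = c' ∧ c = c''
      · obtain ⟨rfl, rfl⟩ := hcc
        simp only [rho_boundary_same hc hc' hc'']
        exact (ih c (F.lt c).le).1 i hc i' hc' k hc''
      · obtain ⟨ψ, hψ, hv⟩ := v.exists_rep
        simp only [rho_boundary_ne hv hc hc' hc'' hcc]
        exact tendsto_const_nhds
    · intro p hp
      obtain ⟨c, hc⟩ := F.exists_seg hp
      simp only [Rop_boundary hc]
      exact (ih c (F.lt c).le).2 p hc

end Geodesics

section MatrixGeodesics

open Matrix

variable {d : ℕ}

lemma exists_orthogonal_diagonalization {S : Matrix (Fin d) (Fin d) ℝ} (hS : S.IsHermitian) :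
    ∃ U : Matrix (Fin d) (Fin d) ℝ, Uᵀ * U = 1 ∧ Uᵀ * S * U = diagonal hS.eigenvalues := by
  refine ⟨hS.eigenvectorUnitary, ?_, ?_⟩
  · have h := Unitary.coe_star_mul_self hS.eigenvectorUnitary
    rwa [star_eq_conjTranspose, conjTranspose_eq_transpose_of_trivial] at h
  · have h := hS.conjStarAlgAut_star_eigenvectorUnitary
    rw [Unitary.conjStarAlgAut_star_apply, star_eq_conjTranspose,
      conjTranspose_eq_transpose_of_trivial] at h
    rw [h]
    rfl

/-- Simultaneous diagonalization of a positive definite and a symmetric matrix. -/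
lemma exists_simultaneous_diagonalization {X S : Matrix (Fin d) (Fin d) ℝ} (hX : X.PosDef)
    (hS : Sᵀ = S) :
    ∃ (P : Matrix (Fin d) (Fin d) ℝ) (c : Fin d → ℝ),
      Pᵀ * X * P = 1 ∧ Pᵀ * S * P = diagonal c := by
  obtain ⟨U, hU, hUX⟩ := exists_orthogonal_diagonalization hX.1
  let D : Matrix (Fin d) (Fin d) ℝ := diagonal fun i => (√(hX.1.eigenvalues i))⁻¹
  have hB : (U * D)ᵀ * X * (U * D) = 1 := by
    rw [transpose_mul, show Dᵀ * Uᵀ * X * (U * D) = Dᵀ * (Uᵀ * X * U) * D by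
      simp only [Matrix.mul_assoc], hUX]
    simp only [D, diagonal_transpose, diagonal_mul_diagonal]
    rw [← diagonal_one]
    congr 1
    funext i
    have h := hX.eigenvalues_pos i
    have h2 := Real.mul_self_sqrt h.le
    have h3 := (Real.sqrt_pos.2 h).ne'
    rw [mul_right_comm, ← mul_inv, h2, inv_mul_cancel₀ h.ne']
  have hS' : ((U * D)ᵀ * S * (U * D)).IsHermitian := by
    rw [IsHermitian, conjTranspose_eq_transpose_of_trivial, transpose_mul,
      transpose_mul (U * D)ᵀ, transpose_transpose, hS, Matrix.mul_assoc]
  obtain ⟨R, hR, hRS⟩ := exists_orthogonal_diagonalization hS'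
  refine ⟨U * D * R, hS'.eigenvalues, ?_, ?_⟩
  · rw [transpose_mul, show Rᵀ * (U * D)ᵀ * X * (U * D * R) = Rᵀ * ((U * D)ᵀ * X * (U * D)) * R by
      simp only [Matrix.mul_assoc], hB, Matrix.mul_one, hR]
  · rw [transpose_mul, show Rᵀ * (U * D)ᵀ * S * (U * D * R) = Rᵀ * ((U * D)ᵀ * S * (U * D)) * R by
      simp only [Matrix.mul_assoc], hRS]

lemma differentiable_det {X : ℝ → Matrix (Fin d) (Fin d) ℝ}
    (hX : ∀ i j, Differentiable ℝ fun t => X t i j) : Differentiable ℝ fun t => (X t).det := by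
  simp only [det_apply]
  refine Differentiable.fun_sum fun σ _ => Differentiable.const_smul ?_ _
  exact Differentiable.fun_finsetProd fun i _ => hX _ _

lemma differentiable_inv {X : ℝ → Matrix (Fin d) (Fin d) ℝ}
    (hX : ∀ i j, Differentiable ℝ fun t => X t i j) (h0 : ∀ t, (X t).det ≠ 0) (i j : Fin d) :
    Differentiable ℝ fun t => (X t)⁻¹ i j := by
  simp only [Matrix.inv_def, Matrix.smul_apply, Ring.inverse_eq_inv', smul_eq_mul, adjugate_apply]
  refine Differentiable.mul ((differentiable_det hX).inv h0) (differentiable_det fun k l => ?_)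
  by_cases hk : k = j
  · subst hk
    simp only [updateRow_self]
    exact differentiable_const _
  · simp only [updateRow_ne hk]
    exact hX k l

lemma eq_exp_of_hasDerivAt {f : ℝ → ℝ} {c : ℝ} (hf : ∀ t, HasDerivAt f (f t * c) t) (t : ℝ) :
    f t = f 0 * Real.exp (c * t) := by
  have hg : ∀ s, HasDerivAt (fun s => f s * Real.exp (-(c * s))) 0 s := fun s => by
    have h1 : HasDerivAt (fun s => -(c * s)) (-(c * 1)) s :=
      ((hasDerivAt_id s).const_mul c).neg
    refine ((hf s).mul h1.exp).congr_deriv ?_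
    ring
  have h := is_const_of_deriv_eq_zero (fun s => (hg s).differentiableAt) (fun s => (hg s).deriv) t 0
  simp only [mul_zero, neg_zero, Real.exp_zero, mul_one] at h
  rw [← h, mul_assoc, ← Real.exp_add]
  simp

/-- Along a geodesic, `X⁻¹ X'` is constant. -/
lemma IsMatrixGeodesic.exists_velocity {X : ℝ → Matrix (Fin d) (Fin d) ℝ}
    (h : IsMatrixGeodesic X) :
    ∃ Y : Matrix (Fin d) (Fin d) ℝ, ∀ t i j, HasDerivAt (fun s => X s i j) ((X t * Y) i j) t := by
  obtain ⟨hpos, X', hX, hX'⟩ := h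
  have hdet : ∀ t, IsUnit (X t).det := fun t => (hpos t).det_pos.ne'.isUnit
  have hinv := differentiable_inv (fun i j t => (hX t i j).differentiableAt)
    fun t => (hdet t).ne_zero
  let Y : ℝ → Matrix (Fin d) (Fin d) ℝ := fun t => (X t)⁻¹ * X' t
  have hYd : ∀ i j, Differentiable ℝ fun t => Y t i j := fun i j => by
    simp only [Y, Matrix.mul_apply]
    exact Differentiable.fun_sum fun k _ =>
      (hinv i k).mul fun t => (hX' t k j).differentiableAt
  have hXY : ∀ t, X t * Y t = X' t := fun t => mul_nonsing_inv_cancel_left _ _ (hdet t)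
  let Y' : ℝ → Matrix (Fin d) (Fin d) ℝ := fun t i j => deriv (fun s => Y s i j) t
  have hY0 : ∀ t, Y' t = 0 := fun t => by
    have key : X' t * Y t + X t * Y' t = X' t * Y t := by
      ext i j
      have h1 : HasDerivAt (fun s => X' s i j)
          (∑ k, (X' t i k * Y t k j + X t i k * Y' t k j)) t := by
        have h2 : (fun s => X' s i j) = fun s => ∑ k, X s i k * Y s k j := by
          funext s
          rw [← hXY, Matrix.mul_apply]
        rw [h2]
        exact HasDerivAt.fun_sum fun k _ => (hX t i k).mul (hYd k j t).hasDerivAt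
      rw [Matrix.add_apply, Matrix.mul_apply, Matrix.mul_apply, ← Finset.sum_add_distrib, h1.unique (hX' t i j),
        Matrix.mul_assoc, Matrix.mul_apply]
    have h2 : X t * Y' t = 0 := by simpa using key
    have h3 := nonsing_inv_mul_cancel_left (A := X t) (Y' t) (hdet t)
    rw [h2, Matrix.mul_zero] at h3
    exact h3.symm
  refine ⟨Y 0, fun t i j => ?_⟩
  have hc : Y t = Y 0 := by
    ext i j
    exact is_const_of_deriv_eq_zero (hYd i j) (fun s => congrFun (congrFun (hY0 s) i) j) t 0
  rw [← hc, hXY]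
  exact hX t i j

/-- Geodesics are diagonal in a suitable basis. -/
lemma IsMatrixGeodesic.exists_diagonal {X : ℝ → Matrix (Fin d) (Fin d) ℝ}
    (h : IsMatrixGeodesic X) :
    ∃ (P : Matrix (Fin d) (Fin d) ℝ) (c : Fin d → ℝ), IsUnit P.det ∧
      ∀ t, Pᵀ * X t * P = diagonal fun i => Real.exp (c i * t) := by
  obtain ⟨Y, hY⟩ := h.exists_velocity
  have hsymm : ∀ t, (X t)ᵀ = X t := fun t => by
    have h1 := (h.1 t).1
    rwa [IsHermitian, conjTranspose_eq_transpose_of_trivial] at h1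
  have hS : (X 0 * Y)ᵀ = X 0 * Y := by
    ext i j
    have h1 : (fun s => X s j i) = fun s => X s i j := by
      funext s
      conv_lhs => rw [← hsymm s, transpose_apply]
    rw [transpose_apply, ← (hY 0 j i).deriv, ← (hY 0 i j).deriv, h1]
  obtain ⟨P, c, hP, hPS⟩ := exists_simultaneous_diagonalization (h.1 0) hS
  have hPu : IsUnit P.det := by
    have h1 := congrArg det hP
    rw [det_mul, det_one] at h1
    exact IsUnit.of_mul_eq_one_right _ h1
  refine ⟨P, c, hPu, fun t => ?_⟩
  have hYP : Y * P = P * diagonal c := by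
    have h1 : Pᵀ * X 0 * (Y * P) = Pᵀ * X 0 * (P * diagonal c) := by
      rw [← Matrix.mul_assoc (Pᵀ * X 0) P, hP, Matrix.one_mul, ← hPS]
      simp only [Matrix.mul_assoc]
    have h2 : IsUnit (Pᵀ * X 0).det := by
      rw [det_mul, det_transpose]
      exact hPu.mul (h.1 0).det_pos.ne'.isUnit
    have h3 := congrArg ((Pᵀ * X 0)⁻¹ * ·) h1
    simpa only [nonsing_inv_mul_cancel_left _ _ h2] using h3
  have hder : ∀ t i j, HasDerivAt (fun s => (Pᵀ * X s * P) i j) ((Pᵀ * X t * P) i j * c j) t := by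
    intro t i j
    have h1 : (Pᵀ * X t * P) i j * c j = (Pᵀ * (X t * Y) * P) i j := by
      rw [show Pᵀ * (X t * Y) * P = Pᵀ * X t * (Y * P) by simp only [Matrix.mul_assoc], hYP,
        ← Matrix.mul_assoc, mul_diagonal]
    rw [h1]
    have h2 : ∀ M : Matrix (Fin d) (Fin d) ℝ,
        (Pᵀ * M * P) i j = ∑ k, (∑ l, Pᵀ i l * M l k) * P k j := fun M => by
      simp only [Matrix.mul_apply]
    simp only [h2]
    exact HasDerivAt.fun_sum fun k _ => (HasDerivAt.fun_sum fun l _ =>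
      (hY t l k).const_mul _).mul_const _
  ext i j
  rw [eq_exp_of_hasDerivAt (fun t => hder t i j) t, hP]
  by_cases hij : i = j
  · subst hij
    simp
  · simp [hij]

end MatrixGeodesics

section GeodesicLimits

lemma IsGeodesic.exists_diagonal {E : Type u} [AddCommGroup E] [Module ℝ E] {γ : ℝ → PE E}
    (h : IsGeodesic γ) :
    ∃ (d : ℕ) (b : Basis (Fin d) ℝ E) (c : Fin d → ℝ) (Q : ℝ → PosDefForm E),
      (∀ t v, (Q t).1 v = ∑ i, Real.exp (c i * t) * b.repr v i ^ 2) ∧ ∀ t, γ t = PE.mk (Q t) := by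
  obtain ⟨d, b, X, Q, hX, hQ, hγ⟩ := h
  obtain ⟨P, c, hP, hPX⟩ := hX.exists_diagonal
  let L : (Fin d → ℝ) ≃ₗ[ℝ] (Fin d → ℝ) := Matrix.toLin'OfInv (M := P⁻¹) (M' := P)
    (Matrix.nonsing_inv_mul _ hP) (Matrix.mul_nonsing_inv _ hP)
  let b' : Basis (Fin d) ℝ E := Basis.ofEquivFun (b.equivFun.trans L.symm)
  have hb' : ∀ v i, b.repr v i = ∑ j, P i j * b'.repr v j := fun v i => by
    have h1 : P.mulVec (b'.equivFun v) = b.equivFun v := by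
      simp only [b', Basis.equivFun_ofEquivFun, LinearEquiv.trans_apply]
      exact (Matrix.toLin'_apply P _).symm.trans (L.apply_symm_apply (b.equivFun v))
    exact (congrFun h1 i).symm
  refine ⟨d, b', c, Q, fun t v => ?_, hγ⟩
  rw [hQ]
  have h1 : ∀ y : Fin d → ℝ, ∑ i, ∑ j, X t i j * P.mulVec y i * P.mulVec y j =
      ∑ i, Real.exp (c i * t) * y i ^ 2 := fun y => by
    have h2 : ∑ i, ∑ j, X t i j * P.mulVec y i * P.mulVec y j =
        P.mulVec y ⬝ᵥ (X t).mulVec (P.mulVec y) := by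
      refine Finset.sum_congr rfl fun i _ => ?_
      change _ = P.mulVec y i * ∑ j, X t i j * P.mulVec y j
      rw [Finset.mul_sum]
      exact Finset.sum_congr rfl fun j _ => by ring
    have h3 : P.mulVec y ⬝ᵥ (X t).mulVec (P.mulVec y) =
        y ⬝ᵥ (P.transpose * X t * P).mulVec y := by
      rw [← Matrix.mulVec_mulVec, ← Matrix.mulVec_mulVec, Matrix.dotProduct_mulVec y,
        Matrix.vecMul_transpose]
    rw [h2, h3, hPX]
    simp only [dotProduct, Matrix.mulVec_diagonal]
    exact Finset.sum_congr rfl fun i _ => by ring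
  rw [← h1]
  simp only [Matrix.mulVec, dotProduct, hb']

lemma exists_distinct_values {d : ℕ} (c : Fin d → ℝ) :
    ∃ (m : ℕ) (ψ : Fin m → ℝ) (κ : Fin d → Fin m), StrictAnti ψ ∧ Function.Surjective κ ∧
      ∀ i, c i = ψ (κ i) := by
  let s := Finset.univ.image c
  let ψ : Fin s.card → ℝ := fun k => s.orderEmbOfFin rfl k.rev
  have hψ : StrictAnti ψ := fun k l hkl =>
    (s.orderEmbOfFin rfl).strictMono (Fin.rev_lt_rev.2 hkl)
  have hκ : ∀ i, ∃ k, c i = ψ k := fun i => by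
    have h : c i ∈ Set.range (s.orderEmbOfFin rfl) := by
      rw [Finset.range_orderEmbOfFin]
      exact Finset.mem_image_of_mem _ (Finset.mem_univ i)
    obtain ⟨k, hk⟩ := h
    exact ⟨k.rev, by simp [ψ, hk]⟩
  choose κ hκ using hκ
  refine ⟨s.card, ψ, κ, hψ, fun k => ?_, hκ⟩
  obtain ⟨i, -, hi⟩ := Finset.mem_image.1 (s.orderEmbOfFin_mem rfl k.rev)
  exact ⟨i, hψ.injective ((hκ i).symm.trans hi)⟩

variable {V : Type u} [AddCommGroup V] [Module ℝ V] {A B : Submodule ℝ V}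

/-- The flag defined by a basis of `A / B` whose vectors are distributed among `m` levels. -/
def levelFlag (hAB : B ≤ A) {d m : ℕ} (b : Basis (Fin d) ℝ (SubQ A B)) (κ : Fin d → Fin m)
    (hκ : Function.Surjective κ) : Flag A B m where
  W k := (⨅ i, ⨅ _ : (κ i : ℕ) < k,
    LinearMap.ker (b.coord i ∘ₗ (B.submoduleOf A).mkQ)).map A.subtype
  strictAnti k l hkl := by
    refine lt_of_le_of_ne (Submodule.map_mono (iInf_mono fun i => ?_)) fun heq => ?_
    · exact le_iInf fun h => iInf_le_of_le (lt_trans h hkl) le_rfl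
    · obtain ⟨i, hi⟩ := hκ ⟨k, by have := l.2; have := Fin.lt_def.1 hkl; omega⟩
      obtain ⟨v, hv⟩ := Submodule.mkQ_surjective _ (b i)
      have heq' := Submodule.map_injective_of_injective A.injective_subtype heq
      have hvk : v ∈ ⨅ i, ⨅ _ : (κ i : ℕ) < k,
          LinearMap.ker (b.coord i ∘ₗ (B.submoduleOf A).mkQ) := by
        simp only [Submodule.mem_iInf, LinearMap.mem_ker, LinearMap.comp_apply, hv,
          Basis.coord_apply, Basis.repr_self]
        intro j hj
        refine Finsupp.single_eq_of_ne fun hij => ?_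
        subst hij
        simp [hi] at hj
      rw [← heq'] at hvk
      simp only [Submodule.mem_iInf, LinearMap.mem_ker, LinearMap.comp_apply,
        Basis.coord_apply] at hvk
      have h1 := hvk i (by simpa [hi] using hkl)
      rw [hv] at h1
      simp at h1
  first := by simp
  last := by
    have h1 : (⨅ i, ⨅ _ : (κ i : ℕ) < Fin.last m,
        LinearMap.ker (b.coord i ∘ₗ (B.submoduleOf A).mkQ)) = B.submoduleOf A := by
      ext v
      simp only [Submodule.mem_iInf, LinearMap.mem_ker, LinearMap.comp_apply, Basis.coord_apply]
      constructor
      · intro h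
        rw [← Submodule.Quotient.mk_eq_zero, ← Submodule.mkQ_apply]
        exact b.ext_elem fun i => by simpa using h i (by simp)
      · intro h i _
        rw [Submodule.mkQ_apply, (Submodule.Quotient.mk_eq_zero _).2 h]
        simp
    rw [h1, Submodule.submoduleOf, Submodule.map_comap_subtype, inf_eq_right.2 hAB]

lemma mem_levelFlag (hAB : B ≤ A) {d m : ℕ} (b : Basis (Fin d) ℝ (SubQ A B)) (κ : Fin d → Fin m)
    (hκ : Function.Surjective κ) (k : Fin (m + 1)) (v : A) :
    (v : V) ∈ (levelFlag hAB b κ hκ).W k ↔ ∀ i, (κ i : ℕ) < k → b.repr (cls B v) i = 0 := by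
  simp [levelFlag, Submodule.mem_iInf]

lemma IsGeodesic.exists_limit (hAB : B ≤ A) {γ : ℝ → PE (SubQ A B)} (h : IsGeodesic γ) :
    ∃ x, IsGeodesicLimit γ x := by
  obtain ⟨d, b, c, Q, hQ, hγ⟩ := h.exists_diagonal
  obtain ⟨m, ψ, κ, hψ, hκ, hc⟩ := exists_distinct_values c
  by_cases hm : 2 ≤ m
  · let F := levelFlag hAB b κ hκ
    have hF := mem_levelFlag hAB b κ hκ
    have hle : ∀ k, F.W k ≤ A := fun k => by
      conv_rhs => rw [← F.first]
      exact F.strictAnti.antitone (Fin.zero_le k)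
    have hq : ∀ k : Fin m, ∃ q : PosDefForm (SubQ (F.W k.castSucc) (F.W k.succ)),
        ∀ v : F.W k.castSucc, q.1 (cls _ v) =
          ∑ i with κ i = k, 1 * (b.coord i ∘ₗ (B.submoduleOf A).mkQ ∘ₗ
            Submodule.inclusion (hle k.castSucc)) v ^ 2 := fun k => by
      refine exists_posDefForm _ _ _ (fun _ _ => one_pos) fun v => ?_
      have h1 := (hF k.castSucc ⟨v, hle _ v.2⟩).1 v.2
      rw [show (v : V) = ((⟨v, hle _ v.2⟩ : A) : V) from rfl, hF k.succ]
      simp only [Finset.mem_filter, Finset.mem_univ, true_and]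
      constructor
      · rintro h i rfl
        exact h i (by simp)
      · intro h i hi
        rcases (Nat.lt_succ_iff.1 hi).lt_or_eq with h2 | h2
        · exact h1 i (by simpa using h2)
        · exact h i (Fin.ext h2)
    choose q hq using hq
    refine ⟨_, Or.inr ⟨m, hm, ψ, hψ, d, b, κ, Q, F, q, ?_, hγ, hF, ?_, rfl⟩⟩
    · intro t v
      simp only [hQ, hc]
    · intro k v hA hW
      rw [hq]
      simp only [one_mul]
      rfl
  · refine ⟨_, Or.inl ⟨γ 0, fun t => ?_, rfl⟩⟩
    have hsub : Subsingleton (Fin m) := by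
      rw [Fin.subsingleton_iff_le_one]
      omega
    rw [hγ, hγ, eq_comm, PE.mk_eq]
    rcases isEmpty_or_nonempty (Fin d) with hd | ⟨⟨i₀⟩⟩
    · exact ⟨1, one_pos, fun v => by simp [hQ]⟩
    · refine ⟨Real.exp (c i₀ * t), Real.exp_pos _, fun v => ?_⟩
      rw [hQ, hQ, Finset.mul_sum]
      refine Finset.sum_congr rfl fun i _ => ?_
      rw [hc i, hc i₀, Subsingleton.elim (κ i) (κ i₀)]
      simp

lemma IsAssGeodesic.exists_limit {γ : ℝ → Ass A B} (h : IsAssGeodesic γ) :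
    B ≤ A → ∃ x, IsAssLimit γ x := by
  induction h with
  | interior c hc =>
    intro hAB
    obtain ⟨x, hx⟩ := hc.exists_limit hAB
    exact ⟨x, .interior c x hx⟩
  | boundary m hm F v γ hγ ih =>
    intro _
    choose x hx using fun k => ih k (F.strictAnti.antitone (Fin.castSucc_le_succ k))
    exact ⟨_, .boundary m hm F v γ x hx⟩

end GeodesicLimits

section Continuity

/-- Pointwise convergence of forms is convergence relative to the limit form. -/
lemma eventually_abs_sub_le {E I ι : Type*} [AddCommGroup E] [Module ℝ E] [Fintype I]
    {l : Filter ι} (b : Basis I ℝ E) {Q : ι → QuadraticForm ℝ E} {Q₀ : QuadraticForm ℝ E}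
    (hQ₀ : ∀ v, Q₀ v = ∑ i, b.repr v i ^ 2) (hQ : ∀ v, Tendsto (fun j => Q j v) l (𝓝 (Q₀ v)))
    {η : ℝ} (hη : 0 < η) : ∀ᶠ j in l, ∀ v, |Q j v - Q₀ v| ≤ η * Q₀ v := by
  let β : ι → I → I → ℝ := fun j i i' =>
    QuadraticMap.associated (R := ℝ) (Q j - Q₀) (b i) (b i')
  have hβ : ∀ i i', Tendsto (fun j => β j i i') l (𝓝 0) := fun i i' => by
    have h1 : Tendsto (fun j => Q j (b i + b i') - Q₀ (b i + b i') -
        (Q j (b i) - Q₀ (b i)) - (Q j (b i') - Q₀ (b i'))) l (𝓝 (0 - 0 - 0)) := by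
      refine (Tendsto.sub ?_ ?_).sub ?_ <;>
      exact tendsto_sub_nhds_zero_iff.2 (hQ _)
    have h2 := h1.const_mul (2⁻¹ : ℝ)
    simp only [sub_zero, mul_zero] at h2
    refine h2.congr fun j => ?_
    have h3 := congrArg (fun B => B (b i) (b i')) (QuadraticMap.two_nsmul_associated ℝ (Q j - Q₀))
    simp only [LinearMap.smul_apply, QuadraticMap.polarBilin_apply_apply, QuadraticMap.polar,
      _root_.sub_apply, nsmul_eq_mul, Nat.cast_ofNat] at h3
    simp only [β]
    linarith
  let n : ℝ := Fintype.card I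
  have hn : 0 ≤ n := Nat.cast_nonneg _
  have hδ : 0 < η / (n + 1) := by positivity
  have hev : ∀ᶠ j in l, ∀ i i', |β j i i'| ≤ η / (n + 1) := by
    refine eventually_all.2 fun i => eventually_all.2 fun i' => ?_
    have h1 := (hβ i i').abs
    rw [abs_zero] at h1
    filter_upwards [h1.eventually (gt_mem_nhds hδ)] with j hj
    exact hj.le
  filter_upwards [hev] with j hj v
  have h1 : Q j v - Q₀ v = ∑ i, ∑ i', b.repr v i * (b.repr v i' * β j i i') := by
    have h2 : Q j v - Q₀ v = QuadraticMap.associated (R := ℝ) (Q j - Q₀) v v := by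
      rw [QuadraticMap.associated_eq_self_apply, _root_.sub_apply]
    rw [h2]
    conv_lhs => rw [← b.sum_repr v]
    simp only [map_sum, map_smul, LinearMap.sum_apply, LinearMap.smul_apply, smul_eq_mul,
      Finset.mul_sum, β]
    rw [Finset.sum_comm]
    exact Finset.sum_congr rfl fun i _ => Finset.sum_congr rfl fun i' _ => by ring
  have h2 : (∑ i, |b.repr v i|) ^ 2 ≤ n * Q₀ v := by
    have h3 := sq_sum_le_card_mul_sum_sq (s := Finset.univ) (f := fun i => |b.repr v i|)
    simpa [hQ₀, n] using h3
  have h0 : 0 ≤ Q₀ v := by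
    rw [hQ₀]
    exact Finset.sum_nonneg fun _ _ => sq_nonneg _
  calc |Q j v - Q₀ v| ≤ ∑ i, ∑ i', |b.repr v i| * (|b.repr v i'| * (η / (n + 1))) := by
        rw [h1]
        refine (Finset.abs_sum_le_sum_abs _ _).trans (Finset.sum_le_sum fun i _ =>
          (Finset.abs_sum_le_sum_abs _ _).trans (Finset.sum_le_sum fun i' _ => ?_))
        rw [abs_mul, abs_mul]
        have := hj i i'
        gcongr
    _ = η / (n + 1) * (∑ i, |b.repr v i|) ^ 2 := by
        rw [sq, Finset.sum_mul_sum, Finset.mul_sum]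
        refine Finset.sum_congr rfl fun i _ => ?_
        rw [Finset.mul_sum]
        exact Finset.sum_congr rfl fun i' _ => by ring
    _ ≤ η / (n + 1) * (n * Q₀ v) := by gcongr
    _ = η * Q₀ v * (n / (n + 1)) := by ring
    _ ≤ η * Q₀ v * 1 := by
        gcongr
        exact (div_le_one (by positivity)).2 (by linarith)
    _ = η * Q₀ v := mul_one _

variable {V : Type u} [NormedAddCommGroup V] [InnerProductSpace ℝ V] [FiniteDimensional ℝ V]

lemma PosDefForm.tendsto_iff {E ι : Type*} [AddCommGroup E] [Module ℝ E] {l : Filter ι}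
    {Q : ι → PosDefForm E} {Q₀ : PosDefForm E} :
    Tendsto Q l (𝓝 Q₀) ↔ ∀ v, Tendsto (fun j => (Q j).1 v) l (𝓝 (Q₀.1 v)) := by
  rw [nhds_induced, tendsto_comap_iff, tendsto_pi_nhds]
  rfl

lemma PE.continuous_mk {E : Type*} [AddCommGroup E] [Module ℝ E] :
    Continuous (PE.mk : PosDefForm E → PE E) := continuous_quotient_mk'

/-- The coordinates depend continuously on the form. -/
lemma coordTendsto_of_tendsto {A B : Submodule ℝ V} (hAB : B ≤ A) {ι : Type*} {l : Filter ι}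
    {Q : ι → PosDefForm (SubQ A B)} {Q₀ : PosDefForm (SubQ A B)} (h : Tendsto Q l (𝓝 Q₀)) :
    CoordTendsto l (fun j => .interior (PE.mk (Q j))) (.interior (PE.mk Q₀)) := by
  rw [PosDefForm.tendsto_iff] at h
  obtain ⟨e, μ, he⟩ := exists_qframe hAB Q₀
  obtain ⟨g, hg⟩ := exists_frame_basis he.orth he.adpA he.adpB (fun i => Real.exp (μ i / 2))
    (fun i => (Real.exp_pos _).ne')
  have hQ₀ : ∀ v, Q₀.1 v = ∑ i, g.repr v i ^ 2 := fun v => by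
    induction v using Submodule.Quotient.induction_on with
    | H v =>
      change Q₀.1 (cls B v) = ∑ i, g.repr (cls B v) i ^ 2
      rw [he.diag, ← Finset.sum_coe_sort]
      refine Finset.sum_congr rfl fun i _ => ?_
      rw [hg, mul_pow, ← Real.exp_nat_mul]
      congr 2
      push_cast
      ring
  refine coordTendsto_of_ratio hAB (Q' := fun _ => Q₀) (fun _ => he) (fun C hC => ?_)
    (fun i hi i' hi' k hk => ?_) (fun p hp => Rop_interior hAB he hp) fun p hp => ?_
  · have hη : 0 < (C - 1) / C := by
      have : 0 < C - 1 := by linarith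
      positivity
    filter_upwards [eventually_abs_sub_le g hQ₀ h hη] with j hj v
    have h1 := abs_le.1 (hj v)
    have h0 := posDef_nonneg Q₀ v
    have hC0 : 0 < C := by linarith
    have h2 : (C - 1) / C ≤ C - 1 := div_le_self (by linarith) hC.le
    have h3 := mul_le_mul_of_nonneg_right h2 h0
    have h4 : C * ((C - 1) / C * Q₀.1 v) = (C - 1) * Q₀.1 v := by
      field_simp
    constructor
    · linarith
    · have h5 := mul_le_mul_of_nonneg_left h1.1 hC0.le
      rw [mul_sub, mul_neg, h4] at h5
      linarith
  · rw [rho_interior hAB he hi hi' hk]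
    exact tendsto_const_nhds
  · rw [Rop_interior hAB he hp]
    exact tendsto_const_nhds

end Continuity

section Compactification

variable {V : Type u} [NormedAddCommGroup V] [InnerProductSpace ℝ V] [FiniteDimensional ℝ V]

/-- All the coordinates of a point of the compactification. -/
def coords (x : Ass (⊤ : Submodule ℝ V) ⊥) :
    (Fin (finrank ℝ V) → Fin (finrank ℝ V) → Fin (finrank ℝ V) → ℝ) ×
      (Fin (finrank ℝ V) → (V →L[ℝ] V)) :=
  (rho x, Rop x)

/-- The topology of the compactification. -/
instance instTopologicalSpaceAss : TopologicalSpace (Ass (⊤ : Submodule ℝ V) ⊥) :=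
  TopologicalSpace.induced coords inferInstance

lemma isEmbedding_coords : IsEmbedding (coords (V := V)) :=
  ⟨⟨rfl⟩, fun _ _ h => eq_of_coords_eq (congrArg Prod.fst h) (congrArg Prod.snd h)⟩

lemma tendsto_nhds_iff {ι : Type*} {l : Filter ι} {γ : ι → Ass (⊤ : Submodule ℝ V) ⊥}
    {x : Ass (⊤ : Submodule ℝ V) ⊥} : Tendsto γ l (𝓝 x) ↔ CoordTendsto l γ x := by
  rw [isEmbedding_coords.tendsto_nhds_iff, Prod.tendsto_iff]
  simp only [tendsto_pi_nhds, CoordTendsto, mem_block_top_bot, true_imp_iff, coords,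
    Function.comp_apply]

lemma tendsto_interior_iff {ι : Type*} {l : Filter ι}
    {X : ι → PosDefForm (SubQ (⊤ : Submodule ℝ V) ⊥)}
    {E : ι → Fin (finrank ℝ V) → V} {φ : ι → Fin (finrank ℝ V) → ℝ}
    (hX : ∀ j, QFrame (X j) (E j) (φ j)) {x : Ass (⊤ : Submodule ℝ V) ⊥} :
    Tendsto (fun j => (.interior (PE.mk (X j)) : Ass (⊤ : Submodule ℝ V) ⊥)) l (𝓝 x) ↔
      RhoTendsto l φ x ∧ ∀ p, Tendsto (fun j => frameOp ⊤ ⊥ (E j) (φ j) p) l (𝓝 (Rop x p)) := by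
  have h1 : ∀ j i i' k, rho (.interior (PE.mk (X j)) : Ass (⊤ : Submodule ℝ V) ⊥) i i' k =
      relDiff (φ j i - φ j i') (φ j i - φ j k) := fun j i i' k =>
    rho_interior bot_le (hX j) (mem_block_top_bot i) (mem_block_top_bot i') (mem_block_top_bot k)
  have h2 : ∀ j p, Rop (.interior (PE.mk (X j)) : Ass (⊤ : Submodule ℝ V) ⊥) p =
      frameOp ⊤ ⊥ (E j) (φ j) p := fun j p => Rop_interior bot_le (hX j) (mem_block_top_bot p)
  rw [tendsto_nhds_iff, CoordTendsto, RhoTendsto]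
  simp only [h1, h2, mem_block_top_bot, true_imp_iff]

theorem metrizableSpace_ass : TopologicalSpace.MetrizableSpace (Ass (⊤ : Submodule ℝ V) ⊥) :=
  isEmbedding_coords.metrizableSpace

theorem denseRange_interior :
    DenseRange (Ass.interior : PE (SubQ (⊤ : Submodule ℝ V) ⊥) → Ass ⊤ ⊥) := by
  intro x
  obtain ⟨e, he, -, -, hx⟩ := exists_adaptedTo x bot_le
  obtain ⟨X, φ, hX, hφ⟩ := exists_approximation x he
  refine mem_closure_of_tendsto (f := fun j => .interior (PE.mk (X j))) ((tendsto_interior_iff hX).2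
    ⟨hφ, fun p => hx.tendsto_frameOp (fun _ => tendsto_const_nhds) hφ p⟩)
    (Eventually.of_forall fun j => Set.mem_range_self _)

lemma exists_tendsto_ultrafilter {ι : Type*} (U : Ultrafilter ι)
    (X : ι → PosDefForm (SubQ (⊤ : Submodule ℝ V) ⊥)) :
    ∃ x, Tendsto (fun j => (.interior (PE.mk (X j)) : Ass (⊤ : Submodule ℝ V) ⊥)) U (𝓝 x) := by
  choose E φ hX using fun j => exists_qframe bot_le (X j)
  obtain ⟨e, he, hE⟩ := exists_frame_tendsto U fun j => (hX j).orth
  obtain ⟨x, hρ, hx⟩ := exists_limit U he (φ := φ) fun j i i' h =>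
    (hX j).anti i (mem_block_top_bot i) i' (mem_block_top_bot i') h
  exact ⟨x, (tendsto_interior_iff hX).2 ⟨hρ, hx.tendsto_frameOp hE hρ⟩⟩

lemma norm_coords_interior_le (q : PE (SubQ (⊤ : Submodule ℝ V) ⊥)) :
    ‖coords (.interior q)‖ ≤ 1 + finrank ℝ V := by
  obtain ⟨Q, rfl⟩ := q.exists_rep
  obtain ⟨e, μ, h⟩ := exists_qframe bot_le Q
  have h0 : (0 : ℝ) ≤ 1 + finrank ℝ V := by positivity
  refine norm_prod_le_iff.2 ⟨?_, ?_⟩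
  · refine (pi_norm_le_iff_of_nonneg h0).2 fun i => (pi_norm_le_iff_of_nonneg h0).2 fun i' =>
      (pi_norm_le_iff_of_nonneg h0).2 fun k => ?_
    simp only [coords]
    rw [rho_interior bot_le h (mem_block_top_bot i) (mem_block_top_bot i') (mem_block_top_bot k),
      Real.norm_eq_abs]
    have := abs_relDiff_lt_one (μ i - μ i') (μ i - μ k)
    have h1 : (0 : ℝ) ≤ finrank ℝ V := Nat.cast_nonneg _
    linarith
  · refine (pi_norm_le_iff_of_nonneg h0).2 fun p => ?_
    simp only [coords]
    rw [Rop_interior bot_le h (mem_block_top_bot p)]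
    have := norm_diagOp_le h.orth (c := wt ⊤ ⊥ μ p) (C := 1) fun i => by
      rw [abs_of_nonneg (wt_nonneg p i)]
      exact wt_le_one p i
    rw [frameOp]
    linarith

theorem compactSpace_ass : CompactSpace (Ass (⊤ : Submodule ℝ V) ⊥) := by
  let f : PosDefForm (SubQ (⊤ : Submodule ℝ V) ⊥) → Ass (⊤ : Submodule ℝ V) ⊥ :=
    fun Q => .interior (PE.mk Q)
  have : ProperSpace (V →L[ℝ] V) := FiniteDimensional.proper ℝ _
  have hcl : Set.range (coords (V := V)) = closure (Set.range (coords ∘ f)) := by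
    apply Set.Subset.antisymm
    · rintro _ ⟨x, rfl⟩
      refine closure_mono ?_ (image_closure_subset_closure_image isEmbedding_coords.continuous
        (Set.mem_image_of_mem _ (denseRange_interior x)))
      rintro _ ⟨_, ⟨q, rfl⟩, rfl⟩
      obtain ⟨Q, rfl⟩ := q.exists_rep
      exact ⟨Q, rfl⟩
    · intro p hp
      have hne : (comap (coords ∘ f) (𝓝 p)).NeBot := comap_neBot fun t ht => by
        obtain ⟨_, h1, ⟨Q, rfl⟩⟩ := mem_closure_iff_nhds.1 hp t ht
        exact ⟨Q, h1⟩
      let U := Ultrafilter.of (comap (coords ∘ f) (𝓝 p))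
      obtain ⟨x, hx⟩ := exists_tendsto_ultrafilter U id
      have h1 : Tendsto (coords ∘ f) U (𝓝 p) :=
        tendsto_comap.mono_left (Ultrafilter.of_le _)
      exact ⟨x, tendsto_nhds_unique ((isEmbedding_coords.continuous.tendsto x).comp hx) h1⟩
  have hbd : Bornology.IsBounded (Set.range (coords ∘ f)) :=
    (Metric.isBounded_closedBall (x := 0) (r := 1 + finrank ℝ V)).subset (by
      rintro _ ⟨Q, rfl⟩
      rw [mem_closedBall_zero_iff]
      exact norm_coords_interior_le _)
  rw [← isCompact_univ_iff, isEmbedding_coords.isCompact_iff, Set.image_univ, hcl]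
  exact hbd.isCompact_closure

theorem continuous_interior :
    Continuous (Ass.interior : PE (SubQ (⊤ : Submodule ℝ V) ⊥) → Ass ⊤ ⊥) := by
  have h : Continuous fun Q => (Ass.interior (PE.mk Q) : Ass (⊤ : Submodule ℝ V) ⊥) :=
    continuous_iff_continuousAt.2 fun Q₀ =>
      tendsto_nhds_iff.2 (coordTendsto_of_tendsto bot_le tendsto_id)
  exact isQuotientMap_quotient_mk'.continuous_iff.2 h

/-- Convergence to an interior point is convergence of forms up to factors. -/
lemma tendsto_of_tendsto_interior {u : ℕ → PE (SubQ (⊤ : Submodule ℝ V) ⊥)}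
    {q : PE (SubQ (⊤ : Submodule ℝ V) ⊥)}
    (h : Tendsto (fun j => (Ass.interior (u j) : Ass (⊤ : Submodule ℝ V) ⊥)) atTop
      (𝓝 (.interior q))) : Tendsto u atTop (𝓝 q) := by
  choose X hX using fun j => (u j).exists_rep
  choose E φ hE using fun j => exists_qframe bot_le (X j)
  simp only [hX] at h
  have hs := ((hybrid_iff hE _).2 ((tendsto_interior_iff hE).1 h)).2
  rw [SatakeTendsto] at hs
  obtain ⟨Q, a, rfl, ha, hQ⟩ := hs
  have hid : ∀ j v, (eigenTail (E j) ⊤).starProjection v = v := fun j v => by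
    rw [starProjection_eigenTail (hE j).orth]
    simp only [not_before_top, if_false]
    exact frame_sum (hE j).orth v
  have h1 : Tendsto (fun j => (X j).scale (a j) (ha j)) atTop (𝓝 Q) :=
    PosDefForm.tendsto_iff.2 fun v => by
      induction v using Submodule.Quotient.induction_on with
      | H v =>
        have h2 := (hQ v).2
        simp only [hid] at h2
        exact h2
  refine ((PE.continuous_mk.tendsto Q).comp h1).congr fun j => ?_
  rw [Function.comp_apply, ← PE.mk_scale, hX]

theorem isOpenEmbedding_interior :
    IsOpenEmbedding (Ass.interior : PE (SubQ (⊤ : Submodule ℝ V) ⊥) → Ass ⊤ ⊥) := by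
  have := metrizableSpace_ass (V := V)
  have hrange : Set.range (Ass.interior : PE (SubQ (⊤ : Submodule ℝ V) ⊥) → Ass ⊤ ⊥) =
      ⋂ i, ⋂ i', {x | |(coords x).1 i i' i'| < 1 / 2} := by
    ext x
    simp only [Set.mem_iInter, Set.mem_ofPred_eq]
    constructor
    · rintro ⟨q, rfl⟩ i i'
      simp only [coords, rho]
      exact abs_relDiff_self_lt _
    · intro h
      cases x with
      | interior q => exact ⟨q, rfl⟩
      | boundary m hm F v x =>
        obtain ⟨i, hi⟩ := F.seg_nonempty ⟨0, by omega⟩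
        obtain ⟨i', hi'⟩ := F.seg_nonempty ⟨1, by omega⟩
        have h1 := h i i'
        simp only [coords] at h1
        rw [rho_boundary_lt hi hi' (by simp [Fin.lt_def])] at h1
        norm_num at h1
  refine ⟨⟨isInducing_iff_nhds.2 fun q => le_antisymm
    continuous_interior.continuousAt.tendsto.le_comap ?_, fun q q' h => by injection h⟩, ?_⟩
  · have h : Tendsto id (comap Ass.interior (𝓝 (.interior q : Ass (⊤ : Submodule ℝ V) ⊥)))
        (𝓝 q) := tendsto_iff_seq_tendsto.2 fun u hu =>
      tendsto_of_tendsto_interior (tendsto_comap_iff.1 hu)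
    exact h
  · rw [hrange]
    refine isOpen_iInter_of_finite fun i => isOpen_iInter_of_finite fun i' => ?_
    refine isOpen_lt (Continuous.abs ?_) continuous_const
    have h := (isEmbedding_coords (V := V)).continuous
    exact (continuous_apply i').comp ((continuous_apply i').comp
      ((continuous_apply i).comp (continuous_fst.comp h)))

lemma IsEigenbasis.qframe_top_bot {Q : PosDefForm (SubQ (⊤ : Submodule ℝ V) ⊥)}
    {e : Fin (finrank ℝ V) → V} {μ : Fin (finrank ℝ V) → ℝ} (h : IsEigenbasis Q e μ) :
    QFrame Q e μ := by
  obtain ⟨e', he', heq⟩ := h.exists_qframe bot_le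
  rwa [show e' = e from funext fun i => heq i (mem_block_top_bot i)] at he'

end Compactification

end Neretin

end

theorem theorem5p1 (n : ℕ) :
    ∃ _ : TopologicalSpace (Neretin.AssPE n),
      CompactSpace (Neretin.AssPE n) ∧
      TopologicalSpace.MetrizableSpace (Neretin.AssPE n) ∧
      -- `PE_n` with its usual topology is an open dense subspace
      IsOpenEmbedding (Neretin.Ass.interior : Neretin.PE (Neretin.Full n) → Neretin.AssPE n) ∧
      DenseRange (Neretin.Ass.interior : Neretin.PE (Neretin.Full n) → Neretin.AssPE n) ∧
      -- limits of geodesics in `PE_n` and in all boundary symmetric spaces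
      (∀ γ : ℝ → Neretin.AssPE n, Neretin.IsAssGeodesic γ →
        (∃ x, Neretin.IsAssLimit γ x) ∧
          ∀ x, Neretin.IsAssLimit γ x → Tendsto γ atTop (𝓝 x)) ∧
      -- the topology is that of the hybrid of the velocity compactification and the
      -- Satake–Furstenberg compactification
      ∀ (X : ℕ → Neretin.PosDefForm (Neretin.Full n))
        (e : ℕ → Fin (Module.finrank ℝ (EuclideanSpace ℝ (Fin n))) → EuclideanSpace ℝ (Fin n))
        (φ : ℕ → Fin (Module.finrank ℝ (EuclideanSpace ℝ (Fin n))) → ℝ),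
        (∀ j, Neretin.IsEigenbasis (X j) (e j) (φ j)) →
          ∀ x : Neretin.AssPE n,
            Tendsto (fun j => (Neretin.Ass.interior (Neretin.PE.mk (X j)) : Neretin.AssPE n))
                atTop (𝓝 x) ↔
              Neretin.VelocityTendsto φ x ∧ Neretin.SatakeTendsto X e x := by
  refine ⟨inferInstance, Neretin.compactSpace_ass, Neretin.metrizableSpace_ass,
    Neretin.isOpenEmbedding_interior, Neretin.denseRange_interior, fun γ hγ =>
    ⟨hγ.exists_limit bot_le, fun x hx => Neretin.tendsto_nhds_iff.2 (hx.coordTendsto bot_le)⟩,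
    fun X e φ h x => ?_⟩
  have hX := fun j => (h j).qframe_top_bot
  rw [Neretin.tendsto_interior_iff hX, Neretin.hybrid_iff hX]
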